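/- Let $n\ge 3$ and $I=(-1,1)$. An *ovaloid* in $\mathbb R^{n-1}$ is a compact connected embedded smooth hypersurface without boundary all of whose principal curvatures with respect to the outer unit normal $N$ (the one pointing into the unbounded component of the complement; $dN(v)=\kappa v$) are positive. A map $\gamma:\mathbb S^{n-2}\to\mathbb R^{n-1}$ *support-parametrizes* a set $\mathcal O\subset\mathbb R^{n-1}$ if $\mathcal O$ is an ovaloid and $\gamma$ is the inverse of its Gauss map $N:\mathcal O\to\mathbb S^{n-2}$. A *transversely convex tube in standard position* is the image $\mathcal T\subset\mathbb R^{n-1}\times\mathbb R$ of a smooth embedding $X:\mathbb S^{n-2}\times I\to\mathbb R^{n-1}\times\mathbb R$ of the form $X(u,z)=(c(z)+\alpha(u,z),z)$, where $c:I\to\mathbb R^{n-1}$ and $\alpha:\mathbb S^{n-2}\times I\to\mathbb R^{n-1}$ are smooth and, for each $z\in I$, $\alpha(\mathbb S^{n-2},z)$ is an ovaloid with center of mass (as a hypersurface) at the origin. Let $\mathcal T$ be a bounded transversely convex tube in standard position. For $z\in I$ put $\mathcal O(z)=\{p\in\mathbb R^{n-1}:(p,z)\in\mathcal T\}$. Then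 there is a unique map $\Gamma:\mathbb S^{n-2}\times I\to\mathbb R^{n-1}$ (the *support map* of $\mathcal T$) such that $\Gamma(\cdot,z)$ support-parametrizes $\mathcal O(z)$ for every $z\in I$, and $\Gamma$ is smooth. For $z_0\in I$, $\tau\in\mathbb S^{n-2}$ and $\epsilon\in\mathbb R$ let $$\mathcal O_\tau(z_0,\epsilon)=\{p\in\mathbb R^{n-1}: (p,z)\in\mathcal T \text{ for } z=z_0+\epsilon\,(p\cdot\tau)\}$$ be the projection to $\mathbb R^{n-1}$ of the tilted slice of $\mathcal T$, and let $\tau^{T}(u)=\tau-(\tau\cdot u)u$ be the tangential part of $\tau$ at $u\in\mathbb S^{n-2}$. Then for every $z_0\in I$ and $\tau\in\mathbb S^{n-2}$ there are $\delta>0$, a smooth function $z:(-\delta,\delta)\times\mathbb S^{n-2}\to I$ with $z(0,\cdot)\equiv z_0$ such that, for all $|\epsilon|<\delta$ and $u\in\mathbb S^{n-2}$, $z(\epsilon,u)$ is the unique $z\in I$ with $z=z_0+\epsilon\,\tau\cdot\Gamma(u,z)$, and diffeomorphisms $\theta_\epsilon:\mathbb S^{n-2}\to\mathbb S^{n-2}$,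 $|\epsilon|<\delta$, with $(\epsilon,u)\mapsto\theta_\epsilon(u)$ smooth, such that 1. for every $|\epsilon|<\delta$ the map $u\mapsto\Gamma\bigl(\theta_\epsilon(u),z(\epsilon,\theta_\epsilon(u))\bigr)$ support-parametrizes $\mathcal O_\tau(z_0,\epsilon)$; 2. $\theta_0=\mathrm{id}$; 3. $\displaystyle\frac{\partial\theta_\epsilon}{\partial\epsilon}(u)\Big|_{\epsilon=0}=\Bigl(u\cdot\frac{\partial\Gamma}{\partial z}(u,z_0)\Bigr)\,\tau^{T}(u)$ for every $u\in\mathbb S^{n-2}$. -/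

import Mathlib

open scoped Manifold ContDiff

noncomputable section

namespace ConvexTube

/-- Euclidean space `ℝ^(d+1)`; with `n = d + 2` this is `ℝ^(n-1)`. -/
abbrev Euc (d : ℕ) : Type := EuclideanSpace ℝ (Fin (d + 1))

/-- The unit sphere `𝕊^d = 𝕊^(n-2)` of `ℝ^(d+1)`, with Mathlib's manifold structure. -/
abbrev Sph (d : ℕ) : Type := Metric.sphere (0 : EuclideanSpace ℝ (Fin (d + 1))) 1

/-- The open interval `I = (-1, 1)`. -/
abbrev I : Set ℝ := Set.Ioo (-1) 1

/-- The union of the unbounded connected components of the complement of `O`. -/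
def exterior {d : ℕ} (O : Set (Euc d)) : Set (Euc d) :=
  {x | x ∉ O ∧ ¬ Bornology.IsBounded (connectedComponentIn Oᶜ x)}

/-- The function `f` exhibits `O` near `p` as a regular smooth level hypersurface `f = 0`, with
`f > 0` exactly on the unbounded side. -/
structure IsOutwardDefiningFunction {d : ℕ} (O : Set (Euc d)) (p : Euc d)
    (U : Set (Euc d)) (f : Euc d → ℝ) : Prop where
  isOpen : IsOpen U
  mem : p ∈ U
  smooth : ContDiffOn ℝ ∞ f U
  regular : ∀ x ∈ U, gradient f x ≠ 0
  mem_iff : ∀ x ∈ U, x ∈ O ↔ f x = 0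
  exterior_iff : ∀ x ∈ U, x ∈ exterior O ↔ 0 < f x

/-- The normalized gradient of `f`. -/
def unitNormal {d : ℕ} (f : Euc d → ℝ) (x : Euc d) : Euc d :=
  ‖gradient f x‖⁻¹ • gradient f x

/-- `u` is the outer unit normal of the hypersurface `O` at the point `p`. -/
def IsOuterUnitNormal {d : ℕ} (O : Set (Euc d)) (p u : Euc d) : Prop :=
  p ∈ O ∧ ∃ U f, IsOutwardDefiningFunction O p U f ∧ u = unitNormal f p

/-- `κ` is a principal curvature of the hypersurface `O` at `p` with respect to the outer unit
normal field `N`: there is a tangent vector `v ≠ 0` with `dN(v) = κ v`. -/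
def IsPrincipalCurvature {d : ℕ} (O : Set (Euc d)) (p : Euc d) (κ : ℝ) : Prop :=
  p ∈ O ∧ ∃ U f, IsOutwardDefiningFunction O p U f ∧
    ∃ v : Euc d, v ≠ 0 ∧ inner ℝ (gradient f p) v = 0 ∧
      fderiv ℝ (unitNormal f) p v = κ • v

/-- An ovaloid: a closed (compact, connected, boundaryless) embedded smooth hypersurface of
`ℝ^(d+1)` all of whose principal curvatures with respect to the outer unit normal are positive. -/
structure IsOvaloid {d : ℕ} (O : Set (Euc d)) : Prop where
  isCompact : IsCompact O
  isConnected : IsConnected O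
  hypersurface : ∀ p ∈ O, ∃ U f, IsOutwardDefiningFunction O p U f
  curvature_pos : ∀ p κ, IsPrincipalCurvature O p κ → 0 < κ

/-- `γ` is the support parametrization of the ovaloid `O`: the inverse of its Gauss map. -/
structure IsSupportParametrization {d : ℕ} (γ : Sph d → Euc d) (O : Set (Euc d)) : Prop where
  isOvaloid : IsOvaloid O
  range_eq : Set.range γ = O
  normal : ∀ u : Sph d, IsOuterUnitNormal O (γ u) u

/-- The inverse of the Gauss map of `O`: the point of `O` at which the outer unit normal is `u`. -/
def gaussInverse {d : ℕ} (O : Set (Euc d)) (u : Sph d) : Euc d :=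
  Classical.epsilon fun p => IsOuterUnitNormal O p u

/-- The map `X(u, z) = (c(z) + α(u, z), z)`. -/
def tubeMap {d : ℕ} (c : ℝ → Euc d) (α : Sph d × ℝ → Euc d) (q : Sph d × ℝ) : Euc d × ℝ :=
  (c q.2 + α q, q.2)

/-- The restriction of `X` to `𝕊^d × I` is a smooth embedding: it is smooth, has injective
differentials, and is a homeomorphism onto its image. -/
structure IsEmbeddingOnTube {d : ℕ} (X : Sph d × ℝ → Euc d × ℝ) : Prop where
  smooth : ContMDiffOn ((𝓡 d).prod 𝓘(ℝ, ℝ)) 𝓘(ℝ, Euc d × ℝ) ∞ X (Set.univ ×ˢ I)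
  immersion : ∀ q ∈ (Set.univ : Set (Sph d)) ×ˢ I,
    Function.Injective (mfderiv ((𝓡 d).prod 𝓘(ℝ, ℝ)) 𝓘(ℝ, Euc d × ℝ) X q)
  embedding : Topology.IsEmbedding (((Set.univ : Set (Sph d)) ×ˢ I).domRestrict X)

open MeasureTheory in
/-- `T` is a transversely convex tube in standard position in `ℝ^(d+1) × ℝ`. The centre of mass
of the hypersurface `α(𝕊^d, z)` is taken with respect to its `d`-dimensional area. -/
def IsTransverselyConvexTube {d : ℕ} (T : Set (Euc d × ℝ)) : Prop :=
  ∃ (c : ℝ → Euc d) (α : Sph d × ℝ → Euc d),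
    ContDiffOn ℝ ∞ c I ∧
    ContMDiffOn ((𝓡 d).prod 𝓘(ℝ, ℝ)) 𝓘(ℝ, Euc d) ∞ α (Set.univ ×ˢ I) ∧
    IsEmbeddingOnTube (tubeMap c α) ∧
    (∀ z ∈ I, IsOvaloid (Set.range fun u => α (u, z)) ∧
      ∫ x in Set.range (fun u => α (u, z)), x ∂(Measure.hausdorffMeasure (d : ℝ)) = 0) ∧
    T = tubeMap c α '' (Set.univ ×ˢ I)

/-- The horizontal cross-section of `T` at height `z`, as a subset of `ℝ^(d+1)`. -/
def horizontalSlice {d : ℕ} (T : Set (Euc d × ℝ)) (z : ℝ) : Set (Euc d) :=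
  {p | (p, z) ∈ T}

/-- The support map `Γ(u, z)` of `T`: for each `z`, the inverse of the Gauss map of the horizontal
cross-section at height `z`. -/
def supportMap {d : ℕ} (T : Set (Euc d × ℝ)) (u : Sph d) (z : ℝ) : Euc d :=
  gaussInverse (horizontalSlice T z) u

/-- The hyperplane `z = z₀ + ε (p · τ)`. -/
def tiltedHyperplane {d : ℕ} (τ : Sph d) (z₀ ε : ℝ) : Set (Euc d × ℝ) :=
  {q | q.2 = ε * inner ℝ q.1 (τ : Euc d) + z₀}

/-- The projection `O_τ(z₀, ε)` to `ℝ^(d+1)` of the tilted cross-section of `T`. -/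
def projectedSlice {d : ℕ} (T : Set (Euc d × ℝ)) (τ : Sph d) (z₀ ε : ℝ) : Set (Euc d) :=
  Prod.fst '' (T ∩ tiltedHyperplane τ z₀ ε)

/-- The orthogonal projection of `τ` to the tangent space of the sphere at `u`. -/
def tangentialPart {d : ℕ} (τ u : Sph d) : Euc d :=
  (τ : Euc d) - inner ℝ (τ : Euc d) (u : Euc d) • (u : Euc d)

/-- `ζ` is the smooth height function on `(-δ, δ) × 𝕊^d`: `ζ(0, u) = z₀`, and `z = ζ(ε, u)` is the
only solution in `I` of `z = z₀ + ε τ · Γ(u, z)`. -/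
structure IsHeightFunction {d : ℕ} (T : Set (Euc d × ℝ)) (τ : Sph d) (z₀ δ : ℝ)
    (ζ : ℝ → Sph d → ℝ) : Prop where
  smooth : ContMDiffOn (𝓘(ℝ, ℝ).prod (𝓡 d)) 𝓘(ℝ, ℝ) ∞
    (fun q : ℝ × Sph d => ζ q.1 q.2) (Set.Ioo (-δ) δ ×ˢ Set.univ)
  zero : ∀ u, ζ 0 u = z₀
  mem : ∀ ε ∈ Set.Ioo (-δ) δ, ∀ u, ζ ε u ∈ I
  solves_iff : ∀ ε ∈ Set.Ioo (-δ) δ, ∀ u, ∀ z ∈ I,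
    z - z₀ - ε * inner ℝ (τ : Euc d) (supportMap T u z) = 0 ↔ z = ζ ε u

end ConvexTube

end

open ConvexTube

open Topology Set

/-! A map on the sphere is replaced throughout by its extension to `ℝ^(d+1) ∖ {0}` that is constant
on rays, so that the calculus takes place in Euclidean space. For such a map `γ`, being the inverse
of the Gauss map of an ovaloid becomes a differential condition, `IsSupportField`: the differential
at `y` takes values in the orthogonal complement of `y` and is positive definite there.

Ovaloids yield support fields. Positive curvature makes the complement of the exterior locally
strictly convex along the ovaloid, and connectedness turns this into a global statement
(`segment_notMem_exterior`). Hence every tangent hyperplane supports the ovaloid and every nonzero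
linear functional has a unique maximum point, the point whose outer normal is its direction. This
maximum is nondegenerate, so the implicit function theorem makes it smooth in the direction and in
the height `z` (`contDiffAt_top`, `IsOvaloidFamily.isSupportField`); this gives the support map `Γ`.
Conversely, a support field bounds a convex body and parametrizes its boundary by the outer normal
(`IsSupportField.isSupportParametrization`).

For a tilted section, the equation `z = z₀ + ε τ·Γ(u, z)` has one solution `ζ(ε, u)` for small `ε`;
boundedness of the tube excludes solutions far from `z₀`. The section consists of the points `p =
Γ(u, ζ(ε, u))`. A tangent vector `dp` satisfies `u·dp = ε k (τ·dp)` with `k = u·∂Γ/∂z`, because the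
horizontal part of the motion is orthogonal to `u`. So `u - ε k τ` is normal to the section at `p`,
and `θ_ε` must invert `u ↦ u - ε k τ` up to positive factors. The correction is always along `τ`, so
the inverse is `u + σ τ`, where `σ` solves the scalar equation `σ = ε k(ε, u + σ τ)`. Reparametrized
in this way the section satisfies the orthogonality condition for every small `ε`, and positivity
persists from `ε = 0` by compactness, so it is again given by a support field. Finally `σ` has
derivative `u·∂Γ/∂z` at `ε = 0`, and radial projection retains the tangential part of `τ`. -/

/-- A map into the sphere is smooth as soon as it is smooth as a map into the ambient space. -/
theorem ContMDiffOn.of_coe_sphere {d : ℕ} {m : WithTop ℕ∞}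
    {F : Type*} [NormedAddCommGroup F] [NormedSpace ℝ F] {H : Type*} [TopologicalSpace H]
    {J : ModelWithCorners ℝ F H} {M : Type*} [TopologicalSpace M] [ChartedSpace H M]
    [IsManifold J m M] {f : M → Sph d} {s : Set M}
    (hf : ContMDiffOn J 𝓘(ℝ, Euc d) m (fun x => (f x : Euc d)) s) :
    ContMDiffOn J (𝓡 d) m f s := by
  have := Fact.mk (@finrank_euclideanSpace_fin ℝ _ (d + 1))
  rw [contMDiffOn_iff_target]
  refine ⟨Topology.IsInducing.subtypeVal.continuousOn_iff.2 hf.continuousOn, fun v => ?_⟩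
  -- The chart at `v` is stereographic projection from the pole `-v`, that is `stereoToFun` followed
  -- by the isometry `U`. The pole is described by `inner = 1`, which matches the domain on which
  -- `stereoToFun` is smooth.
  let U : _ ≃ₗᵢ[ℝ] _ :=
    (OrthonormalBasis.fromOrthogonalSpanSingleton (E := Euc d)
        d (ne_zero_of_mem_unit_sphere (-v))).repr
  have h : ContDiffOn ℝ ω _ Set.univ := U.contDiff.contDiffOn
  have H₁ := (h.comp_inter contDiffOn_stereoToFun).contMDiffOn
  convert! (H₁.of_le le_top).comp' hf using 1
  ext x
  have hfxv : (f x : Euc d) = -↑v ↔ inner ℝ (f x : Euc d) (-↑v) = 1 := by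
    have hfx : ‖(f x : Euc d)‖ = 1 := by simp
    rw [inner_eq_one_iff_of_norm_eq_one hfx]
    exact norm_eq_of_mem_sphere (-v)
  simp [chartAt, ChartedSpace.chartAt, Subtype.ext_iff, hfxv, real_inner_comm]

/-! ### Radial projection and maps constant on rays -/

namespace ConvexTube

/-- The radial projection of `ℝ^(d+1) ∖ {0}` to the unit sphere. -/
noncomputable def sphereProj {d : ℕ} (y : Euc d) : Sph d :=
  if h : y = 0 then ⟨EuclideanSpace.single 0 1, by simp⟩
  else ⟨‖y‖⁻¹ • y, by simp [norm_smul, h]⟩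

theorem coe_sphereProj {d : ℕ} {y : Euc d} (hy : y ≠ 0) :
    (sphereProj y : Euc d) = ‖y‖⁻¹ • y := by
  simp [sphereProj, hy]

@[simp] theorem sphereProj_coe {d : ℕ} (u : Sph d) : sphereProj (u : Euc d) = u := by
  ext1
  rw [coe_sphereProj (ne_zero_of_mem_unit_sphere u)]
  simp

theorem sphereProj_smul {d : ℕ} (y : Euc d) {r : ℝ} (hr : 0 < r) :
    sphereProj (r • y) = sphereProj y := by
  by_cases hy : y = 0
  · simp [hy]
  · ext1
    rw [coe_sphereProj (smul_ne_zero hr.ne' hy), coe_sphereProj hy, norm_smul, smul_smul,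
      Real.norm_of_nonneg hr.le]
    congr 1
    field_simp

theorem contDiffOn_coe_sphereProj {d : ℕ} :
    ContDiffOn ℝ ∞ (fun y : Euc d => (sphereProj y : Euc d)) {0}ᶜ := by
  have : ContDiffOn ℝ ∞ (fun y : Euc d => ‖y‖⁻¹ • y) {0}ᶜ := fun y hy =>
    (((contDiffAt_norm ℝ hy).inv (norm_ne_zero_iff.2 hy)).smul contDiffAt_id).contDiffWithinAt
  exact this.congr fun y hy => coe_sphereProj hy

theorem contMDiffOn_sphereProj {d : ℕ} :
    ContMDiffOn 𝓘(ℝ, Euc d) (𝓡 d) ∞ (sphereProj : Euc d → Sph d) {0}ᶜ :=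
  ContMDiffOn.of_coe_sphere contDiffOn_coe_sphereProj.contMDiffOn

theorem contMDiff_coe_sph {d : ℕ} :
    ContMDiff (𝓡 d) 𝓘(ℝ, Euc d) ∞ (fun u : Sph d => (u : Euc d)) :=
  have := Fact.mk (@finrank_euclideanSpace_fin ℝ _ (d + 1))
  contMDiff_coe_sphere

theorem hasDerivAt_coe_sphereProj {d : ℕ} (u : Sph d) {w : Euc d}
    (hw : inner ℝ (u : Euc d) w = 0) :
    HasDerivAt (fun t : ℝ => (sphereProj ((u : Euc d) + t • w) : Euc d)) w 0 := by
  have hu : (u : Euc d) ≠ 0 := ne_zero_of_mem_unit_sphere u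
  have h1 : HasDerivAt (fun t : ℝ => (u : Euc d) + t • w) w 0 := by
    simpa using ((hasDerivAt_id (0 : ℝ)).smul_const w).const_add (u : Euc d)
  have h2 : HasDerivAt (fun t : ℝ => ‖(u : Euc d) + t • w‖ ^ 2) 0 0 := by
    simpa [hw] using h1.norm_sq
  have h3 : HasDerivAt (fun t : ℝ => (Real.sqrt (‖(u : Euc d) + t • w‖ ^ 2))⁻¹) 0 0 := by
    simpa using (h2.sqrt (by simp)).fun_inv (by simp)
  have h4 := h3.smul h1
  simp only [zero_smul, add_zero, norm_eq_of_mem_sphere, one_pow, Real.sqrt_one, inv_one,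
    one_smul] at h4
  refine h4.congr_of_eventuallyEq ?_
  have hne : ∀ᶠ t in 𝓝 (0 : ℝ), (u : Euc d) + t • w ≠ 0 :=
    h1.continuousAt.eventually_ne (by simpa using hu)
  filter_upwards [hne] with t ht
  simp [coe_sphereProj ht]

/-- A smooth map on `𝕊^d × I` gives a smooth map on `(ℝ^(d+1) ∖ {0}) × I`, constant on rays. -/
theorem contDiffOn_comp_sphereProj {d : ℕ} {F : Type*} [NormedAddCommGroup F] [NormedSpace ℝ F]
    {f : Sph d × ℝ → F}
    (hf : ContMDiffOn ((𝓡 d).prod 𝓘(ℝ, ℝ)) 𝓘(ℝ, F) ∞ f (univ ×ˢ I)) :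
    ContDiffOn ℝ ∞ (fun q : Euc d × ℝ => f (sphereProj q.1, q.2)) ({0}ᶜ ×ˢ I) := by
  rw [← contMDiffOn_iff_contDiffOn]
  have h1 : ContMDiffOn 𝓘(ℝ, Euc d × ℝ) (𝓡 d) ∞ (fun q : Euc d × ℝ => sphereProj q.1)
      ({0}ᶜ ×ˢ I) :=
    contMDiffOn_sphereProj.comp contDiff_fst.contMDiff.contMDiffOn fun q hq => hq.1
  have h2 : ContMDiffOn 𝓘(ℝ, Euc d × ℝ) 𝓘(ℝ, ℝ) ∞ (fun q : Euc d × ℝ => q.2)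
      ({0}ᶜ ×ˢ I) := contDiff_snd.contMDiff.contMDiffOn
  exact hf.comp (h1.prodMk h2) fun q hq => ⟨trivial, hq.2⟩

/-- Immersions of `𝕊^d × I` are nondegenerate in the directions of the sphere. -/
theorem ne_zero_of_hasDerivAt_comp_sphereProj {d : ℕ} {F : Type*} [NormedAddCommGroup F]
    [NormedSpace ℝ F] {X : Sph d × ℝ → F} {u : Sph d} {z : ℝ}
    (hX : MDifferentiableAt ((𝓡 d).prod 𝓘(ℝ, ℝ)) 𝓘(ℝ, F) X (u, z))
    (hinj : Function.Injective (mfderiv ((𝓡 d).prod 𝓘(ℝ, ℝ)) 𝓘(ℝ, F) X (u, z)))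
    {w : Euc d} (hw : inner ℝ (u : Euc d) w = 0) (hw0 : w ≠ 0) {a : F}
    (ha : HasDerivAt (fun t : ℝ => X (sphereProj ((u : Euc d) + t • w), z)) a 0) : a ≠ 0 := by
  have hu : (u : Euc d) ≠ 0 := ne_zero_of_mem_unit_sphere u
  set c : ℝ → Sph d := fun t => sphereProj ((u : Euc d) + t • w) with hc
  have hc0 : c 0 = u := by simp [hc]
  have hcm : MDifferentiableAt 𝓘(ℝ, ℝ) (𝓡 d) c 0 := by
    have h1 : ContMDiffAt 𝓘(ℝ, Euc d) (𝓡 d) ∞ (sphereProj : Euc d → Sph d) ((u : Euc d) + (0 : ℝ) • w) :=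
      contMDiffOn_sphereProj.contMDiffAt (isOpen_compl_singleton.mem_nhds (by simpa using hu))
    have h2 : ContMDiffAt 𝓘(ℝ, ℝ) 𝓘(ℝ, Euc d) ∞ (fun t : ℝ => (u : Euc d) + t • w) 0 :=
      (contDiffAt_const.add (contDiffAt_id.smul contDiffAt_const)).contMDiffAt
    exact (h1.comp (0 : ℝ) h2).mdifferentiableAt (by simp)
  have hcd := hcm.hasMFDerivAt
  have hcoe : MDifferentiableAt (𝓡 d) 𝓘(ℝ, Euc d) (fun u : Sph d => (u : Euc d)) (c 0) :=
    contMDiff_coe_sph.contMDiffAt.mdifferentiableAt (by simp)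
  -- The ambient velocity `w` of the curve factors through its intrinsic velocity in the sphere. If
  -- the differential of `X` killed that velocity, injectivity would make it zero, and then `w = 0`.
  obtain ⟨L, hL, hL1⟩ : ∃ L : ℝ →L[ℝ] Euc d, HasFDerivAt (fun t : ℝ => (c t : Euc d)) L 0 ∧
      L 1 = mfderiv (𝓡 d) 𝓘(ℝ, Euc d) (fun u : Sph d => (u : Euc d)) (c 0)
        ((mfderiv 𝓘(ℝ, ℝ) (𝓡 d) c 0) (1 : ℝ)) :=
    ⟨_, (hcoe.hasMFDerivAt.comp 0 hcd).hasFDerivAt, rfl⟩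
  have h1 : L 1 = w := hL.hasDerivAt.unique (hasDerivAt_coe_sphereProj u hw)
  have hz : HasMFDerivAt 𝓘(ℝ, ℝ) 𝓘(ℝ, ℝ) (fun _ : ℝ => z) 0 (0 : ℝ →L[ℝ] ℝ) :=
    hasMFDerivAt_const z 0
  have hX' : HasMFDerivAt ((𝓡 d).prod 𝓘(ℝ, ℝ)) 𝓘(ℝ, F) X (c 0, z)
      (mfderiv ((𝓡 d).prod 𝓘(ℝ, ℝ)) 𝓘(ℝ, F) X (c 0, z)) := by
    rw [hc0]; exact hX.hasMFDerivAt
  obtain ⟨N, hN, hN1⟩ : ∃ N : ℝ →L[ℝ] F, HasFDerivAt (fun t : ℝ => X (c t, z)) N 0 ∧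
      N 1 = mfderiv ((𝓡 d).prod 𝓘(ℝ, ℝ)) 𝓘(ℝ, F) X (c 0, z)
        ((mfderiv 𝓘(ℝ, ℝ) (𝓡 d) c 0) (1 : ℝ), (0 : ℝ)) :=
    ⟨_, (hX'.comp (0 : ℝ) (hcd.prodMk hz)).hasFDerivAt, rfl⟩
  have h2 : N 1 = a := hN.hasDerivAt.unique ha
  rintro rfl
  rw [← hc0] at hinj
  have h3 := hinj (a₁ := ((mfderiv 𝓘(ℝ, ℝ) (𝓡 d) c 0) (1 : ℝ), (0 : ℝ))) (a₂ := 0)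
    (by rw [map_zero]; exact hN1.symm.trans h2)
  have h4 : (mfderiv 𝓘(ℝ, ℝ) (𝓡 d) c 0) (1 : ℝ) = 0 := congrArg Prod.fst h3
  apply hw0
  rw [← h1, hL1]
  exact (congrArg (mfderiv (𝓡 d) 𝓘(ℝ, Euc d) (fun u : Sph d => (u : Euc d)) (c 0)) h4).trans
    (map_zero _)

end ConvexTube

namespace ConvexTube

variable {d : ℕ} {O U : Set (Euc d)} {p u : Euc d} {f : Euc d → ℝ}

/-! ### The exterior and the outer normal -/

/-- The half-space `⟨u, ·⟩ ≥ ⟨u, x⟩` misses `O`, is connected and contains the ray from `x` in the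
direction `u`, so the component of `x` is unbounded. -/
theorem mem_exterior_of_forall_inner_lt (hu : u ≠ 0) {x : Euc d}
    (h : ∀ y ∈ O, inner ℝ u y < inner ℝ u x) : x ∈ exterior O := by
  refine ⟨fun hx => lt_irrefl _ (h x hx), fun hb => ?_⟩
  have hconv : Convex ℝ {y : Euc d | inner ℝ u x ≤ inner ℝ u y} :=
    convex_halfSpace_ge (innerSL ℝ u).isLinear _
  have hsub : {y : Euc d | inner ℝ u x ≤ inner ℝ u y} ⊆ connectedComponentIn Oᶜ x :=
    hconv.isPreconnected.subset_connectedComponentIn (le_refl (inner ℝ u x))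
      fun y hy hyO => not_lt_of_ge hy (h y hyO)
  obtain ⟨R, hR⟩ := (hb.subset hsub).exists_norm_le
  have hu' : 0 < ‖u‖ := norm_pos_iff.2 hu
  have hR0 : 0 ≤ R := (norm_nonneg x).trans (hR x (le_refl (inner ℝ u x)))
  set s : ℝ := (R + ‖x‖ + 1) / ‖u‖ with hs
  have hs0 : 0 ≤ s := by positivity
  have h1 := hR (x + s • u) (by
    simp only [mem_ofPred_eq, inner_add_right, inner_smul_right]
    nlinarith [mul_nonneg hs0 (real_inner_self_nonneg (x := u))])
  have h2 : ‖s • u‖ ≤ ‖x + s • u‖ + ‖x‖ := by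
    simpa using norm_sub_le (x + s • u) x
  rw [norm_smul, Real.norm_of_nonneg hs0, hs, div_mul_cancel₀ _ hu'.ne'] at h2
  linarith

theorem isOpen_exterior (hO : IsClosed O) : IsOpen (exterior O) := by
  rw [isOpen_iff_mem_nhds]
  rintro x ⟨hx, hb⟩
  refine Filter.mem_of_superset (hO.isOpen_compl.connectedComponentIn.mem_nhds
    (mem_connectedComponentIn hx)) fun y hy => ⟨connectedComponentIn_subset _ _ hy, ?_⟩
  rwa [← connectedComponentIn_eq hy]

namespace IsOutwardDefiningFunction

theorem contDiffAt (hf : IsOutwardDefiningFunction O p U f) {x : Euc d} (hx : x ∈ U) :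
    ContDiffAt ℝ ∞ f x :=
  hf.smooth.contDiffAt (hf.isOpen.mem_nhds hx)

theorem differentiableAt (hf : IsOutwardDefiningFunction O p U f) {x : Euc d} (hx : x ∈ U) :
    DifferentiableAt ℝ f x :=
  (hf.contDiffAt hx).differentiableAt (by simp)

theorem notMem_exterior_iff (hf : IsOutwardDefiningFunction O p U f) {x : Euc d} (hx : x ∈ U) :
    x ∉ exterior O ↔ f x ≤ 0 := by
  rw [hf.exterior_iff x hx, not_lt]

theorem of_mem (hf : IsOutwardDefiningFunction O p U f) {x : Euc d} (hx : x ∈ U) :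
    IsOutwardDefiningFunction O x U f :=
  { hf with mem := hx }

theorem hasDerivAt_line (hf : IsOutwardDefiningFunction O p U f) {x : Euc d} (hx : x ∈ U)
    (w : Euc d) :
    HasDerivAt (fun t : ℝ => f (x + t • w)) (inner ℝ (gradient f x) w) 0 := by
  have h1 : HasDerivAt (fun t : ℝ => x + t • w) w 0 := by
    simpa using ((hasDerivAt_id (0 : ℝ)).smul_const w).const_add x
  have h2 : HasFDerivAt f (fderiv ℝ f x) (x + (0 : ℝ) • w) := by
    simpa using (hf.differentiableAt hx).hasFDerivAt
  rw [inner_gradient_left]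
  exact h2.comp_hasDerivAt 0 h1

theorem eventually_line_mem (hf : IsOutwardDefiningFunction O p U f) {x : Euc d} (hx : x ∈ U)
    (w : Euc d) : ∀ᶠ t : ℝ in 𝓝[>] 0, x + t • w ∈ U := by
  have : Filter.Tendsto (fun t : ℝ => x + t • w) (𝓝 0) (𝓝 x) := by
    have : Continuous (fun t : ℝ => x + t • w) := by fun_prop
    simpa using this.tendsto 0
  exact nhdsWithin_le_nhds (this (hf.isOpen.mem_nhds hx))

/-- At a point maximizing a linear functional on `O`, the outer normal is its direction. -/
theorem unitNormal_eq (hf : IsOutwardDefiningFunction O p U f) (hp : p ∈ O) (hu : ‖u‖ = 1)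
    (hmax : ∀ y ∈ O, inner ℝ u y ≤ inner ℝ u p) : unitNormal f p = u := by
  have hu0 : u ≠ 0 := by rintro rfl; simp at hu
  have huu : inner ℝ u u = (1 : ℝ) := by simp [hu]
  have hf0 : f p = 0 := (hf.mem_iff p hf.mem).1 hp
  -- Moving from `p` in such a direction leads into the exterior, where `f > 0`. A functional that
  -- is nonnegative on the open half-space, hence on its closure, is a nonnegative multiple of `⟨u,
  -- ·⟩`; this determines the gradient.
  have key : ∀ w, 0 < inner ℝ u w → 0 ≤ inner ℝ (gradient f p) w := by
    intro w hw
    have h1 := (hf.hasDerivAt_line hf.mem w).tendsto_slope.mono_left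
      (nhdsWithin_mono (0 : ℝ) (fun t (ht : t ∈ Ioi (0 : ℝ)) => ne_of_gt ht))
    refine ge_of_tendsto h1 ?_
    filter_upwards [hf.eventually_line_mem hf.mem w, self_mem_nhdsWithin] with t ht ht0
    have ht0' : (0 : ℝ) < t := ht0
    have h2 : 0 < f (p + t • w) := by
      rw [← hf.exterior_iff _ ht]
      refine mem_exterior_of_forall_inner_lt hu0 fun y hy => (hmax y hy).trans_lt ?_
      rw [inner_add_right, inner_smul_right]
      nlinarith [mul_pos ht0' hw]
    simp only [slope_def_field, zero_smul, add_zero, hf0, sub_zero]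
    positivity
  have hperp : ∀ v, inner ℝ u v = 0 → 0 ≤ inner ℝ (gradient f p) v := by
    intro v hv
    have h2 : ∀ s : ℝ, 0 < s → 0 ≤ inner ℝ (gradient f p) v + s * inner ℝ (gradient f p) u := by
      intro s hs
      simpa [inner_add_right, inner_smul_right] using
        key (v + s • u) (by rw [inner_add_right, inner_smul_right, hv, huu]; linarith)
    have h3 : Filter.Tendsto
        (fun s : ℝ => inner ℝ (gradient f p) v + s * inner ℝ (gradient f p) u) (𝓝[>] 0)
        (𝓝 (inner ℝ (gradient f p) v)) := by
      have : Continuous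
        (fun s : ℝ => inner ℝ (gradient f p) v + s * inner ℝ (gradient f p) u) := by fun_prop
      simpa using (this.tendsto 0).mono_left nhdsWithin_le_nhds
    exact ge_of_tendsto h3 (Filter.eventually_of_mem self_mem_nhdsWithin h2)
  set a : ℝ := inner ℝ (gradient f p) u with ha
  have ha0 : 0 ≤ a := key u (by rw [huu]; exact one_pos)
  have hgrad : gradient f p = a • u := by
    have hv : inner ℝ u (gradient f p - a • u) = 0 := by
      rw [inner_sub_right, inner_smul_right, huu, ha, real_inner_comm]; ring
    have h1 := hperp _ hv
    have h2 := hperp (-(gradient f p - a • u)) (by rw [inner_neg_right, hv, neg_zero])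
    rw [inner_neg_right] at h2
    have h3 : inner ℝ (gradient f p - a • u) (gradient f p - a • u) = 0 := by
      rw [inner_sub_left (gradient f p), inner_smul_left, hv]
      simp only [mul_zero, sub_zero]
      linarith
    exact sub_eq_zero.1 (inner_self_eq_zero.1 h3)
  have ha1 : a ≠ 0 := fun h => hf.regular p hf.mem (by rw [hgrad, h, zero_smul])
  rw [unitNormal, hgrad, norm_smul, hu, mul_one, Real.norm_of_nonneg ha0, smul_smul,
    inv_mul_cancel₀ ha1, one_smul]

theorem norm_unitNormal (hf : IsOutwardDefiningFunction O p U f) {x : Euc d} (hx : x ∈ U) :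
    ‖unitNormal f x‖ = 1 := by
  rw [unitNormal, norm_smul, norm_inv, norm_norm,
    inv_mul_cancel₀ (norm_ne_zero_iff.2 (hf.regular x hx))]

end IsOutwardDefiningFunction

/-! ### The second fundamental form -/

theorem gradient_eq_comp (f : Euc d → ℝ) :
    gradient f = (InnerProductSpace.toDual ℝ (Euc d)).symm ∘ fderiv ℝ f := rfl

namespace IsOutwardDefiningFunction

theorem contDiffOn_gradient (hf : IsOutwardDefiningFunction O p U f) :
    ContDiffOn ℝ ∞ (gradient f) U := by
  rw [gradient_eq_comp]
  exact (InnerProductSpace.toDual ℝ (Euc d)).symm.contDiff.comp_contDiffOn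
    (hf.smooth.fderiv_of_isOpen hf.isOpen (by simp))

theorem contDiffAt_gradient (hf : IsOutwardDefiningFunction O p U f) {x : Euc d} (hx : x ∈ U) :
    ContDiffAt ℝ ∞ (gradient f) x :=
  hf.contDiffOn_gradient.contDiffAt (hf.isOpen.mem_nhds hx)

theorem differentiableAt_gradient (hf : IsOutwardDefiningFunction O p U f) {x : Euc d}
    (hx : x ∈ U) : DifferentiableAt ℝ (gradient f) x :=
  (hf.contDiffAt_gradient hx).differentiableAt (by simp)

theorem inner_fderiv_gradient (hf : IsOutwardDefiningFunction O p U f) {x : Euc d} (hx : x ∈ U)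
    (v w : Euc d) :
    inner ℝ (fderiv ℝ (gradient f) x v) w = fderiv ℝ (fderiv ℝ f) x v w := by
  have h : DifferentiableAt ℝ (fderiv ℝ f) x :=
    ((hf.smooth.fderiv_of_isOpen hf.isOpen (m := ∞) (by simp)).contDiffAt
      (hf.isOpen.mem_nhds hx)).differentiableAt (by simp)
  have h1 : HasFDerivAt (gradient f) _ x :=
    ((InnerProductSpace.toDual ℝ (Euc d)).symm.toContinuousLinearEquiv.toContinuousLinearMap
      |>.hasFDerivAt).comp x h.hasFDerivAt
  rw [h1.fderiv]
  simp

theorem inner_fderiv_gradient_comm (hf : IsOutwardDefiningFunction O p U f) {x : Euc d}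
    (hx : x ∈ U) (v w : Euc d) :
    inner ℝ (fderiv ℝ (gradient f) x v) w = inner ℝ (fderiv ℝ (gradient f) x w) v := by
  rw [hf.inner_fderiv_gradient hx, hf.inner_fderiv_gradient hx]
  exact ((hf.contDiffAt hx).isSymmSndFDerivAt (by
    rw [minSmoothness_of_isRCLikeNormedField]; exact WithTop.coe_le_coe.2 (le_top : (2 : ℕ∞) ≤ ⊤))) v w

theorem contDiffOn_unitNormal (hf : IsOutwardDefiningFunction O p U f) :
    ContDiffOn ℝ ∞ (unitNormal f) U := fun x hx =>
  ((((hf.contDiffAt_gradient hx).norm ℝ (hf.regular x hx)).inv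
    (norm_ne_zero_iff.2 (hf.regular x hx))).smul
      (hf.contDiffAt_gradient hx)).contDiffWithinAt

theorem differentiableAt_unitNormal (hf : IsOutwardDefiningFunction O p U f) {x : Euc d}
    (hx : x ∈ U) : DifferentiableAt ℝ (unitNormal f) x :=
  (hf.contDiffOn_unitNormal.contDiffAt (hf.isOpen.mem_nhds hx)).differentiableAt (by simp)

/-- Differentiating the factor `‖gradient f‖⁻¹` only contributes a multiple of the gradient, which
is orthogonal to `w`. -/
theorem inner_fderiv_unitNormal (hf : IsOutwardDefiningFunction O p U f) {x : Euc d} (hx : x ∈ U)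
    (v : Euc d) {w : Euc d} (hw : inner ℝ (gradient f x) w = 0) :
    inner ℝ (fderiv ℝ (unitNormal f) x v) w =
      ‖gradient f x‖⁻¹ * inner ℝ (fderiv ℝ (gradient f) x v) w := by
  have h1 : DifferentiableAt ℝ (fun y => ‖gradient f y‖⁻¹) x :=
    (((hf.contDiffAt_gradient hx).norm ℝ (hf.regular x hx)).inv
      (norm_ne_zero_iff.2 (hf.regular x hx))).differentiableAt (by simp)
  have h2 : HasFDerivAt (unitNormal f) _ x :=
    h1.hasFDerivAt.smul (hf.differentiableAt_gradient hx).hasFDerivAt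
  rw [h2.fderiv]
  simp [inner_add_left, inner_smul_left, hw]

theorem inner_fderiv_unitNormal_gradient (hf : IsOutwardDefiningFunction O p U f) {x : Euc d}
    (hx : x ∈ U) (v : Euc d) :
    inner ℝ (gradient f x) (fderiv ℝ (unitNormal f) x v) = 0 := by
  have h1 := (hf.differentiableAt_unitNormal hx).hasFDerivAt
  have h2 := h1.inner ℝ h1
  have h3 : (fun y => (inner ℝ (unitNormal f y) (unitNormal f y) : ℝ)) =ᶠ[𝓝 x] fun _ => 1 := by
    filter_upwards [hf.isOpen.mem_nhds hx] with y hy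
    rw [real_inner_self_eq_norm_sq, hf.norm_unitNormal hy, one_pow]
  have h4 := congrArg (fun L => L v) (h2.unique ((hasFDerivAt_const (1 : ℝ) x).congr_of_eventuallyEq h3))
  simp only [ContinuousLinearMap.comp_apply, ContinuousLinearMap.prod_apply,
    fderivInnerCLM_apply, zero_apply] at h4
  rw [real_inner_comm (unitNormal f x)] at h4
  have h5 : inner ℝ (unitNormal f x) (fderiv ℝ (unitNormal f) x v) = 0 := by linarith
  rw [unitNormal, inner_smul_left] at h5
  simpa [hf.regular x hx] using h5

end IsOutwardDefiningFunction

/-- In an orthonormal eigenbasis the quadratic form is a sum of squares weighted by the eigenvalues.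
-/
theorem _root_.LinearMap.IsSymmetric.inner_pos_of_eigenvalues_pos {V : Type*}
    [NormedAddCommGroup V] [InnerProductSpace ℝ V] [FiniteDimensional ℝ V] {S : V →ₗ[ℝ] V}
    (hS : S.IsSymmetric) (h : ∀ (κ : ℝ) v, v ≠ 0 → S v = κ • v → 0 < κ) {v : V} (hv : v ≠ 0) :
    0 < inner ℝ (S v) v := by
  set b := hS.eigenvectorBasis rfl
  have hpos : ∀ i, 0 < hS.eigenvalues rfl i := fun i =>
    h _ (b i) (b.orthonormal.ne_zero i) (hS.apply_eigenvectorBasis rfl i)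
  have hsum : inner ℝ (S v) v = ∑ i, hS.eigenvalues rfl i * inner ℝ (b i) v ^ 2 := by
    rw [← b.sum_inner_mul_inner]
    refine Finset.sum_congr rfl fun i _ => ?_
    rw [hS v (b i), hS.apply_eigenvectorBasis, inner_smul_right, real_inner_comm v (b i)]
    simp; ring
  rw [hsum]
  obtain ⟨i, hi⟩ : ∃ i, inner ℝ (b i) v ≠ 0 := by
    by_contra! hcon
    apply hv
    rw [← b.sum_repr v]
    simp [b.repr_apply_apply, hcon]
  exact Finset.sum_pos' (fun i _ => mul_nonneg (hpos i).le (sq_nonneg _))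
    ⟨i, Finset.mem_univ _, mul_pos (hpos i) (by positivity)⟩

/-- Positive principal curvatures make the second fundamental form positive definite. -/
theorem IsOutwardDefiningFunction.inner_fderiv_gradient_pos
    (hf : IsOutwardDefiningFunction O p U f) (hp : p ∈ O)
    (hcurv : ∀ κ, IsPrincipalCurvature O p κ → 0 < κ) {v : Euc d} (hv : v ≠ 0)
    (hvp : inner ℝ (gradient f p) v = 0) :
    0 < inner ℝ (fderiv ℝ (gradient f) p v) v := by
  set V : Submodule ℝ (Euc d) := (ℝ ∙ gradient f p)ᗮ with hV
  have hmemV : ∀ w, w ∈ V ↔ inner ℝ (gradient f p) w = 0 := fun w =>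
    Submodule.mem_orthogonal_singleton_iff_inner_right
  -- `S` is the shape operator. Up to the positive factor `‖gradient f p‖⁻¹` its quadratic form is
  -- the Hessian of `f` on the tangent space, so it is symmetric, and its eigenvalues are principal
  -- curvatures.
  let S : V →ₗ[ℝ] V := (fderiv ℝ (unitNormal f) p).toLinearMap.restrict
    fun w _ => (hmemV _).2 (hf.inner_fderiv_unitNormal_gradient hf.mem w)
  have hScoe : ∀ w : V, (S w : Euc d) = fderiv ℝ (unitNormal f) p w := fun w => rfl
  have hS : S.IsSymmetric := by
    intro x y
    rw [Submodule.coe_inner, Submodule.coe_inner, hScoe, hScoe, real_inner_comm _ (x : Euc d),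
      hf.inner_fderiv_unitNormal hf.mem _ ((hmemV _).1 y.2),
      hf.inner_fderiv_unitNormal hf.mem _ ((hmemV _).1 x.2), hf.inner_fderiv_gradient_comm hf.mem]
  have h1 := hS.inner_pos_of_eigenvalues_pos (v := ⟨v, (hmemV v).2 hvp⟩) (fun κ w hw hSw =>
    hcurv κ ⟨hp, U, f, hf, w, by simpa using hw, (hmemV _).1 w.2, congrArg Subtype.val hSw⟩)
    (by simpa using hv)
  rw [Submodule.coe_inner, hScoe, hf.inner_fderiv_unitNormal hf.mem _ hvp] at h1
  exact pos_of_mul_pos_right h1 (by positivity)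

end ConvexTube

namespace ConvexTube

variable {d : ℕ} {O U : Set (Euc d)} {p u : Euc d} {f : Euc d → ℝ}

/-! ### Convexity of ovaloids -/

/-- Near a point with positive definite second fundamental form, the sublevel set is strictly
convex. -/
theorem IsOutwardDefiningFunction.exists_ball_strictConvex
    (hf : IsOutwardDefiningFunction O p U f)
    (hpos : ∀ v, v ≠ 0 → inner ℝ (gradient f p) v = 0 →
      0 < inner ℝ (fderiv ℝ (gradient f) p v) v) :
    ∃ r > 0, Metric.ball p r ⊆ U ∧ ∀ x ∈ Metric.ball p r, ∀ y ∈ Metric.ball p r, x ≠ y →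
      f x ≤ 0 → f y ≤ 0 → ∀ t ∈ Ioo (0 : ℝ) 1, f (x + t • (y - x)) < 0 := by
  have hG : ContinuousAt (gradient f) p := (hf.contDiffAt_gradient hf.mem).continuousAt
  have hH : ContinuousAt (fderiv ℝ (gradient f)) p :=
    ((hf.contDiffAt_gradient hf.mem).fderiv_right (m := 0) (by simp)).continuousAt
  have hev : ∀ᶠ x in 𝓝 p, ∀ v ∈ Metric.sphere (0 : Euc d) 1,
      inner ℝ (gradient f x) v = 0 → 0 < inner ℝ (fderiv ℝ (gradient f) x v) v := by
    refine (isCompact_sphere _ _).eventually_forall_of_forall_eventually fun v hv => ?_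
    have hv0 : v ≠ 0 := ne_zero_of_mem_unit_sphere ⟨v, hv⟩
    have hG' : ContinuousAt (fun z : Euc d × Euc d => gradient f z.1) (p, v) :=
      ContinuousAt.comp (g := gradient f) (f := Prod.fst) hG continuousAt_fst
    have hH' : ContinuousAt (fun z : Euc d × Euc d => fderiv ℝ (gradient f) z.1) (p, v) :=
      ContinuousAt.comp (g := fderiv ℝ (gradient f)) (f := Prod.fst) hH continuousAt_fst
    -- Both alternatives are open: if `v` is tangent at `p`, positivity persists nearby; otherwise
    -- nearby pairs still fail to be tangent and nothing is required of them.
    by_cases h : inner ℝ (gradient f p) v = 0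
    · have h1 : ContinuousAt
          (fun z : Euc d × Euc d => (inner ℝ (fderiv ℝ (gradient f) z.1 z.2) z.2 : ℝ)) (p, v) :=
        (hH'.clm_apply continuousAt_snd).inner continuousAt_snd
      filter_upwards [h1.eventually (lt_mem_nhds (hpos v hv0 h))] with z hz _ using hz
    · have h1 : ContinuousAt
          (fun z : Euc d × Euc d => (inner ℝ (gradient f z.1) z.2 : ℝ)) (p, v) :=
        hG'.inner continuousAt_snd
      filter_upwards [h1.eventually_ne h] with z hz hz' using absurd hz' hz
  obtain ⟨r, hr, hball⟩ := Metric.eventually_nhds_iff_ball.1 (hev.and (hf.isOpen.mem_nhds hf.mem))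
  refine ⟨r, hr, fun x hx => (hball x hx).2, fun x hx y hy hxy hfx hfy t ht => ?_⟩
  have hmem : ∀ s ∈ Icc (0 : ℝ) 1, x + s • (y - x) ∈ Metric.ball p r := fun s hs =>
    (convex_ball p r).add_smul_sub_mem hx hy hs
  have hder : ∀ s ∈ Icc (0 : ℝ) 1, HasDerivAt (fun s : ℝ => f (x + s • (y - x)))
      (inner ℝ (gradient f (x + s • (y - x))) (y - x)) s := by
    intro s hs
    have h1 : HasDerivAt (fun s : ℝ => x + s • (y - x)) (y - x) s := by
      simpa using ((hasDerivAt_id s).smul_const (y - x)).const_add x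
    rw [inner_gradient_left]
    exact (hf.differentiableAt (hball _ (hmem s hs)).2).hasFDerivAt.comp_hasDerivAt s h1
  -- If `f` reached a nonnegative value inside the chord, its restriction would have an interior
  -- maximum. There the chord is tangent to the level set, so the second derivative is positive and
  -- the point is also a local minimum; `f` is then locally constant on the chord, a contradiction.
  by_contra! hcon
  have hcont : ContinuousOn (fun s : ℝ => f (x + s • (y - x))) (Icc 0 1) := fun s hs =>
    (hder s hs).continuousAt.continuousWithinAt
  obtain ⟨s₀, hs₀, hmax₀⟩ := isCompact_Icc.exists_isMaxOn (nonempty_Icc.2 zero_le_one) hcont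
  -- If the maximum is at an endpoint, then it is `≤ 0`, hence at most the value at `t`, so `t` is
  -- itself an interior maximum.
  obtain ⟨s, hs, hmax⟩ : ∃ s ∈ Ioo (0 : ℝ) 1,
      IsMaxOn (fun s : ℝ => f (x + s • (y - x))) (Icc 0 1) s := by
    by_cases h : s₀ ∈ Ioo (0 : ℝ) 1
    · exact ⟨s₀, h, hmax₀⟩
    · refine ⟨t, ht, fun s hs => le_trans (hmax₀ hs) (le_trans ?_ hcon)⟩
      have : s₀ = 0 ∨ s₀ = 1 := by
        by_contra! h'
        exact h ⟨lt_of_le_of_ne hs₀.1 h'.1.symm, lt_of_le_of_ne hs₀.2 h'.2⟩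
      rcases this with rfl | rfl
      · simpa using hfx
      · simpa using hfy
  have hsI : Icc (0 : ℝ) 1 ∈ 𝓝 s := Icc_mem_nhds hs.1 hs.2
  have hlmax : IsLocalMax (fun s : ℝ => f (x + s • (y - x))) s := hmax.isLocalMax hsI
  have hzero : inner ℝ (gradient f (x + s • (y - x))) (y - x) = 0 :=
    hlmax.hasDerivAt_eq_zero (hder s (Ioo_subset_Icc_self hs))
  have hyx : 0 < ‖y - x‖ := norm_pos_iff.2 (sub_ne_zero.2 hxy.symm)
  have hsecond : 0 < inner ℝ (fderiv ℝ (gradient f) (x + s • (y - x)) (y - x)) (y - x) := by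
    have h1 := (hball _ (hmem s (Ioo_subset_Icc_self hs))).1 (‖y - x‖⁻¹ • (y - x))
      (by simp [norm_smul, hyx.ne']) (by rw [inner_smul_right, hzero, mul_zero])
    rw [map_smul, inner_smul_left, inner_smul_right] at h1
    simp only [map_inv₀, conj_trivial] at h1
    have h2 : 0 < ‖y - x‖⁻¹ := inv_pos.2 hyx
    exact pos_of_mul_pos_right (pos_of_mul_pos_right h1 h2.le) h2.le
  have hderiv : deriv (fun s : ℝ => f (x + s • (y - x))) =ᶠ[𝓝 s]
      fun s => inner ℝ (gradient f (x + s • (y - x))) (y - x) := by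
    filter_upwards [hsI] with a ha using (hder a ha).deriv
  have hderiv2 : HasDerivAt (deriv (fun s : ℝ => f (x + s • (y - x))))
      (inner ℝ (fderiv ℝ (gradient f) (x + s • (y - x)) (y - x)) (y - x)) s := by
    have h1 : HasDerivAt (fun s : ℝ => x + s • (y - x)) (y - x) s := by
      simpa using ((hasDerivAt_id s).smul_const (y - x)).const_add x
    have h2 := ((hf.differentiableAt_gradient
      (hball _ (hmem s (Ioo_subset_Icc_self hs))).2).hasFDerivAt.comp_hasDerivAt s h1).inner ℝ
        (hasDerivAt_const s (y - x))
    simp only [inner_zero_right, zero_add] at h2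
    exact h2.congr_of_eventuallyEq hderiv
  have hlmin : IsLocalMin (fun s : ℝ => f (x + s • (y - x))) s :=
    isLocalMin_of_deriv_deriv_pos (by rw [hderiv2.deriv]; exact hsecond)
      (by rw [(hder s (Ioo_subset_Icc_self hs)).deriv, hzero])
      (hder s (Ioo_subset_Icc_self hs)).continuousAt
  have hconst : (fun s : ℝ => f (x + s • (y - x))) =ᶠ[𝓝 s] fun _ => f (x + s • (y - x)) := by
    filter_upwards [hlmin, hlmax] with a h1 h2 using le_antisymm h2 h1
  have h0 : deriv (fun s : ℝ => f (x + s • (y - x))) =ᶠ[𝓝 s] fun _ => 0 := by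
    filter_upwards [hconst.eventuallyEq_nhds] with a ha
    rw [ha.deriv_eq, deriv_const]
  have := hderiv2.unique ((hasDerivAt_const s (0 : ℝ)).congr_of_eventuallyEq h0)
  linarith

namespace IsOvaloid

/-- The component of `q` in the complement of `O` is open and lies entirely outside the exterior. -/
theorem compl_exterior_mem_nhds (hO : IsOvaloid O) {q : Euc d} (hq : q ∉ exterior O)
    (hqO : q ∉ O) : (exterior O)ᶜ ∈ 𝓝 q := by
  refine Filter.mem_of_superset
    (hO.isCompact.isClosed.isOpen_compl.connectedComponentIn.mem_nhds
      (mem_connectedComponentIn hqO)) fun y hy hyE => hq ⟨hqO, ?_⟩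
  rw [connectedComponentIn_eq hy]
  exact hyE.2

/-- Near `p` the complement of the exterior is the sublevel set `f ≤ 0`, so its strict convexity can
be expressed without a defining function. -/
theorem exists_ball (hO : IsOvaloid O) (hp : p ∈ O) :
    ∃ r > 0, ∀ x ∈ Metric.ball p r, ∀ y ∈ Metric.ball p r, x ≠ y →
      x ∉ exterior O → y ∉ exterior O → ∀ t ∈ Ioo (0 : ℝ) 1,
        x + t • (y - x) ∉ exterior O ∧ x + t • (y - x) ∉ O := by
  obtain ⟨U, f, hf⟩ := hO.hypersurface p hp
  obtain ⟨r, hr, hU, h⟩ := hf.exists_ball_strictConvex fun v hv hv' =>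
    hf.inner_fderiv_gradient_pos hp (fun κ => hO.curvature_pos p κ) hv hv'
  refine ⟨r, hr, fun x hx y hy hxy hxE hyE t ht => ?_⟩
  have h1 := h x hx y hy hxy ((hf.notMem_exterior_iff (hU hx)).1 hxE)
    ((hf.notMem_exterior_iff (hU hy)).1 hyE) t ht
  have hmem : x + t • (y - x) ∈ U :=
    hU ((convex_ball p r).add_smul_sub_mem hx hy (Ioo_subset_Icc_self ht))
  exact ⟨(hf.notMem_exterior_iff hmem).2 h1.le, fun h' => h1.ne ((hf.mem_iff _ hmem).1 h')⟩

/-- A point of `O` inside the segment would be the midpoint of a short subsegment contained in a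
ball of local strict convexity. -/
theorem notMem_of_segment (hO : IsOvaloid O) {x y : Euc d} (hxy : x ≠ y)
    (h : ∀ t ∈ Icc (0 : ℝ) 1, x + t • (y - x) ∉ exterior O) {t : ℝ} (ht : t ∈ Ioo (0 : ℝ) 1) :
    x + t • (y - x) ∉ O := by
  intro hq
  obtain ⟨r, hr, hball⟩ := hO.exists_ball hq
  have hyx : 0 < ‖y - x‖ := norm_pos_iff.2 (sub_ne_zero.2 hxy.symm)
  obtain ⟨η, hη, hη1, hη2, hη3⟩ : ∃ η > 0, η ≤ t ∧ η ≤ 1 - t ∧ η * ‖y - x‖ < r := by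
    refine ⟨min (min t (1 - t)) (r / (2 * ‖y - x‖)), ?_, ?_, ?_, ?_⟩
    · have := ht.1; have : 0 < 1 - t := by linarith [ht.2]
      positivity
    · exact (min_le_left _ _).trans (min_le_left _ _)
    · exact (min_le_left _ _).trans (min_le_right _ _)
    · calc _ ≤ r / (2 * ‖y - x‖) * ‖y - x‖ := by gcongr; exact min_le_right _ _
        _ = r / 2 := by field_simp
        _ < r := by linarith
  have h1 := hball (x + (t - η) • (y - x)) ?_ (x + (t + η) • (y - x)) ?_ ?_
    (h _ ⟨by linarith, by linarith [ht.2]⟩) (h _ ⟨by linarith [ht.1], by linarith⟩)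
    (1 / 2) (by norm_num)
  · apply h1.2
    convert hq using 1
    module
  · rw [mem_ball_iff_norm, show x + (t - η) • (y - x) - (x + t • (y - x)) = (-η) • (y - x) by module,
      norm_smul, norm_neg, Real.norm_of_nonneg hη.le]
    exact hη3
  · rw [mem_ball_iff_norm, show x + (t + η) • (y - x) - (x + t • (y - x)) = η • (y - x) by module,
      norm_smul, Real.norm_of_nonneg hη.le]
    exact hη3
  · intro heq
    have : (2 * η) • (y - x) = 0 := by
      rw [← sub_eq_zero.2 heq.symm]; module
    rcases smul_eq_zero.1 this with h | h
    · linarith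
    · exact hxy (sub_eq_zero.1 h).symm

/-- Near its starting point the segment cannot be controlled by openness, since that point lies on
`O`. Instead it is pinned at a later parameter `s`, still inside the convexity ball, and local
convexity covers the parameters in `[0, s]`. -/
theorem eventually_near_left (hO : IsOvaloid O) {x y : Euc d} (hx : x ∈ O)
    (h : ∀ t ∈ Icc (0 : ℝ) 1, x + t • (y - x) ∉ exterior O) :
    ∀ᶠ q : (Euc d × Euc d) × ℝ in 𝓝 ((x, y), 0), q.1.1 ∈ O → q.1.2 ∈ O → 0 ≤ q.2 →
      q.1.1 + q.2 • (q.1.2 - q.1.1) ∉ exterior O := by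
  obtain ⟨r, hr, hball⟩ := hO.exists_ball hx
  have hconv : ∀ a ∈ Metric.ball x r, ∀ b ∈ Metric.ball x r, a ∉ exterior O → b ∉ exterior O →
      ∀ t ∈ Icc (0 : ℝ) 1, a + t • (b - a) ∉ exterior O := by
    intro a ha b hb ha' hb' t ht
    rcases eq_or_ne a b with rfl | hab
    · simpa using ha'
    rcases ht.1.eq_or_lt with rfl | h0
    · simpa using ha'
    rcases ht.2.eq_or_lt with rfl | h1
    · simpa using hb'
    exact (hball a ha b hb hab ha' hb' t ⟨h0, h1⟩).1
  -- For `x = y` take `s = 1`: the far end lies on `O`. Otherwise take a small `s`: the point there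
  -- is off `O`, so a whole neighbourhood of it avoids the exterior.
  obtain ⟨s, hs, hs1, hsb, hsE⟩ : ∃ s > (0 : ℝ), s ≤ 1 ∧ x + s • (y - x) ∈ Metric.ball x r ∧
      ∀ᶠ q : (Euc d × Euc d) × ℝ in 𝓝 ((x, y), 0), q.1.1 ∈ O → q.1.2 ∈ O →
        q.1.1 + s • (q.1.2 - q.1.1) ∉ exterior O := by
    rcases eq_or_ne x y with rfl | hxy
    · refine ⟨1, one_pos, le_rfl, by simpa using hr, Filter.Eventually.of_forall ?_⟩
      intro q _ hq
      simpa using fun hE : q.1.2 ∈ exterior O => hE.1 hq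
    · obtain ⟨s, hs, hsr⟩ : ∃ s ∈ Ioo (0 : ℝ) 1, x + s • (y - x) ∈ Metric.ball x r := by
        have h1 : Filter.Tendsto (fun s : ℝ => x + s • (y - x)) (𝓝[>] 0) (𝓝 x) := by
          have : Continuous (fun s : ℝ => x + s • (y - x)) := by fun_prop
          simpa using (this.tendsto 0).mono_left nhdsWithin_le_nhds
        exact Filter.nonempty_of_mem
          (Filter.inter_mem (Ioo_mem_nhdsGT one_pos) (h1 (Metric.ball_mem_nhds x hr)))
      refine ⟨s, hs.1, hs.2.le, hsr, ?_⟩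
      have h2 := hO.compl_exterior_mem_nhds (h s (Ioo_subset_Icc_self hs))
        (hO.notMem_of_segment hxy h hs)
      have h3 : Filter.Tendsto (fun q : (Euc d × Euc d) × ℝ => q.1.1 + s • (q.1.2 - q.1.1))
          (𝓝 ((x, y), 0)) (𝓝 (x + s • (y - x))) := by
        have : Continuous (fun q : (Euc d × Euc d) × ℝ => q.1.1 + s • (q.1.2 - q.1.1)) := by
          fun_prop
        exact this.tendsto ((x, y), 0)
      filter_upwards [h3 h2] with q hq _ _ using hq
  have h1 : ∀ᶠ q : (Euc d × Euc d) × ℝ in 𝓝 ((x, y), 0), q.1.1 ∈ Metric.ball x r := by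
    have : Continuous (fun q : (Euc d × Euc d) × ℝ => q.1.1) := by fun_prop
    exact this.tendsto ((x, y), 0) (Metric.ball_mem_nhds x hr)
  have h2 : ∀ᶠ q : (Euc d × Euc d) × ℝ in 𝓝 ((x, y), 0),
      q.1.1 + s • (q.1.2 - q.1.1) ∈ Metric.ball x r := by
    have : Continuous (fun q : (Euc d × Euc d) × ℝ => q.1.1 + s • (q.1.2 - q.1.1)) := by
      fun_prop
    exact this.tendsto ((x, y), 0) (Metric.isOpen_ball.mem_nhds hsb)
  have h3 : ∀ᶠ q : (Euc d × Euc d) × ℝ in 𝓝 ((x, y), 0), q.2 ≤ s := by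
    have : Continuous (fun q : (Euc d × Euc d) × ℝ => q.2) := by fun_prop
    exact this.tendsto ((x, y), 0) (Iic_mem_nhds hs)
  filter_upwards [hsE, h1, h2, h3] with q hqE hq1 hq2 hq3 hqx hqy hq0
  have h4 := hconv _ hq1 _ hq2 (fun hE => hE.1 hqx) (hqE hqx hqy) (q.2 / s)
    ⟨by positivity, (div_le_one hs).2 hq3⟩
  convert h4 using 2
  rw [add_sub_cancel_left, smul_smul, div_mul_cancel₀ _ hs.ne']

/-- Segments joining points of an ovaloid avoid its exterior. -/
theorem segment_notMem_exterior (hO : IsOvaloid O) {x y : Euc d} (hx : x ∈ O) (hy : y ∈ O) :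
    ∀ t ∈ Icc (0 : ℝ) 1, x + t • (y - x) ∉ exterior O := by
  -- Continuity method: `S` is closed, open and contains the diagonal, and `O ×ˢ O` is connected.
  let S : Set ↥(O ×ˢ O) := {q | ∀ t ∈ Icc (0 : ℝ) 1, q.1.1 + t • (q.1.2 - q.1.1) ∉ exterior O}
  have hconn : PreconnectedSpace ↥(O ×ˢ O) :=
    Subtype.preconnectedSpace (hO.isConnected.prod hO.isConnected).isPreconnected
  have hclosed : IsClosed S := by
    have : S = ⋂ t ∈ Icc (0 : ℝ) 1, {q : ↥(O ×ˢ O) | q.1.1 + t • (q.1.2 - q.1.1) ∉ exterior O} := by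
      ext q; simp [S]
    rw [this]
    refine isClosed_biInter fun t _ => ?_
    have hc : Continuous (fun q : ↥(O ×ˢ O) => q.1.1 + t • (q.1.2 - q.1.1)) := by fun_prop
    exact (isOpen_exterior hO.isCompact.isClosed).isClosed_compl.preimage hc
  have hopen : IsOpen S := by
    rw [isOpen_iff_mem_nhds]
    rintro ⟨⟨a, b⟩, ha, hb⟩ hq
    replace hq : ∀ t ∈ Icc (0 : ℝ) 1, a + t • (b - a) ∉ exterior O := hq
    have hq' : ∀ t ∈ Icc (0 : ℝ) 1, b + t • (a - b) ∉ exterior O := by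
      intro t ht
      have := hq (1 - t) ⟨by linarith [ht.2], by linarith [ht.1]⟩
      rwa [show a + (1 - t) • (b - a) = b + t • (a - b) by module] at this
    -- By compactness it suffices to argue near each parameter `t`. The endpoints use
    -- `eventually_near_left`, with the segment reversed at `t = 1`; interior parameters use local
    -- convexity on the diagonal, and off it that the open segment misses `O`.
    have key := isCompact_Icc.eventually_forall_of_forall_eventually
      (x₀ := (⟨(a, b), ha, hb⟩ : ↥(O ×ˢ O))) (K := Icc (0 : ℝ) 1)
      (P := fun q t => t ∈ Icc (0 : ℝ) 1 → q.1.1 + t • (q.1.2 - q.1.1) ∉ exterior O) ?_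
    · filter_upwards [key] with q h t ht using h t ht ht
    intro t ht
    have hc : Continuous (fun q : ↥(O ×ˢ O) × ℝ => (((q.1 : Euc d × Euc d), q.2) : (Euc d × Euc d) × ℝ)) :=
      by fun_prop
    rcases ht.1.eq_or_lt with rfl | h0
    · filter_upwards [hc.tendsto (⟨(a, b), ha, hb⟩, 0) (hO.eventually_near_left ha hq)]
        with q h hqt
      exact h q.1.2.1 q.1.2.2 hqt.1
    rcases ht.2.eq_or_lt with rfl | h1
    · have hc' : Continuous (fun q : ↥(O ×ˢ O) × ℝ =>
          ((((q.1 : Euc d × Euc d).2, (q.1 : Euc d × Euc d).1), 1 - q.2) : (Euc d × Euc d) × ℝ)) :=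
        by fun_prop
      have h2 := hc'.tendsto (⟨(a, b), ha, hb⟩, 1)
      simp only [sub_self] at h2
      filter_upwards [h2 (hO.eventually_near_left hb hq')] with q h hqt
      have := h q.1.2.2 q.1.2.1 (by linarith [hqt.2])
      rwa [show (q.1 : Euc d × Euc d).2 + (1 - q.2) • ((q.1 : Euc d × Euc d).1 -
        (q.1 : Euc d × Euc d).2) = (q.1 : Euc d × Euc d).1 + q.2 • ((q.1 : Euc d × Euc d).2 -
        (q.1 : Euc d × Euc d).1) by module] at this
    · rcases eq_or_ne a b with rfl | hab
      · obtain ⟨r, hr, hball⟩ := hO.exists_ball ha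
        have hm1 : ∀ᶠ q : ↥(O ×ˢ O) × ℝ in 𝓝 (⟨(a, a), ha, hb⟩, t), q.1.1.1 ∈ Metric.ball a r := by
          have : Continuous (fun q : ↥(O ×ˢ O) × ℝ => q.1.1.1) := by fun_prop
          exact this.tendsto (⟨(a, a), ha, hb⟩, t) (Metric.ball_mem_nhds a hr)
        have hm2 : ∀ᶠ q : ↥(O ×ˢ O) × ℝ in 𝓝 (⟨(a, a), ha, hb⟩, t), q.1.1.2 ∈ Metric.ball a r := by
          have : Continuous (fun q : ↥(O ×ˢ O) × ℝ => q.1.1.2) := by fun_prop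
          exact this.tendsto (⟨(a, a), ha, hb⟩, t) (Metric.ball_mem_nhds a hr)
        have hm3 : ∀ᶠ q : ↥(O ×ˢ O) × ℝ in 𝓝 (⟨(a, a), ha, hb⟩, t), q.2 ∈ Ioo (0 : ℝ) 1 :=
          continuousAt_snd (Ioo_mem_nhds h0 h1)
        filter_upwards [hm1, hm2, hm3] with q hq1 hq2 hq3 _
        rcases eq_or_ne q.1.1.1 q.1.1.2 with he | he
        · rw [← he, sub_self, smul_zero, add_zero]
          exact fun hE => hE.1 q.1.2.1
        · exact (hball _ hq1 _ hq2 he (fun hE => hE.1 q.1.2.1) (fun hE => hE.1 q.1.2.2)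
            q.2 hq3).1
      · have h2 := hO.compl_exterior_mem_nhds (hq t ht) (hO.notMem_of_segment hab hq ⟨h0, h1⟩)
        have h3 : Continuous (fun q : ↥(O ×ˢ O) × ℝ => q.1.1.1 + q.2 • (q.1.1.2 - q.1.1.1)) := by fun_prop
        filter_upwards [h3.tendsto (⟨(a, b), ha, hb⟩, t) h2] with q h _ using h
  have huniv : S = univ := by
    refine IsClopen.eq_univ ⟨hclosed, hopen⟩ ⟨⟨(x, x), hx, hx⟩, fun t _ => ?_⟩
    simpa using fun hE : x ∈ exterior O => hE.1 hx
  have : (⟨(x, y), hx, hy⟩ : ↥(O ×ˢ O)) ∈ S := huniv ▸ mem_univ _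
  exact this

/-- An ovaloid lies on one side of each of its tangent hyperplanes. -/
theorem inner_unitNormal_le (hO : IsOvaloid O) (hp : p ∈ O)
    (hf : IsOutwardDefiningFunction O p U f) {x : Euc d} (hx : x ∈ O) :
    inner ℝ (unitNormal f p) x ≤ inner ℝ (unitNormal f p) p := by
  have hf0 : f p = 0 := (hf.mem_iff p hf.mem).1 hp
  have h1 := (hf.hasDerivAt_line hf.mem (x - p)).tendsto_slope.mono_left
    (nhdsWithin_mono (0 : ℝ) (fun t (ht : t ∈ Ioi (0 : ℝ)) => ne_of_gt ht))
  have h2 : inner ℝ (gradient f p) (x - p) ≤ 0 := by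
    -- The segment from `p` to `x` avoids the exterior, so `f ≤ 0` along it near `p`, whereas `f p =
    -- 0`.
    refine le_of_tendsto h1 ?_
    filter_upwards [hf.eventually_line_mem hf.mem (x - p), Ioo_mem_nhdsGT one_pos] with t ht ht0
    have h3 : f (p + t • (x - p)) ≤ 0 := (hf.notMem_exterior_iff ht).1
      (hO.segment_notMem_exterior hp hx t (Ioo_subset_Icc_self ht0))
    simp only [slope_def_field, zero_smul, add_zero, hf0, sub_zero]
    exact div_nonpos_of_nonpos_of_nonneg h3 ht0.1.le
  rw [← sub_nonpos, ← inner_sub_right, unitNormal, inner_smul_left]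
  exact mul_nonpos_of_nonneg_of_nonpos (by simp) h2

/-- A linear functional has at most one maximum point on an ovaloid. -/
theorem eq_of_isMax (hO : IsOvaloid O) (hu : u ≠ 0) {x y : Euc d} (hx : x ∈ O) (hy : y ∈ O)
    (hxm : ∀ q ∈ O, inner ℝ u q ≤ inner ℝ u x) (hym : ∀ q ∈ O, inner ℝ u q ≤ inner ℝ u y) :
    x = y := by
  by_contra hxy
  have hs := hO.segment_notMem_exterior hx hy
  -- The midpoint has a neighbourhood disjoint from the exterior. It also has maximal height, so
  -- pushing it slightly along `u` does lead into the exterior.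
  have hE := hO.compl_exterior_mem_nhds (hs (1 / 2) (by norm_num))
    (hO.notMem_of_segment hxy hs (t := 1 / 2) (by norm_num))
  have h1 : Filter.Tendsto (fun s : ℝ => x + (1 / 2 : ℝ) • (y - x) + s • u) (𝓝[>] 0)
      (𝓝 (x + (1 / 2 : ℝ) • (y - x))) := by
    have : Continuous (fun s : ℝ => x + (1 / 2 : ℝ) • (y - x) + s • u) := by fun_prop
    simpa using (this.tendsto 0).mono_left nhdsWithin_le_nhds
  obtain ⟨s, hs1, hs0⟩ := Filter.nonempty_of_mem (Filter.inter_mem (Filter.mem_map.1 (h1 hE)) self_mem_nhdsWithin)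
  refine hs1 (mem_exterior_of_forall_inner_lt hu fun q hq => (hxm q hq).trans_lt ?_)
  have h2 : inner ℝ u x = inner ℝ u y := le_antisymm (hym x hx) (hxm y hy)
  have h3 : 0 < inner ℝ u u := real_inner_self_pos.2 hu
  simp only [inner_add_right, inner_smul_right, inner_sub_right, ← h2, sub_self, mul_zero,
    add_zero]
  nlinarith [mul_pos (show (0 : ℝ) < s from hs0) h3]

end IsOvaloid

end ConvexTube

namespace ConvexTube

variable {d : ℕ} {γ : Euc d → Euc d}

/-! ### Constructing ovaloids from their support parametrization -/

/-- The map `γ`, constant on rays, restricts to an inverse Gauss map of a positively curved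
hypersurface: its differential takes values in the tangent spaces of the sphere and is positive
definite there. -/
structure IsSupportField (γ : Euc d → Euc d) : Prop where
  smooth : ContDiffOn ℝ ∞ γ {0}ᶜ
  smul : ∀ y, ∀ r : ℝ, 0 < r → γ (r • y) = γ y
  perp : ∀ y, y ≠ 0 → ∀ w, inner ℝ y (fderiv ℝ γ y w) = 0
  pos : ∀ y w, y ≠ 0 → inner ℝ y w = 0 → w ≠ 0 → 0 < inner ℝ (fderiv ℝ γ y w) w

theorem exists_unit_orthogonal (hd : 1 ≤ d) (u : Euc d) :
    ∃ m : Euc d, ‖m‖ = 1 ∧ inner ℝ u m = 0 := by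
  have hne : (ℝ ∙ u)ᗮ ≠ ⊥ := by
    intro h
    have h1 := Submodule.finrank_add_finrank_orthogonal (ℝ ∙ u)
    have h2 : Module.finrank ℝ (ℝ ∙ u) ≤ 1 := by
      simpa using finrank_span_le_card (R := ℝ) ({u} : Set (Euc d))
    rw [h, finrank_bot, finrank_euclideanSpace_fin] at h1
    omega
  obtain ⟨v, hv, hv0⟩ := Submodule.exists_mem_ne_zero_of_ne_bot hne
  refine ⟨‖v‖⁻¹ • v, by simp [norm_smul, hv0], ?_⟩
  rw [inner_smul_right, Submodule.mem_orthogonal_singleton_iff_inner_right.1 hv, mul_zero]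

/-- Two distinct unit vectors lie on a great circle. -/
theorem exists_great_circle (hd : 1 ≤ d) {x y : Euc d} (hx : ‖x‖ = 1) (hy : ‖y‖ = 1)
    (hxy : x ≠ y) :
    ∃ m : Euc d, ∃ a : ℝ, ‖m‖ = 1 ∧ inner ℝ y m = 0 ∧ 0 < a ∧ a ≤ Real.pi ∧
      x = Real.cos a • y + Real.sin a • m := by
  set c : ℝ := inner ℝ x y with hc
  have hc1 : c ≤ 1 := by simpa [hx, hy] using real_inner_le_norm x y
  have hc2 : -1 ≤ c := by
    have := neg_le_of_abs_le (abs_real_inner_le_norm x y)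
    rwa [hx, hy, mul_one] at this
  have hc3 : c ≠ 1 := fun h => hxy ((inner_eq_one_iff_of_norm_eq_one hx hy).1 h)
  have hcos : Real.cos (Real.arccos c) = c := Real.cos_arccos hc2 hc1
  have ha0 : 0 < Real.arccos c := Real.arccos_pos.2 (lt_of_le_of_ne hc1 hc3)
  have hnorm : ‖x - c • y‖ ^ 2 = 1 - c ^ 2 := by
    rw [norm_sub_sq_real, hx, inner_smul_right, ← hc, norm_smul, hy, mul_one, Real.norm_eq_abs,
      sq_abs]
    ring
  have hsin : Real.sin (Real.arccos c) = ‖x - c • y‖ := by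
    rw [Real.sin_arccos, ← hnorm, Real.sqrt_sq (norm_nonneg _)]
  -- This is the antipodal case `x = -y`: any unit vector orthogonal to `y` serves, and one exists
  -- because `1 ≤ d`.
  by_cases hv : x - c • y = 0
  · obtain ⟨m, hm, hym⟩ := exists_unit_orthogonal hd y
    refine ⟨m, Real.arccos c, hm, hym, ha0, Real.arccos_le_pi c, ?_⟩
    rw [hsin, hcos, hv, norm_zero, zero_smul, add_zero]
    exact sub_eq_zero.1 hv
  · have hv' : ‖x - c • y‖ ≠ 0 := norm_ne_zero_iff.2 hv
    refine ⟨‖x - c • y‖⁻¹ • (x - c • y), Real.arccos c, ?_, ?_, ha0, Real.arccos_le_pi c, ?_⟩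
    · rw [norm_smul, norm_inv, norm_norm, inv_mul_cancel₀ hv']
    · rw [inner_smul_right, inner_sub_right, inner_smul_right, real_inner_comm, ← hc,
        real_inner_self_eq_norm_sq, hy]
      ring
    · rw [hsin, hcos, smul_smul, mul_inv_cancel₀ hv', one_smul]
      abel

namespace IsSupportField

theorem contDiffAt (hγ : IsSupportField γ) {y : Euc d} (hy : y ≠ 0) : ContDiffAt ℝ ∞ γ y :=
  hγ.smooth.contDiffAt (isOpen_compl_singleton.mem_nhds hy)

theorem hasFDerivAt (hγ : IsSupportField γ) {y : Euc d} (hy : y ≠ 0) :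
    HasFDerivAt γ (fderiv ℝ γ y) y :=
  ((hγ.contDiffAt hy).differentiableAt (by simp)).hasFDerivAt

/-- Along the great circle `P` from `y` to `x` with velocity `Q`, write `y = cos s • P - sin s • Q`.
Since the differential of `γ` is orthogonal to `P`, the height `⟨y, γ (P s)⟩` has derivative `-sin s
⟨dγ Q, Q⟩`, which is negative on `(0, π)`. -/
theorem inner_lt (hγ : IsSupportField γ) (hd : 1 ≤ d) {x y : Euc d} (hx : ‖x‖ = 1)
    (hy : ‖y‖ = 1) (hxy : x ≠ y) : inner ℝ y (γ x) < inner ℝ y (γ y) := by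
  obtain ⟨m, a, hm, hym, ha0, haπ, rfl⟩ := exists_great_circle hd hx hy hxy
  have hyy : inner ℝ y y = (1 : ℝ) := by rw [real_inner_self_eq_norm_sq, hy, one_pow]
  have hmm : inner ℝ m m = (1 : ℝ) := by rw [real_inner_self_eq_norm_sq, hm, one_pow]
  have hmy : inner ℝ m y = (0 : ℝ) := by rw [real_inner_comm, hym]
  let P : ℝ → Euc d := fun s => Real.cos s • y + Real.sin s • m
  let Q : ℝ → Euc d := fun s => -Real.sin s • y + Real.cos s • m
  have hPP : ∀ s, inner ℝ (P s) (P s) = (1 : ℝ) := by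
    intro s
    simp only [P, inner_add_left, inner_add_right, inner_smul_left, inner_smul_right, hyy, hmm,
      hym, hmy, conj_trivial]
    linarith [Real.cos_sq_add_sin_sq s]
  have hQQ : ∀ s, inner ℝ (Q s) (Q s) = (1 : ℝ) := by
    intro s
    simp only [Q, inner_add_left, inner_add_right, inner_smul_left, inner_smul_right, hyy, hmm,
      hym, hmy, conj_trivial]
    linarith [Real.cos_sq_add_sin_sq s]
  have hPQ : ∀ s, inner ℝ (P s) (Q s) = (0 : ℝ) := by
    intro s
    simp only [P, Q, inner_add_left, inner_add_right, inner_smul_left, inner_smul_right, hyy, hmm,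
      hym, hmy, conj_trivial]
    ring
  have hP0 : ∀ s, P s ≠ 0 := fun s h => by have := hPP s; rw [h, inner_zero_left] at this; simp at this
  have hQ0 : ∀ s, Q s ≠ 0 := fun s h => by have := hQQ s; rw [h, inner_zero_left] at this; simp at this
  have hyPQ : ∀ s, y = Real.cos s • P s - Real.sin s • Q s := by
    intro s
    simp only [P, Q, smul_add, smul_smul]
    have := Real.cos_sq_add_sin_sq s
    rw [show Real.cos s * Real.cos s = 1 - Real.sin s * Real.sin s by linarith]
    module
  have hPd : ∀ s, HasDerivAt P (Q s) s := fun s =>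
    ((Real.hasDerivAt_cos s).smul_const y).add ((Real.hasDerivAt_sin s).smul_const m)
  have hder : ∀ s, HasDerivAt (fun s => (inner ℝ y (γ (P s)) : ℝ))
      (-Real.sin s * inner ℝ (fderiv ℝ γ (P s) (Q s)) (Q s)) s := by
    intro s
    have h1 := (hasDerivAt_const s y).inner ℝ ((hγ.hasFDerivAt (hP0 s)).comp_hasDerivAt s (hPd s))
    refine h1.congr_deriv ?_
    rw [inner_zero_left, add_zero]
    conv_lhs => rw [hyPQ s]
    rw [inner_sub_left, inner_smul_left, inner_smul_left, hγ.perp _ (hP0 s), real_inner_comm (Q s)]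
    simp
  have hanti : StrictAntiOn (fun s => (inner ℝ y (γ (P s)) : ℝ)) (Icc 0 a) := by
    refine strictAntiOn_of_deriv_neg (convex_Icc 0 a)
      (fun s _ => (hder s).continuousAt.continuousWithinAt) fun s hs => ?_
    rw [interior_Icc] at hs
    rw [(hder s).deriv]
    have h1 := Real.sin_pos_of_pos_of_lt_pi hs.1 (hs.2.trans_le haπ)
    have h2 := hγ.pos _ _ (hP0 s) (hPQ s) (hQ0 s)
    nlinarith [mul_pos h1 h2]
  have h1 := hanti ⟨le_rfl, ha0.le⟩ ⟨ha0.le, le_rfl⟩ ha0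
  simpa [P] using h1

theorem inner_le (hγ : IsSupportField γ) (hd : 1 ≤ d) {x y : Euc d} (hx : ‖x‖ = 1)
    (hy : ‖y‖ = 1) : inner ℝ y (γ x) ≤ inner ℝ y (γ y) := by
  rcases eq_or_ne x y with rfl | hxy
  · exact le_rfl
  · exact (hγ.inner_lt hd hx hy hxy).le

/-- The open convex body bounded by the hypersurface. -/
def body (γ : Euc d → Euc d) : Set (Euc d) := {x | ∀ n : Sph d, inner ℝ (n : Euc d) x < inner ℝ (n : Euc d) (γ n)}

/-- The function `y ↦ ⟨y, γ y - x⟩` is nonnegative and vanishes at `m`, so its differential vanishes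
there. By `perp` that differential is `⟨·, γ m - x⟩`. -/
theorem eq_of_inner_eq (hγ : IsSupportField γ) {x : Euc d} {m : Sph d}
    (hle : ∀ n : Sph d, inner ℝ (n : Euc d) x ≤ inner ℝ (n : Euc d) (γ n))
    (heq : inner ℝ (m : Euc d) x = inner ℝ (m : Euc d) (γ m)) : x = γ m := by
  have hm : (m : Euc d) ≠ 0 := ne_zero_of_mem_unit_sphere m
  have hnn : ∀ y : Euc d, y ≠ 0 → 0 ≤ inner ℝ y (γ y - x) := by
    intro y hy
    have h1 := hle (sphereProj y)
    rw [coe_sphereProj hy, hγ.smul y _ (by positivity), ← sub_nonneg, ← inner_sub_right,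
      inner_smul_left] at h1
    have h2 : (0 : ℝ) < ‖y‖⁻¹ := by positivity
    exact nonneg_of_mul_nonneg_right h1 h2
  have hmin : IsLocalMin (fun y : Euc d => (inner ℝ y (γ y - x) : ℝ)) m := by
    filter_upwards [isOpen_compl_singleton.mem_nhds hm] with y hy
    rw [inner_sub_right, ← heq, sub_self]
    exact hnn y hy
  have hder := (hasFDerivAt_id (m : Euc d)).inner ℝ ((hγ.hasFDerivAt hm).sub_const x)
  have h0 := hmin.hasFDerivAt_eq_zero hder
  have h1 := congrArg (fun L => L (γ m - x)) h0
  simp only [ContinuousLinearMap.comp_apply, ContinuousLinearMap.prod_apply,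
    fderivInnerCLM_apply, zero_apply, id_eq, hγ.perp _ hm, zero_add,
    ContinuousLinearMap.id_apply] at h1
  exact (sub_eq_zero.1 (inner_self_eq_zero.1 h1)).symm

theorem continuous_comp_coe (hγ : IsSupportField γ) : Continuous fun u : Sph d => γ u :=
  hγ.smooth.continuousOn.comp_continuous continuous_subtype_val
    fun u => ne_zero_of_mem_unit_sphere u

theorem isOpen_body (hγ : IsSupportField γ) : IsOpen (body γ) := by
  rw [isOpen_iff_mem_nhds]
  intro x hx
  have h1 : Continuous fun z : Euc d × Sph d => (inner ℝ (z.2 : Euc d) z.1 : ℝ) := by fun_prop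
  have h2 : Continuous fun z : Euc d × Sph d => (inner ℝ (z.2 : Euc d) (γ z.2) : ℝ) :=
    (continuous_subtype_val.comp continuous_snd).inner (hγ.continuous_comp_coe.comp continuous_snd)
  have key := isCompact_univ.eventually_forall_of_forall_eventually (x₀ := x)
    (K := (univ : Set (Sph d)))
    (P := fun x n => inner ℝ (n : Euc d) x < inner ℝ (n : Euc d) (γ n))
    fun n _ => (isOpen_lt h1 h2).mem_nhds (hx n)
  filter_upwards [key] with y hy n using hy n trivial

theorem isBounded_body (hγ : IsSupportField γ) : Bornology.IsBounded (body γ) := by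
  obtain ⟨R, hR⟩ := (isCompact_range hγ.continuous_comp_coe).isBounded.exists_norm_le
  refine isBounded_iff_forall_norm_le.2 ⟨max R 0, fun x hx => ?_⟩
  by_cases hx0 : x = 0
  · simp [hx0]
  have h1 := hx (sphereProj x)
  have h2 : inner ℝ (sphereProj x : Euc d) x = ‖x‖ := by
    rw [coe_sphereProj hx0, inner_smul_left, real_inner_self_eq_norm_sq]
    have : ‖x‖ ≠ 0 := norm_ne_zero_iff.2 hx0
    simp; field_simp
  have h3 := real_inner_le_norm (sphereProj x : Euc d) (γ (sphereProj x))
  rw [norm_eq_of_mem_sphere, one_mul] at h3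
  have h4 := hR _ (mem_range_self (sphereProj x))
  exact le_max_of_le_left (by linarith)

theorem notMem_range_of_mem_body {x : Euc d} (hx : x ∈ body γ) :
    x ∉ range fun u : Sph d => γ u := by
  rintro ⟨m, rfl⟩
  exact lt_irrefl _ (hx m)

/-- By `eq_of_inner_eq`, a limit point of the body outside the body lies on the hypersurface. A
component of the complement that meets the body therefore stays in it, and the body is bounded. -/
theorem notMem_exterior_of_mem_body (hγ : IsSupportField γ) {x : Euc d} (hx : x ∈ body γ) :
    x ∉ exterior (range fun u : Sph d => γ u) := by
  rintro ⟨-, hE⟩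
  refine hE (hγ.isBounded_body.subset ?_)
  refine isPreconnected_connectedComponentIn.subset_of_closure_inter_subset hγ.isOpen_body
    ⟨x, mem_connectedComponentIn (notMem_range_of_mem_body hx), hx⟩ ?_
  rintro y ⟨hy, hyO⟩
  have hle : ∀ n : Sph d, inner ℝ (n : Euc d) y ≤ inner ℝ (n : Euc d) (γ n) := by
    intro n
    have hcl : IsClosed {y : Euc d | inner ℝ (n : Euc d) y ≤ inner ℝ (n : Euc d) (γ n)} :=
      isClosed_le (by fun_prop) continuous_const
    exact closure_minimal (fun z hz => (hz n).le) hcl hy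
  intro n
  refine lt_of_le_of_ne (hle n) fun heq => connectedComponentIn_subset _ _ hyO ?_
  exact ⟨n, (hγ.eq_of_inner_eq hle heq).symm⟩

/-- The cone over the hypersurface with vertex `q`. -/
noncomputable def cone (γ : Euc d → Euc d) (q : Euc d) (y : Euc d) : Euc d := q + ‖y‖ • (γ y - q)

/-- The midpoint of two points with antipodal normals works: a given `n` differs from at least one
of these normals, which makes the inequality strict. -/
theorem exists_mem_body (hγ : IsSupportField γ) (hd : 1 ≤ d) : ∃ q, q ∈ body γ := by
  obtain ⟨m, hm, -⟩ := exists_unit_orthogonal hd (0 : Euc d)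
  have hm' : ‖-m‖ = 1 := by rwa [norm_neg]
  have hne : m ≠ -m := fun h => by
    have h2 : (2 : ℝ) • m = 0 := by rw [two_smul]; nth_rewrite 2 [h]; simp
    rw [(smul_eq_zero.1 h2).resolve_left two_ne_zero, norm_zero] at hm
    exact zero_ne_one hm
  refine ⟨(1 / 2 : ℝ) • (γ m + γ (-m)), fun n => ?_⟩
  have hn : ‖(n : Euc d)‖ = 1 := norm_eq_of_mem_sphere n
  rw [inner_smul_right, inner_add_right]
  rcases eq_or_ne m n with h | h
  · have h1 := hγ.inner_lt hd hm' hn (by rw [← h]; exact hne.symm)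
    have h2 := hγ.inner_le hd hm hn
    linarith
  · have h1 := hγ.inner_lt hd hm hn h
    have h2 := hγ.inner_le hd hm' hn
    linarith

theorem inner_pos_of_mem_body (hγ : IsSupportField γ) {q y : Euc d} (hq : q ∈ body γ)
    (hy : y ≠ 0) : 0 < inner ℝ y (γ y - q) := by
  have h1 := hq (sphereProj y)
  have h2 : (0 : ℝ) < ‖y‖⁻¹ := by positivity
  rw [coe_sphereProj hy, hγ.smul y _ h2, ← sub_pos, ← inner_sub_right, inner_smul_left] at h1
  exact pos_of_mul_pos_right h1 h2.le

theorem contDiffAt_cone (hγ : IsSupportField γ) (q : Euc d) {y : Euc d} (hy : y ≠ 0) :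
    ContDiffAt ℝ ∞ (cone γ q) y :=
  contDiffAt_const.add ((contDiffAt_norm ℝ hy).smul ((hγ.contDiffAt hy).sub contDiffAt_const))

/-- Pair a kernel vector's image with `y`: the part from `γ` drops out and `⟨y, γ y - q⟩ > 0` forces
the vector to be orthogonal to `y`. Positivity of the differential of `γ` then forces it to vanish.
-/
theorem exists_equiv_hasFDerivAt_cone (hγ : IsSupportField γ) {q y : Euc d} (hq : q ∈ body γ)
    (hy : y ≠ 0) :
    ∃ L : Euc d ≃L[ℝ] Euc d, HasFDerivAt (cone γ q) (L : Euc d →L[ℝ] Euc d) y := by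
  have hn : HasFDerivAt (fun y : Euc d => ‖y‖) (fderiv ℝ (fun y : Euc d => ‖y‖) y) y :=
    ((contDiffAt_norm (n := 1) ℝ hy).differentiableAt (by simp)).hasFDerivAt
  have hn' : ∀ w, ‖y‖ * fderiv ℝ (fun y : Euc d => ‖y‖) y w = inner ℝ y w := by
    intro w
    have h1 := hn.pow 2
    have h2 := (hasStrictFDerivAt_norm_sq y).hasFDerivAt
    have h3 := congrArg (fun L => L w) (h1.unique h2)
    simp at h3
    linarith
  have hG : HasFDerivAt (cone γ q) _ y :=
    (hn.smul ((hγ.hasFDerivAt hy).sub_const q)).const_add q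
  set D := ‖y‖ • fderiv ℝ γ y + (fderiv ℝ (fun y : Euc d => ‖y‖) y).smulRight (γ y - q) with hD
  have hDw : ∀ w, D w = ‖y‖ • fderiv ℝ γ y w + fderiv ℝ (fun y : Euc d => ‖y‖) y w • (γ y - q) :=
    fun w => by simp [hD]
  have hinj : Function.Injective D.toLinearMap := by
    rw [← LinearMap.ker_eq_bot, LinearMap.ker_eq_bot']
    intro w hw
    have hw' : ‖y‖ • fderiv ℝ γ y w + fderiv ℝ (fun y : Euc d => ‖y‖) y w • (γ y - q) = 0 := by
      rw [← hDw]; exact hw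
    have h1 := congrArg (fun v => (inner ℝ y v : ℝ)) hw'
    simp only [inner_add_right, inner_smul_right, hγ.perp y hy, mul_zero, zero_add,
      inner_zero_right] at h1
    have h2 : fderiv ℝ (fun y : Euc d => ‖y‖) y w = 0 :=
      (mul_eq_zero.1 h1).resolve_right (hγ.inner_pos_of_mem_body hq hy).ne'
    have h3 : inner ℝ y w = 0 := by rw [← hn', h2, mul_zero]
    rw [h2, zero_smul, add_zero] at hw'
    have h4 := (smul_eq_zero.1 hw').resolve_left (norm_ne_zero_iff.2 hy)
    by_contra hw0
    have h5 := hγ.pos y w hy h3 hw0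
    rw [h4, inner_zero_left] at h5
    exact lt_irrefl _ h5
  exact ⟨(LinearEquiv.ofInjectiveEndo D.toLinearMap hinj).toContinuousLinearEquiv,
    hG.congr_fderiv (by ext1; rfl)⟩

/-- A local inverse of the cone over an interior point `q` provides the gauge of the body about `q`;
the defining function is the gauge minus `1`. -/
theorem exists_isOutwardDefiningFunction (hγ : IsSupportField γ) (hd : 1 ≤ d) (u : Sph d) :
    ∃ U f, IsOutwardDefiningFunction (range fun u : Sph d => γ u) (γ u) U f := by
  obtain ⟨q, hq⟩ := hγ.exists_mem_body hd
  have hu : (u : Euc d) ≠ 0 := ne_zero_of_mem_unit_sphere u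
  have hcu : cone γ q u = γ u := by simp [cone]
  obtain ⟨L, hL⟩ := hγ.exists_equiv_hasFDerivAt_cone hq hu
  set e := (hγ.contDiffAt_cone q hu).toOpenPartialHomeomorph (cone γ q) hL (by simp) with he
  have hecoe : ∀ y, e y = cone γ q y := fun y => rfl
  have hus : (u : Euc d) ∈ e.source :=
    (hγ.contDiffAt_cone q hu).mem_toOpenPartialHomeomorph_source hL (by simp)
  have hut : γ u ∈ e.target := by rw [← hcu, ← hecoe]; exact e.map_source hus
  have heu : e.symm (γ u) = u := by rw [← hcu, ← hecoe]; exact e.left_inv hus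
  -- Here `x = q + ‖y‖ • (γ n - q)`, so comparing `‖y‖` with `1` decides whether `x` is in the body,
  -- on the hypersurface or beyond the supporting hyperplane with normal `n`.
  have hO : ∀ x ∈ e.target, e.symm x ≠ 0 →
      (x ∈ range (fun u : Sph d => γ u) ↔ ‖e.symm x‖ - 1 = 0) ∧
      (x ∈ exterior (range fun u : Sph d => γ u) ↔ 0 < ‖e.symm x‖ - 1) := by
    intro x hx hx0
    set y := e.symm x with hy
    have hxy : x = cone γ q y := by rw [← hecoe, hy, e.right_inv hx]
    have hypos : 0 < ‖y‖ := norm_pos_iff.2 hx0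
    set n := sphereProj y with hn
    have hny : γ y = γ n := by rw [hn, coe_sphereProj hx0, hγ.smul y _ (by positivity)]
    have hxn : x = q + ‖y‖ • (γ n - q) := by rw [hxy, cone, hny]
    have hn1 : ‖(n : Euc d)‖ = 1 := norm_eq_of_mem_sphere n
    have hlt : ‖y‖ < 1 → x ∈ body γ := by
      intro h m
      have h1 := hq m
      have h2 := hγ.inner_le hd hn1 (norm_eq_of_mem_sphere m)
      rw [hxn, inner_add_right, inner_smul_right, inner_sub_right]
      nlinarith [mul_nonneg hypos.le (sub_nonneg.2 h2), mul_pos (sub_pos.2 h) (sub_pos.2 h1)]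
    have heq : ‖y‖ = 1 → x ∈ range fun u : Sph d => γ u := fun h => ⟨n, by simp [hxn, h]⟩
    have hgt : 1 < ‖y‖ → x ∈ exterior (range fun u : Sph d => γ u) := by
      intro h
      refine mem_exterior_of_forall_inner_lt (ne_zero_of_mem_unit_sphere n) ?_
      rintro _ ⟨m, rfl⟩
      have h1 := hq n
      have h2 := hγ.inner_le hd (norm_eq_of_mem_sphere m) hn1
      refine h2.trans_lt ?_
      rw [hxn, inner_add_right, inner_smul_right, inner_sub_right]
      nlinarith [mul_pos (sub_pos.2 h) (sub_pos.2 h1)]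
    rcases lt_trichotomy ‖y‖ 1 with h | h | h
    · exact ⟨⟨fun h' => absurd h' (notMem_range_of_mem_body (hlt h)), fun h' => by linarith⟩,
        ⟨fun h' => absurd h' (hγ.notMem_exterior_of_mem_body (hlt h)), fun h' => by linarith⟩⟩
    · exact ⟨⟨fun _ => by linarith, fun _ => heq h⟩,
        ⟨fun h' => absurd (heq h) h'.1, fun h' => by linarith⟩⟩
    · exact ⟨⟨fun h' => absurd h' (hgt h).1, fun h' => by linarith⟩,
        ⟨fun _ => by linarith, fun _ => hgt h⟩⟩
  have hsm : ∀ x ∈ e.target, e.symm x ≠ 0 → ContDiffAt ℝ ∞ e.symm x := by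
    intro x hx hx0
    obtain ⟨L', hL'⟩ := hγ.exists_equiv_hasFDerivAt_cone hq hx0
    exact e.contDiffAt_symm hx hL' (hγ.contDiffAt_cone q hx0)
  refine ⟨e.target ∩ e.symm ⁻¹' {0}ᶜ, fun x => ‖e.symm x‖ - 1, ?_, ?_, ?_, ?_, ?_, ?_⟩
  · exact e.symm.isOpen_inter_preimage isOpen_compl_singleton
  · exact ⟨hut, by simp [heu, hu]⟩
  · rintro x ⟨hx, hx0⟩
    exact (((hsm x hx hx0).norm ℝ hx0).sub contDiffAt_const).contDiffWithinAt
  -- Along the ray of the cone through `x` the function is `t ↦ t * ‖y‖ - 1`, whose slope `‖y‖` is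
  -- nonzero.
  · rintro x ⟨hx, hx0⟩ hgrad
    have hx0' : e.symm x ≠ 0 := hx0
    set y := e.symm x with hy
    have hys : y ∈ e.source := e.map_target hx
    have hd1 : DifferentiableAt ℝ (fun x => ‖e.symm x‖ - 1) x :=
      (((hsm x hx hx0).norm ℝ hx0).sub contDiffAt_const).differentiableAt (by simp)
    have hxy : cone γ q y = x := by rw [← hecoe, hy, e.right_inv hx]
    have h0 : HasFDerivAt (fun x => ‖e.symm x‖ - 1) (0 : Euc d →L[ℝ] ℝ) (cone γ q y) := by
      rw [hxy]
      have : fderiv ℝ (fun x => ‖e.symm x‖ - 1) x = 0 := by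
        rw [← toDual_gradient, hgrad, map_zero]
      rw [← this]
      exact hd1.hasFDerivAt
    obtain ⟨L', hL'⟩ := hγ.exists_equiv_hasFDerivAt_cone hq hx0'
    have h1 : HasFDerivAt (fun y => ‖e.symm (cone γ q y)‖ - 1) _ y := h0.comp y hL'
    have hl : HasDerivAt (fun t : ℝ => t • y) y 1 := by
      simpa using (hasDerivAt_id (1 : ℝ)).smul_const y
    have h2 : HasDerivAt (fun t : ℝ => ‖e.symm (cone γ q (t • y))‖ - 1) 0 1 := by
      have h1' : HasFDerivAt (fun y => ‖e.symm (cone γ q y)‖ - 1)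
        ((0 : Euc d →L[ℝ] ℝ).comp (L' : Euc d →L[ℝ] Euc d)) ((1 : ℝ) • y) := by
        rw [one_smul]; exact h1
      have h := h1'.comp_hasDerivAt 1 hl
      rw [ContinuousLinearMap.zero_comp, zero_apply] at h
      exact h
    have h3 : (fun t : ℝ => t * ‖y‖ - 1) =ᶠ[𝓝 1] fun t : ℝ => ‖e.symm (cone γ q (t • y))‖ - 1 := by
      have hm : ∀ᶠ t in 𝓝 (1 : ℝ), t • y ∈ e.source := by
        have := hl.continuousAt.eventually (e.open_source.mem_nhds (by simpa using hys))
        exact this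
      filter_upwards [hm, lt_mem_nhds (zero_lt_one' ℝ)] with t ht ht0
      rw [← hecoe, e.left_inv ht, norm_smul, Real.norm_of_nonneg ht0.le]
    have h4 : HasDerivAt (fun t : ℝ => t * ‖y‖ - 1) ‖y‖ 1 := by
      simpa using ((hasDerivAt_id (1 : ℝ)).mul_const ‖y‖).sub_const 1
    exact norm_ne_zero_iff.2 hx0' (h4.unique (h2.congr_of_eventuallyEq h3))
  · exact fun x hx => (hO x hx.1 hx.2).1
  · exact fun x hx => (hO x hx.1 hx.2).2

theorem isMax (hγ : IsSupportField γ) (hd : 1 ≤ d) (u : Sph d) :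
    ∀ y ∈ range (fun u : Sph d => γ u), inner ℝ (u : Euc d) y ≤ inner ℝ (u : Euc d) (γ u) := by
  rintro _ ⟨m, rfl⟩
  exact hγ.inner_le hd (norm_eq_of_mem_sphere m) (norm_eq_of_mem_sphere u)

theorem unitNormal_eq (hγ : IsSupportField γ) (hd : 1 ≤ d) (u : Sph d) {U : Set (Euc d)}
    {f : Euc d → ℝ}
    (hf : IsOutwardDefiningFunction (range fun u : Sph d => γ u) (γ u) U f) :
    unitNormal f (γ u) = u :=
  hf.unitNormal_eq ⟨u, rfl⟩ (norm_eq_of_mem_sphere u) (hγ.isMax hd u)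

/-- A point of the hypersurface is some `γ m`, and every defining function has normal `m` there. So
the choice in `gaussInverse` is forced. -/
theorem gaussInverse_eq (hγ : IsSupportField γ) (hd : 1 ≤ d) (u : Sph d) :
    gaussInverse (range fun u : Sph d => γ u) u = γ u := by
  obtain ⟨U, f, hf⟩ := hγ.exists_isOutwardDefiningFunction hd u
  have h1 : IsOuterUnitNormal (range fun u : Sph d => γ u) (γ u) u :=
    ⟨⟨u, rfl⟩, U, f, hf, (hγ.unitNormal_eq hd u hf).symm⟩
  have h2 : IsOuterUnitNormal (range fun u : Sph d => γ u)
    (gaussInverse (range fun u : Sph d => γ u) u) u := 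
    Classical.epsilon_spec
      (p := fun p => IsOuterUnitNormal (range fun u : Sph d => γ u) p u) ⟨_, h1⟩
  obtain ⟨⟨m, hm⟩, U', f', hf', hu⟩ := h2
  rw [← hm] at hf' hu ⊢
  have : u = m := Subtype.ext (hu.trans (hγ.unitNormal_eq hd m hf'))
  rw [this]

/-- The differentials of the Gauss map and of `γ` are mutually inverse. A principal direction `v =
dγ w` satisfies `w = κ • v`, whence `0 < ⟨dγ w, w⟩ = κ ‖v‖²`. -/
theorem curvature_pos (hγ : IsSupportField γ) (hd : 1 ≤ d) {p : Euc d} {κ : ℝ}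
    (h : IsPrincipalCurvature (range fun u : Sph d => γ u) p κ) : 0 < κ := by
  obtain ⟨⟨u, rfl⟩, U, f, hf, v, hv0, hv, hκ⟩ := h
  have hu : (u : Euc d) ≠ 0 := ne_zero_of_mem_unit_sphere u
  simp only at hf hv hκ
  have huv : inner ℝ (u : Euc d) v = 0 := by
    rw [← hγ.unitNormal_eq hd u hf, unitNormal, inner_smul_left, hv, mul_zero]
  set V : Submodule ℝ (Euc d) := (ℝ ∙ (u : Euc d))ᗮ with hV
  have hmemV : ∀ w, w ∈ V ↔ inner ℝ (u : Euc d) w = 0 := fun w =>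
    Submodule.mem_orthogonal_singleton_iff_inner_right
  let S : V →ₗ[ℝ] V := (fderiv ℝ γ u).toLinearMap.restrict fun w _ => (hmemV _).2 (hγ.perp _ hu w)
  have hScoe : ∀ w : V, (S w : Euc d) = fderiv ℝ γ u w := fun w => rfl
  have hinj : Function.Injective S := by
    rw [← LinearMap.ker_eq_bot, LinearMap.ker_eq_bot']
    intro w hw
    by_contra hw0
    have h1 := hγ.pos u w hu ((hmemV _).1 w.2) (by simpa using hw0)
    rw [← hScoe, hw] at h1
    simp at h1
  obtain ⟨⟨w, hw⟩, hSw⟩ := LinearMap.injective_iff_surjective.1 hinj ⟨v, (hmemV v).2 huv⟩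
  have hwv : fderiv ℝ γ u w = v := congrArg Subtype.val hSw
  have hw' := (hmemV w).1 hw
  have hw0 : w ≠ 0 := by rintro rfl; exact hv0 (by rw [← hwv, map_zero])
  have hl : HasDerivAt (fun t : ℝ => (u : Euc d) + t • w) w 0 := by
    simpa using ((hasDerivAt_id (0 : ℝ)).smul_const w).const_add (u : Euc d)
  have hl0 : (u : Euc d) + (0 : ℝ) • w = u := by simp
  have h1 : HasDerivAt (fun t : ℝ => γ ((u : Euc d) + t • w)) v 0 := by
    rw [← hwv]
    exact HasFDerivAt.comp_hasDerivAt (x := (0 : ℝ)) (l := γ) (hl0.symm ▸ hγ.hasFDerivAt hu) hl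
  have h2 : HasDerivAt (fun t : ℝ => unitNormal f (γ ((u : Euc d) + t • w))) (κ • v) 0 := by
    rw [← hκ]
    refine HasFDerivAt.comp_hasDerivAt (x := (0 : ℝ)) (l := unitNormal f) ?_ h1
    rw [hl0]
    exact (hf.differentiableAt_unitNormal hf.mem).hasFDerivAt
  have hne : ∀ᶠ t in 𝓝 (0 : ℝ), (u : Euc d) + t • w ≠ 0 :=
    hl.continuousAt.eventually_ne (by simpa using hu)
  have hU : ∀ᶠ t in 𝓝 (0 : ℝ), γ ((u : Euc d) + t • w) ∈ U :=
    h1.continuousAt.eventually (hf.isOpen.mem_nhds (by simpa using hf.mem))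
  have h3 : (fun t : ℝ => (sphereProj ((u : Euc d) + t • w) : Euc d)) =ᶠ[𝓝 0]
      fun t : ℝ => unitNormal f (γ ((u : Euc d) + t • w)) := by
    filter_upwards [hne, hU] with t ht htU
    have h4 : γ ((u : Euc d) + t • w) = γ (sphereProj ((u : Euc d) + t • w)) := by
      rw [coe_sphereProj ht, hγ.smul _ _ (by positivity)]
    rw [h4] at htU ⊢
    rw [hγ.unitNormal_eq hd _ (hf.of_mem htU)]
  have h5 : w = κ • v :=
    (hasDerivAt_coe_sphereProj u hw').unique (h2.congr_of_eventuallyEq h3)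
  have h6 := hγ.pos u w hu hw' hw0
  rw [hwv] at h6
  nth_rewrite 1 [h5] at h6
  rw [inner_smul_right] at h6
  exact pos_of_mul_pos_left h6 real_inner_self_nonneg

/-- A support field parametrizes an ovaloid by its outer normal. -/
theorem isSupportParametrization (hγ : IsSupportField γ) (hd : 1 ≤ d) :
    IsSupportParametrization (fun u : Sph d => γ u) (range fun u : Sph d => γ u) where
  isOvaloid :=
    { isCompact := isCompact_range hγ.continuous_comp_coe
      isConnected := by
        -- Connectedness of the sphere requires ambient dimension `d + 1 > 1`.
        have h1 : IsConnected (Metric.sphere (0 : Euc d) 1) := by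
          refine isConnected_sphere ?_ 0 zero_le_one
          rw [← Module.finrank_eq_rank, finrank_euclideanSpace_fin]
          exact_mod_cast Nat.lt_add_one_iff.2 hd
        have := Subtype.connectedSpace h1
        exact isConnected_range hγ.continuous_comp_coe
      hypersurface := by
        rintro _ ⟨u, rfl⟩
        exact hγ.exists_isOutwardDefiningFunction hd u
      curvature_pos := fun p κ h => hγ.curvature_pos hd h }
  range_eq := rfl
  normal := fun u => by
    obtain ⟨U, f, hf⟩ := hγ.exists_isOutwardDefiningFunction hd u
    exact ⟨⟨u, rfl⟩, U, f, hf, (hγ.unitNormal_eq hd u hf).symm⟩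

end IsSupportField

end ConvexTube

namespace ConvexTube

variable {d : ℕ} {γ : Euc d → Euc d}

/-! ### The support map of a smooth family of ovaloids -/

/-- For maps constant on rays, it suffices to check the conditions on the unit sphere. -/
theorem IsSupportField.of_unit (smooth : ContDiffOn ℝ ∞ γ {0}ᶜ)
    (smul : ∀ y, ∀ r : ℝ, 0 < r → γ (r • y) = γ y)
    (perp : ∀ y, ‖y‖ = 1 → ∀ w, inner ℝ y (fderiv ℝ γ y w) = 0)
    (pos : ∀ y w, ‖y‖ = 1 → inner ℝ y w = 0 → w ≠ 0 → 0 < inner ℝ (fderiv ℝ γ y w) w) :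
    IsSupportField γ := by
  -- The differential of a map constant on rays is homogeneous of degree `-1`.
  have key : ∀ y : Euc d, y ≠ 0 → ∀ w,
      fderiv ℝ γ y w = ‖y‖⁻¹ • fderiv ℝ γ (‖y‖⁻¹ • y) w := by
    intro y hy w
    have hr : (0 : ℝ) < ‖y‖⁻¹ := by positivity
    have h1 : HasFDerivAt γ (fderiv ℝ γ (‖y‖⁻¹ • y)) (‖y‖⁻¹ • y) :=
      ((smooth.contDiffAt (isOpen_compl_singleton.mem_nhds
        (smul_ne_zero hr.ne' hy))).differentiableAt (by simp)).hasFDerivAt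
    have h2 : HasFDerivAt (fun x => γ (‖y‖⁻¹ • x)) _ y :=
      HasFDerivAt.comp (g := γ) y h1 ((hasFDerivAt_id y).const_smul ‖y‖⁻¹)
    have h3 : (fun x => γ (‖y‖⁻¹ • x)) = γ := funext fun x => smul x _ hr
    rw [h3] at h2
    rw [h2.fderiv]
    simp
  have hunit : ∀ y : Euc d, y ≠ 0 → ‖‖y‖⁻¹ • y‖ = 1 := fun y hy => by
    rw [norm_smul, norm_inv, norm_norm, inv_mul_cancel₀ (norm_ne_zero_iff.2 hy)]
  refine ⟨smooth, smul, fun y hy w => ?_, fun y w hy hyw hw => ?_⟩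
  · have h1 := perp _ (hunit y hy) w
    rw [inner_smul_left] at h1
    rw [key y hy, inner_smul_right, (mul_eq_zero.1 h1).resolve_left (by simpa using hy), mul_zero]
  · have hr : (0 : ℝ) < ‖y‖⁻¹ := by positivity
    rw [key y hy, inner_smul_left]
    exact mul_pos hr (pos _ w (hunit y hy) (by rw [inner_smul_left, hyw, mul_zero]) hw)

/-- A smooth family of ovaloids, parametrized by the unit sphere through maps constant on rays. -/
structure IsOvaloidFamily (A : Euc d × ℝ → Euc d) : Prop where
  smooth : ContDiffOn ℝ ∞ A ({0}ᶜ ×ˢ I)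
  inj : ∀ z ∈ I, InjOn (fun y => A (y, z)) (Metric.sphere 0 1)
  smul : ∀ y z, ∀ r : ℝ, 0 < r → A (r • y, z) = A (y, z)
  imm : ∀ z ∈ I, ∀ y w, ‖y‖ = 1 → inner ℝ y w = 0 → w ≠ 0 →
    fderiv ℝ (fun y => A (y, z)) y w ≠ 0
  ovaloid : ∀ z ∈ I, IsOvaloid ((fun y => A (y, z)) '' Metric.sphere 0 1)

/-- The unit vector `y` maximizes the height of `A (·, z)` in the direction `q.1`, `z = q.2`. -/
def IsTop (A : Euc d × ℝ → Euc d) (q : Euc d × ℝ) (y : Euc d) : Prop :=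
  ‖y‖ = 1 ∧ ∀ x, ‖x‖ = 1 → inner ℝ q.1 (A (x, q.2)) ≤ inner ℝ q.1 (A (y, q.2))

/-- The parameter of the highest point in the direction `q.1` at the level `q.2`. -/
noncomputable def top (A : Euc d × ℝ → Euc d) (q : Euc d × ℝ) : Euc d :=
  Classical.epsilon (IsTop A q)

namespace IsOvaloidFamily

variable {A : Euc d × ℝ → Euc d}

theorem isOpen_dom : IsOpen (({0}ᶜ : Set (Euc d)) ×ˢ I) :=
  isOpen_compl_singleton.prod isOpen_Ioo

theorem contDiffAt (hA : IsOvaloidFamily A) {y : Euc d} {z : ℝ} (hy : y ≠ 0) (hz : z ∈ I) :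
    ContDiffAt ℝ ∞ A (y, z) :=
  hA.smooth.contDiffAt (isOpen_dom.mem_nhds ⟨hy, hz⟩)

theorem contDiffAt_left (hA : IsOvaloidFamily A) {y : Euc d} {z : ℝ} (hy : y ≠ 0) (hz : z ∈ I) :
    ContDiffAt ℝ ∞ (fun y => A (y, z)) y :=
  ContDiffAt.comp (g := A) y (hA.contDiffAt hy hz) (contDiffAt_id.prodMk contDiffAt_const)

theorem ne_zero_of_norm {y : Euc d} (hy : ‖y‖ = 1) : y ≠ 0 := by
  rintro rfl; simp at hy

theorem isTop_top (hA : IsOvaloidFamily A) {q : Euc d × ℝ} (hq : q.2 ∈ I) :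
    IsTop A q (top A q) := by
  apply Classical.epsilon_spec (p := IsTop A q)
  have hc : ContinuousOn (fun y : Euc d => (inner ℝ q.1 (A (y, q.2)) : ℝ)) (Metric.sphere 0 1) :=
    fun y hy => (continuousAt_const.inner (hA.contDiffAt_left
      (ne_zero_of_mem_unit_sphere ⟨y, hy⟩) hq).continuousAt).continuousWithinAt
  obtain ⟨y, hy, hmax⟩ := (isCompact_sphere (0 : Euc d) 1).exists_isMaxOn
    ⟨EuclideanSpace.single 0 1, by simp⟩ hc
  exact ⟨y, by simpa using hy, fun x hx => hmax (by simpa using hx)⟩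

theorem eq_of_isTop (hA : IsOvaloidFamily A) {q : Euc d × ℝ} (hq0 : q.1 ≠ 0) (hq : q.2 ∈ I)
    {x y : Euc d} (hx : IsTop A q x) (hy : IsTop A q y) : x = y := by
  have hx1 : x ∈ Metric.sphere (0 : Euc d) 1 := by simpa using hx.1
  have hy1 : y ∈ Metric.sphere (0 : Euc d) 1 := by simpa using hy.1
  refine hA.inj _ hq hx1 hy1 ((hA.ovaloid _ hq).eq_of_isMax hq0 ⟨x, hx1, rfl⟩ ⟨y, hy1, rfl⟩ ?_ ?_)
  · rintro _ ⟨p, hp, rfl⟩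
    exact hx.2 p (by simpa using hp)
  · rintro _ ⟨p, hp, rfl⟩
    exact hy.2 p (by simpa using hp)

theorem top_eq (hA : IsOvaloidFamily A) {q : Euc d × ℝ} (hq0 : q.1 ≠ 0) (hq : q.2 ∈ I)
    {y : Euc d} (hy : IsTop A q y) : top A q = y :=
  hA.eq_of_isTop hq0 hq (hA.isTop_top hq) hy

theorem top_smul (u : Euc d) (z r : ℝ) (hr : 0 < r) : top A (r • u, z) = top A (u, z) := by
  have : IsTop A (r • u, z) = IsTop A (u, z) := by
    funext y
    simp only [IsTop, inner_smul_left, conj_trivial, mul_le_mul_iff_right₀ hr]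
  rw [top, top, this]

/-- Outside a neighbourhood `W` of the unique maximizer the unit sphere is compact, and the height
there is strictly below the maximum. This strict inequality persists for nearby `q'`, which forces
their maximizers into `W`. -/
theorem continuousAt_top (hA : IsOvaloidFamily A) {q : Euc d × ℝ} (hq0 : q.1 ≠ 0)
    (hq : q.2 ∈ I) : ContinuousAt (top A) q := by
  have hT := hA.isTop_top hq
  rw [ContinuousAt, Filter.tendsto_def]
  intro V hV
  obtain ⟨W, hWV, hWo, hW⟩ := mem_nhds_iff.1 hV
  have hcpt : IsCompact (Metric.sphere (0 : Euc d) 1 \ W) := (isCompact_sphere _ _).diff hWo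
  have hcont : ∀ y : Euc d, ‖y‖ = 1 → ContinuousAt
      (fun a : (Euc d × ℝ) × Euc d => (inner ℝ a.1.1 (A (a.2, a.1.2)) : ℝ)) (q, y) := by
    intro y hy
    refine ContinuousAt.inner (by fun_prop) ?_
    exact ContinuousAt.comp (g := A) (f := fun a : (Euc d × ℝ) × Euc d => (a.2, a.1.2))
      (hA.contDiffAt (ne_zero_of_norm hy) hq).continuousAt (by fun_prop)
  have key := hcpt.eventually_forall_of_forall_eventually (x₀ := q)
    (P := fun q' x => inner ℝ q'.1 (A (x, q'.2)) < inner ℝ q'.1 (A (top A q, q'.2))) ?_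
  · have hI : ∀ᶠ q' : Euc d × ℝ in 𝓝 q, q'.2 ∈ I := continuousAt_snd (isOpen_Ioo.mem_nhds hq)
    filter_upwards [key, hI] with q' h hqI
    have hT' := hA.isTop_top hqI
    apply hWV
    by_contra hn
    have h1 := h (top A q') ⟨by simpa using hT'.1, hn⟩
    exact absurd (hT'.2 _ hT.1) (not_le.2 h1)
  · rintro x ⟨hx, hxW⟩
    have hx1 : ‖x‖ = 1 := by simpa using hx
    have hlt : inner ℝ q.1 (A (x, q.2)) < inner ℝ q.1 (A (top A q, q.2)) := by
      refine lt_of_le_of_ne (hT.2 x hx1) fun heq => hxW ?_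
      rw [← hA.top_eq hq0 hq (y := x) ⟨hx1, fun p hp => (hT.2 p hp).trans heq.ge⟩]
      exact hW
    have h2 : ContinuousAt (fun a : (Euc d × ℝ) × Euc d =>
        (inner ℝ a.1.1 (A (top A q, a.1.2)) : ℝ)) (q, x) :=
      ContinuousAt.comp (g := fun a : (Euc d × ℝ) × Euc d => (inner ℝ a.1.1 (A (a.2, a.1.2)) : ℝ))
        (f := fun a : (Euc d × ℝ) × Euc d => (a.1, top A q)) (hcont _ hT.1) (by fun_prop)
    exact (hcont x hx1).eventually_lt h2 hlt

/-- The critical point equation for the height functions, made nondegenerate in the radial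
direction. -/
noncomputable def criticalMap (A : Euc d × ℝ → Euc d) (a : (Euc d × ℝ) × Euc d) : Euc d :=
  (InnerProductSpace.toDual ℝ (Euc d)).symm
    ((innerSL ℝ a.1.1).comp ((fderiv ℝ A (a.2, a.1.2)).comp (.inl ℝ (Euc d) ℝ)))
    - (‖a.2‖ ^ 2 - 1) • a.2

theorem inner_criticalMap (hA : IsOvaloidFamily A) {u y : Euc d} {z : ℝ} (hy : y ≠ 0)
    (hz : z ∈ I) (w : Euc d) :
    inner ℝ (criticalMap A ((u, z), y)) w =
      inner ℝ u (fderiv ℝ (fun y => A (y, z)) y w) - (‖y‖ ^ 2 - 1) * inner ℝ y w := by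
  have h1 : HasFDerivAt (fun y => A (y, z)) _ y :=
    HasFDerivAt.comp (g := A) y ((hA.contDiffAt hy hz).differentiableAt (by simp)).hasFDerivAt
      ((hasFDerivAt_id y).prodMk (hasFDerivAt_const z y))
  rw [h1.fderiv, criticalMap, inner_sub_left, inner_smul_left,
    InnerProductSpace.toDual_symm_apply]
  simp

theorem contDiffAt_criticalMap (hA : IsOvaloidFamily A) {u y : Euc d} {z : ℝ} (hy : y ≠ 0)
    (hz : z ∈ I) : ContDiffAt ℝ ∞ (criticalMap A) ((u, z), y) := by
  have h1 : ContDiffAt ℝ ∞ (fun a : (Euc d × ℝ) × Euc d => fderiv ℝ A (a.2, a.1.2))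
      ((u, z), y) :=
    ContDiffAt.comp (g := fderiv ℝ A) ((u, z), y)
      ((hA.contDiffAt hy hz).fderiv_right (m := ∞) (by simp))
      (f := fun a : (Euc d × ℝ) × Euc d => (a.2, a.1.2)) (by fun_prop)
  have h2 : ContDiffAt ℝ ∞ (fun a : (Euc d × ℝ) × Euc d => innerSL ℝ a.1.1) ((u, z), y) :=
    ContDiffAt.comp (g := fun u : Euc d => innerSL ℝ u) ((u, z), y)
      (innerSL ℝ (E := Euc d)).contDiff.contDiffAt
      (f := fun a : (Euc d × ℝ) × Euc d => a.1.1) (by fun_prop)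
  have h3 := (InnerProductSpace.toDual ℝ (Euc d)).symm.contDiff.contDiffAt.comp ((u, z), y)
    (h2.clm_comp (h1.clm_comp (contDiffAt_const (c := ContinuousLinearMap.inl ℝ (Euc d) ℝ))))
  have h4 : ContDiffAt ℝ ∞ (fun a : (Euc d × ℝ) × Euc d => ‖a.2‖ ^ 2 - 1) ((u, z), y) :=
    (contDiffAt_snd.norm_sq ℝ).sub contDiffAt_const
  have h5 : ContDiffAt ℝ ∞ (fun a : (Euc d × ℝ) × Euc d => (‖a.2‖ ^ 2 - 1) • a.2) ((u, z), y) :=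
    h4.smul contDiffAt_snd
  exact ContDiffAt.sub h3 h5

/-- Constancy on rays turns the maximum over the sphere into a local maximum in space, and the added
radial term vanishes on unit vectors. -/
theorem criticalMap_top (hA : IsOvaloidFamily A) {q : Euc d × ℝ} (hq : q.2 ∈ I) :
    criticalMap A (q, top A q) = 0 := by
  obtain ⟨h1, hmax⟩ := hA.isTop_top hq
  have h0 : top A q ≠ 0 := ne_zero_of_norm h1
  have hloc : IsLocalMax (fun y => (inner ℝ q.1 (A (y, q.2)) : ℝ)) (top A q) := by
    filter_upwards [isOpen_compl_singleton.mem_nhds h0] with y hy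
    have hy' : (0 : ℝ) < ‖y‖⁻¹ := inv_pos.2 (norm_pos_iff.2 hy)
    rw [← hA.smul y q.2 _ hy']
    exact hmax _ (by rw [norm_smul, norm_inv, norm_norm, inv_mul_cancel₀ (norm_ne_zero_iff.2 hy)])
  have hder := (hasFDerivAt_const q.1 (top A q)).inner ℝ
    ((hA.contDiffAt_left h0 hq).differentiableAt (by simp)).hasFDerivAt
  have hz := hloc.hasFDerivAt_eq_zero hder
  refine ext_inner_right ℝ fun w => ?_
  have h2 := congrArg (fun L => L w) hz
  simp only [ContinuousLinearMap.comp_apply, ContinuousLinearMap.prod_apply,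
    fderivInnerCLM_apply, zero_apply, inner_zero_left, add_zero] at h2
  rw [show (q, top A q) = ((q.1, q.2), top A q) from rfl, hA.inner_criticalMap h0 hq, h2, h1,
    inner_zero_left]
  simp

-- Nondegeneracy of the maximum. Since `f` vanishes along `t ↦ A (y + t • w, z)`, two
-- differentiations express `⟨gradient f, D'⟩` through the second fundamental form, and `u` is a
-- positive multiple of the gradient. So `⟨u, D'⟩ < 0` unless `D 0 = 0`; in that case `w` is not
-- tangent to the sphere and the radial term `-2 ⟨y, w⟩²` is negative.
set_option maxHeartbeats 1000000 in
theorem inner_fderiv_criticalMap_neg (hA : IsOvaloidFamily A) {u : Euc d} {z : ℝ} (hu : u ≠ 0)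
    (hz : z ∈ I) {w : Euc d} (hw : w ≠ 0) :
    inner ℝ (fderiv ℝ (criticalMap A) ((u, z), top A (u, z)) (0, w)) w < 0 := by
  obtain ⟨hy1, hmax⟩ := hA.isTop_top (q := (u, z)) hz
  set y := top A (u, z) with hy
  have hy0 : y ≠ 0 := ne_zero_of_norm hy1
  have hO := hA.ovaloid z hz
  set O := (fun y => A (y, z)) '' Metric.sphere 0 1 with hOdef
  have hpO : A (y, z) ∈ O := ⟨y, by simpa using hy1, rfl⟩
  have hAO : ∀ x : Euc d, x ≠ 0 → A (x, z) ∈ O := fun x hx =>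
    ⟨‖x‖⁻¹ • x, by simp [norm_smul, hx], hA.smul x z _ (inv_pos.2 (norm_pos_iff.2 hx))⟩
  obtain ⟨U, f, hf⟩ := hO.hypersurface _ hpO
  have hupos : 0 < ‖u‖ := norm_pos_iff.2 hu
  have hN : unitNormal f (A (y, z)) = ‖u‖⁻¹ • u := by
    refine hf.unitNormal_eq hpO (by rw [norm_smul, norm_inv, norm_norm, inv_mul_cancel₀ hupos.ne']) ?_
    rintro _ ⟨x, hx, rfl⟩
    rw [inner_smul_left, inner_smul_left]
    exact mul_le_mul_of_nonneg_left (hmax x (by simpa using hx)) (by simp)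
  have hgpos : 0 < ‖gradient f (A (y, z))‖ := norm_pos_iff.2 (hf.regular _ hf.mem)
  have hgrad : u = (‖u‖ * ‖gradient f (A (y, z))‖⁻¹) • gradient f (A (y, z)) := by
    rw [mul_smul, ← unitNormal, hN, smul_smul, mul_inv_cancel₀ hupos.ne', one_smul]
  let D : ℝ → Euc d := fun t => fderiv ℝ (fun y => A (y, z)) (y + t • w) w
  have hl : ∀ t, HasDerivAt (fun t : ℝ => y + t • w) w t := fun t => by
    simpa using ((hasDerivAt_id t).smul_const w).const_add y
  have hl0 : y + (0 : ℝ) • w = y := by simp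
  have hne : ∀ᶠ t in 𝓝 (0 : ℝ), y + t • w ≠ 0 :=
    (hl 0).continuousAt.eventually_ne (by simpa using hy0)
  have hAd : ∀ t : ℝ, y + t • w ≠ 0 → HasDerivAt (fun t : ℝ => A (y + t • w, z)) (D t) t :=
    fun t ht => HasFDerivAt.comp_hasDerivAt (l := fun y => A (y, z)) t
      ((hA.contDiffAt_left ht hz).differentiableAt (by simp)).hasFDerivAt (hl t)
  obtain ⟨D', hD'⟩ : ∃ D', HasDerivAt D D' 0 := by
    have h1 : HasFDerivAt (fderiv ℝ (fun y => A (y, z))) _ (y + (0 : ℝ) • w) :=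
      (((hA.contDiffAt_left (by rwa [hl0]) hz).fderiv_right (m := ∞) (by simp)).differentiableAt
        (by simp)).hasFDerivAt
    exact ⟨_, (h1.comp_hasDerivAt 0 (hl 0)).clm_apply (hasDerivAt_const 0 w)⟩
  have hD0 : D 0 = fderiv ℝ (fun y => A (y, z)) y w := by simp [D]
  have hU : ∀ᶠ t in 𝓝 (0 : ℝ), A (y + t • w, z) ∈ U := by
    have := (hAd 0 (by rwa [hl0])).continuousAt
    exact this.eventually (hf.isOpen.mem_nhds (by simpa using hf.mem))
  have hzero : ∀ᶠ t in 𝓝 (0 : ℝ), f (A (y + t • w, z)) = 0 := by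
    filter_upwards [hU, hne] with t ht htn using (hf.mem_iff _ ht).1 (hAO _ htn)
  have hfirst : ∀ᶠ t in 𝓝 (0 : ℝ), inner ℝ (gradient f (A (y + t • w, z))) (D t) = 0 := by
    filter_upwards [hU, hne, hzero.eventually_nhds] with t ht htn h0
    have h1 : HasDerivAt (fun t : ℝ => f (A (y + t • w, z))) _ t :=
      (hf.differentiableAt ht).hasFDerivAt.comp_hasDerivAt t (hAd t htn)
    rw [inner_gradient_left]
    exact h1.unique ((hasDerivAt_const t (0 : ℝ)).congr_of_eventuallyEq h0)
  have htan : inner ℝ (gradient f (A (y, z))) (D 0) = 0 := by simpa using hfirst.self_of_nhds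
  have hsecond : inner ℝ (gradient f (A (y, z))) D' +
      inner ℝ (fderiv ℝ (gradient f) (A (y, z)) (D 0)) (D 0) = 0 := by
    have h1 : HasFDerivAt (gradient f) (fderiv ℝ (gradient f) (A (y, z)))
        (A (y + (0 : ℝ) • w, z)) := by
      rw [hl0]; exact (hf.differentiableAt_gradient hf.mem).hasFDerivAt
    have h2 := (h1.comp_hasDerivAt 0 (hAd 0 (by rwa [hl0]))).inner ℝ hD'
    have h3 := h2.unique ((hasDerivAt_const (0 : ℝ) (0 : ℝ)).congr_of_eventuallyEq hfirst)
    simpa using h3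
  have hcrit : HasDerivAt (fun t : ℝ => (inner ℝ (criticalMap A ((u, z), y + t • w)) w : ℝ))
      (inner ℝ u D' - 2 * inner ℝ y w * inner ℝ y w) 0 := by
    have h1 := (hasDerivAt_const (0 : ℝ) u).inner ℝ hD'
    have h2 := ((hl 0).norm_sq.sub_const 1).mul ((hl 0).inner ℝ (hasDerivAt_const (0 : ℝ) w))
    have h3 := h1.sub h2
    refine (h3.congr_deriv ?_).congr_of_eventuallyEq ?_
    · simp [hy1]
    · filter_upwards [hne] with t ht
      rw [hA.inner_criticalMap ht hz]
      simp [D]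
  have hcrit' : HasDerivAt (fun t : ℝ => (inner ℝ (criticalMap A ((u, z), y + t • w)) w : ℝ))
      (inner ℝ (fderiv ℝ (criticalMap A) ((u, z), y) (0, w)) w) 0 := by
    have h1 : HasFDerivAt (criticalMap A) (fderiv ℝ (criticalMap A) ((u, z), y))
        ((u, z), y + (0 : ℝ) • w) := by
      rw [hl0]
      exact ((hA.contDiffAt_criticalMap hy0 hz).differentiableAt (by simp)).hasFDerivAt
    have h2 : HasDerivAt (fun t : ℝ => ((u, z), y + t • w)) ((0 : Euc d × ℝ), w) 0 :=
      (hasDerivAt_const (0 : ℝ) (u, z)).prodMk (hl 0)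
    have h3 := (h1.comp_hasDerivAt (0 : ℝ) h2).inner ℝ (hasDerivAt_const (0 : ℝ) w)
    exact h3.congr_deriv (by simp)
  rw [hcrit'.unique hcrit]
  have hu' : inner ℝ u D' = -(‖u‖ * ‖gradient f (A (y, z))‖⁻¹) *
      inner ℝ (fderiv ℝ (gradient f) (A (y, z)) (D 0)) (D 0) := by
    conv_lhs => rw [hgrad]
    rw [inner_smul_left, eq_neg_of_add_eq_zero_left hsecond]
    simp
  have hcpos : 0 < ‖u‖ * ‖gradient f (A (y, z))‖⁻¹ := by positivity
  by_cases hD00 : D 0 = 0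
  · have hyw : inner ℝ y w ≠ 0 := by
      intro h
      exact hA.imm z hz y w hy1 h hw (hD0 ▸ hD00)
    rw [hu', hD00]
    simp only [map_zero, inner_zero_left, mul_zero]
    nlinarith [mul_self_pos.2 hyw]
  · have h1 := hf.inner_fderiv_gradient_pos hpO (fun κ => hO.curvature_pos _ κ) hD00 htan
    rw [hu']
    nlinarith [mul_pos hcpos h1, mul_self_nonneg (inner ℝ y w)]

/-- The implicit function theorem solves `criticalMap = 0` uniquely near the maximizer, and
continuity of `top` keeps the maximizers on that branch. -/
theorem contDiffAt_top (hA : IsOvaloidFamily A) {q : Euc d × ℝ} (hq0 : q.1 ≠ 0) (hq : q.2 ∈ I) :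
    ContDiffAt ℝ ∞ (top A) q := by
  have hy0 : top A q ≠ 0 := ne_zero_of_norm (hA.isTop_top hq).1
  have hcd : ContDiffAt ℝ ∞ (criticalMap A) (q, top A q) := hA.contDiffAt_criticalMap hy0 hq
  have hinj : Function.Injective
      (fderiv ℝ (criticalMap A) (q, top A q) ∘L .inr ℝ (Euc d × ℝ) (Euc d)).toLinearMap := by
    rw [← LinearMap.ker_eq_bot, LinearMap.ker_eq_bot']
    intro w hw
    by_contra hw0
    have h1 := hA.inner_fderiv_criticalMap_neg hq0 hq hw0
    have h2 : fderiv ℝ (criticalMap A) ((q.1, q.2), top A (q.1, q.2)) (0, w) = 0 := hw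
    rw [h2, inner_zero_left] at h1
    exact lt_irrefl _ h1
  have hinv : (fderiv ℝ (criticalMap A) (q, top A q) ∘L
      .inr ℝ (Euc d × ℝ) (Euc d)).IsInvertible :=
    ⟨(LinearEquiv.ofInjectiveEndo _ hinj).toContinuousLinearEquiv, by ext1; rfl⟩
  refine (hcd.contDiffAt_implicitFunction (by simp) hinv).congr_of_eventuallyEq ?_
  have h1 : Filter.Tendsto (fun q' => (q', top A q')) (𝓝 q) (𝓝 (q, top A q)) :=
    continuousAt_id.prodMk (hA.continuousAt_top hq0 hq)
  have hI : ∀ᶠ q' : Euc d × ℝ in 𝓝 q, q'.2 ∈ I := continuousAt_snd (isOpen_Ioo.mem_nhds hq)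
  filter_upwards [h1.eventually (hcd.eventually_apply_eq_iff_implicitFunction (by simp) hinv), hI]
    with q' h hq'
  exact (h.1 (by rw [hA.criticalMap_top hq', hA.criticalMap_top hq])).symm

/-- The highest point in the direction `q.1` at the level `q.2`. -/
noncomputable def support (A : Euc d × ℝ → Euc d) (q : Euc d × ℝ) : Euc d := A (top A q, q.2)

theorem contDiffAt_support (hA : IsOvaloidFamily A) {q : Euc d × ℝ} (hq0 : q.1 ≠ 0)
    (hq : q.2 ∈ I) : ContDiffAt ℝ ∞ (support A) q :=
  ContDiffAt.comp (g := A) q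
    (hA.contDiffAt (ne_zero_of_norm (hA.isTop_top hq).1) hq)
    ((hA.contDiffAt_top hq0 hq).prodMk contDiffAt_snd)

/-- The Gauss map sends the support point in the direction `u` back to `u / ‖u‖`. Differentiating,
`w = dN D` with `D` the differential applied to `w`, so `⟨D, w⟩` is the second fundamental form at
`D`. -/
theorem isSupportField (hA : IsOvaloidFamily A) {z : ℝ} (hz : z ∈ I) (b : Euc d) :
    IsSupportField fun u => b + support A (u, z) := by
  have hsm : ∀ u : Euc d, u ≠ 0 → ContDiffAt ℝ ∞ (fun u => b + support A (u, z)) u := fun u hu =>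
    contDiffAt_const.add (ContDiffAt.comp (g := support A) u (hA.contDiffAt_support hu hz)
      (contDiffAt_id.prodMk contDiffAt_const))
  have hder : ∀ u : Euc d, u ≠ 0 → HasFDerivAt (fun u => b + support A (u, z))
      (fderiv ℝ (fun u => b + support A (u, z)) u) u := fun u hu =>
    ((hsm u hu).differentiableAt (by simp)).hasFDerivAt
  have hmax : ∀ u x : Euc d, inner ℝ u (support A (x, z)) ≤ inner ℝ u (support A (u, z)) :=
    fun u x => (hA.isTop_top (q := (u, z)) hz).2 _ (hA.isTop_top (q := (x, z)) hz).1
  have hsmul : ∀ y, ∀ r : ℝ, 0 < r → b + support A (r • y, z) = b + support A (y, z) := by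
    intro y r hr
    simp only [support, top_smul y z r hr]
  have hperp : ∀ y : Euc d, ‖y‖ = 1 → ∀ w,
      inner ℝ y (fderiv ℝ (fun u => b + support A (u, z)) y w) = 0 := by
    intro y hy w
    have hloc : IsLocalMax (fun x => (inner ℝ y (b + support A (x, z)) : ℝ)) y :=
      Filter.Eventually.of_forall fun x => by
        simp only [inner_add_right]
        linarith [hmax y x]
    have h0 := hloc.hasFDerivAt_eq_zero
      ((hasFDerivAt_const y y).inner ℝ (hder y (ne_zero_of_norm hy)))
    have h1 := congrArg (fun L => L w) h0
    simpa only [ContinuousLinearMap.comp_apply, ContinuousLinearMap.prod_apply,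
      fderivInnerCLM_apply, zero_apply, inner_zero_left, add_zero] using h1
  refine .of_unit (fun y hy => (hsm y hy).contDiffWithinAt) hsmul hperp
    fun y w hy hyw hw => ?_
  have hy0 := ne_zero_of_norm hy
  have hO := hA.ovaloid z hz
  set O := (fun y => A (y, z)) '' Metric.sphere 0 1 with hOdef
  have hSO : ∀ u, support A (u, z) ∈ O := fun u =>
    ⟨_, by simpa using (hA.isTop_top (q := (u, z)) hz).1, rfl⟩
  obtain ⟨U, f, hf⟩ := hO.hypersurface _ (hSO y)
  have hN : ∀ u : Euc d, u ≠ 0 → support A (u, z) ∈ U →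
      unitNormal f (support A (u, z)) = sphereProj u := by
    intro u hu huU
    refine (hf.of_mem huU).unitNormal_eq (hSO u) (by simp) ?_
    rintro _ ⟨x, hx, rfl⟩
    rw [coe_sphereProj hu, inner_smul_left, inner_smul_left]
    exact mul_le_mul_of_nonneg_left ((hA.isTop_top (q := (u, z)) hz).2 x (by simpa using hx))
      (by simp)
  set D := fderiv ℝ (fun u => b + support A (u, z)) y w with hD
  have hl : HasDerivAt (fun t : ℝ => y + t • w) w 0 := by
    simpa using ((hasDerivAt_id (0 : ℝ)).smul_const w).const_add y
  have hl0 : y + (0 : ℝ) • w = y := by simp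
  have h1 : HasDerivAt (fun t : ℝ => support A (y + t • w, z)) D 0 := by
    have h2 : HasFDerivAt (fun u => support A (u, z))
        (fderiv ℝ (fun u => b + support A (u, z)) y) (y + (0 : ℝ) • w) := by
      rw [hl0]
      simpa using (hder y hy0).const_add (-b)
    exact HasFDerivAt.comp_hasDerivAt (l := fun u => support A (u, z)) 0 h2 hl
  have h2 : HasDerivAt (fun t : ℝ => unitNormal f (support A (y + t • w, z)))
      (fderiv ℝ (unitNormal f) (support A (y, z)) D) 0 := by
    refine HasFDerivAt.comp_hasDerivAt (x := (0 : ℝ)) (l := unitNormal f) ?_ h1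
    rw [hl0]
    exact (hf.differentiableAt_unitNormal hf.mem).hasFDerivAt
  have hne : ∀ᶠ t in 𝓝 (0 : ℝ), y + t • w ≠ 0 :=
    hl.continuousAt.eventually_ne (by simpa using hy0)
  have hU : ∀ᶠ t in 𝓝 (0 : ℝ), support A (y + t • w, z) ∈ U :=
    h1.continuousAt.eventually (hf.isOpen.mem_nhds (by simpa using hf.mem))
  have h3 : (fun t : ℝ => (sphereProj (y + t • w) : Euc d)) =ᶠ[𝓝 0]
      fun t : ℝ => unitNormal f (support A (y + t • w, z)) := by
    filter_upwards [hne, hU] with t ht htU using (hN _ ht htU).symm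
  have h5 : w = fderiv ℝ (unitNormal f) (support A (y, z)) D :=
    (hasDerivAt_coe_sphereProj ⟨y, by simpa using hy⟩ hyw).unique (h2.congr_of_eventuallyEq h3)
  have hD0 : D ≠ 0 := fun h => hw (by rw [h5, h, map_zero])
  have hgD : inner ℝ (gradient f (support A (y, z))) D = 0 := by
    have h6 := hN y hy0 hf.mem
    have h7 : (sphereProj y : Euc d) = y := by rw [coe_sphereProj hy0, hy]; simp
    rw [h7] at h6
    have h8 : inner ℝ (unitNormal f (support A (y, z))) D = 0 := by
      rw [h6]; exact hperp y hy w
    rw [unitNormal, inner_smul_left] at h8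
    exact (mul_eq_zero.1 h8).resolve_left (by simpa using hf.regular _ hf.mem)
  have h6 := hf.inner_fderiv_gradient_pos (hSO y) (fun κ => hO.curvature_pos _ κ) hD0 hgD
  have h7 := hf.inner_fderiv_unitNormal hf.mem D hgD
  rw [← h5] at h7
  rw [real_inner_comm, h7]
  have := norm_pos_iff.2 (hf.regular _ hf.mem)
  positivity

/-- Every point of the ovaloid maximizes the height in the direction of its own normal, because its
tangent hyperplane is a supporting one. -/
theorem range_support (hA : IsOvaloidFamily A) {z : ℝ} (hz : z ∈ I) :
    range (fun u : Sph d => support A (u, z)) = (fun y => A (y, z)) '' Metric.sphere 0 1 := by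
  apply Subset.antisymm
  · rintro _ ⟨u, rfl⟩
    exact ⟨_, by simpa using (hA.isTop_top (q := ((u : Euc d), z)) hz).1, rfl⟩
  · rintro _ ⟨y, hy, rfl⟩
    have hO := hA.ovaloid z hz
    have hpO : A (y, z) ∈ (fun y => A (y, z)) '' Metric.sphere 0 1 := ⟨y, hy, rfl⟩
    obtain ⟨U, f, hf⟩ := hO.hypersurface _ hpO
    have hn : ‖unitNormal f (A (y, z))‖ = 1 := hf.norm_unitNormal hf.mem
    refine ⟨⟨unitNormal f (A (y, z)), mem_sphere_zero_iff_norm.2 hn⟩, ?_⟩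
    have : top A (unitNormal f (A (y, z)), z) = y := by
      refine hA.top_eq (q := (unitNormal f (A (y, z)), z)) (ne_zero_of_norm hn) hz
        ⟨mem_sphere_zero_iff_norm.1 hy, fun x hx => ?_⟩
      exact hO.inner_unitNormal_le hpO hf ⟨x, mem_sphere_zero_iff_norm.2 hx, rfl⟩
    exact congrArg (fun x => A (x, z)) this

end IsOvaloidFamily

end ConvexTube

namespace ConvexTube

/-! ### Small solutions of scalar equations with parameters -/

/-- For small `ε` the function `s - ε g` is strictly increasing and changes sign on `[-r, r]`. The
bounds are uniform in `w`, so one `δ` serves all parameters. -/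
theorem exists_contDiffOn_fixedPoint {E : Type*} [NormedAddCommGroup E] [NormedSpace ℝ E]
    [CompleteSpace E] {W : Set E} (hW : IsOpen W) {g : (ℝ × E) × ℝ → ℝ} {ε₀ r r₀ B : ℝ}
    (hε₀ : 0 < ε₀) (hr : 0 < r) (hr₀ : r < r₀)
    (hg : ContDiffOn ℝ ∞ g ((Ioo (-ε₀) ε₀ ×ˢ W) ×ˢ Ioo (-r₀) r₀))
    (hB : ∀ ε ∈ Ioo (-ε₀) ε₀, ∀ w ∈ W, ∀ s ∈ Icc (-r) r, |g ((ε, w), s)| ≤ B)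
    (hB' : ∀ ε ∈ Ioo (-ε₀) ε₀, ∀ w ∈ W, ∀ s ∈ Icc (-r) r, |fderiv ℝ g ((ε, w), s) (0, 1)| ≤ B) :
    ∃ δ, 0 < δ ∧ δ ≤ ε₀ ∧ ∃ σ : ℝ × E → ℝ, ContDiffOn ℝ ∞ σ (Ioo (-δ) δ ×ˢ W) ∧
      ∀ ε ∈ Ioo (-δ) δ, ∀ w ∈ W, σ (ε, w) ∈ Ioo (-r) r ∧
        σ (ε, w) = ε * g ((ε, w), σ (ε, w)) ∧
        ∀ s ∈ Icc (-r) r, s = ε * g ((ε, w), s) → s = σ (ε, w) := by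
  have hB1 : 0 < |B| + 1 := by positivity
  -- This ensures `|ε g| ≤ r / 2`, which gives the sign change strictly inside, and `|ε ∂g/∂s| ≤ 1 /
  -- 2`, which gives monotonicity.
  set δ : ℝ := min ε₀ (min (1 / 2) (r / 2) / (|B| + 1)) with hδ
  have hδ0 : 0 < δ := by positivity
  have hδε : δ ≤ ε₀ := min_le_left _ _
  have hsub : ∀ ε ∈ Ioo (-δ) δ, ε ∈ Ioo (-ε₀) ε₀ := fun ε hε =>
    ⟨by linarith [hε.1], by linarith [hε.2]⟩
  have hsmall : ∀ ε ∈ Ioo (-δ) δ, ∀ b : ℝ, |b| ≤ B → |ε * b| ≤ 1 / 2 ∧ |ε * b| ≤ r / 2 := by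
    intro ε hε b hb
    have h1 : |ε| ≤ min (1 / 2) (r / 2) / (|B| + 1) :=
      (abs_lt.2 hε).le.trans (min_le_right _ _)
    have h2 : |ε * b| ≤ min (1 / 2) (r / 2) := by
      rw [abs_mul]
      calc |ε| * |b| ≤ min (1 / 2) (r / 2) / (|B| + 1) * (|B| + 1) := by
            gcongr
            linarith [le_abs_self B]
        _ = _ := div_mul_cancel₀ _ hB1.ne'
    exact ⟨h2.trans (min_le_left _ _), h2.trans (min_le_right _ _)⟩
  have hopen : IsOpen ((Ioo (-ε₀) ε₀ ×ˢ W) ×ˢ Ioo (-r₀) r₀) :=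
    (isOpen_Ioo.prod hW).prod isOpen_Ioo
  have hrr : ∀ s ∈ Icc (-r) r, s ∈ Ioo (-r₀) r₀ := fun s hs =>
    ⟨by linarith [hs.1], by linarith [hs.2]⟩
  have hgat : ∀ ε ∈ Ioo (-ε₀) ε₀, ∀ w ∈ W, ∀ s ∈ Icc (-r) r, ContDiffAt ℝ ∞ g ((ε, w), s) :=
    fun ε hε w hw s hs => hg.contDiffAt (hopen.mem_nhds ⟨⟨hε, hw⟩, hrr s hs⟩)
  have hder : ∀ ε ∈ Ioo (-ε₀) ε₀, ∀ w ∈ W, ∀ s ∈ Icc (-r) r,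
      HasDerivAt (fun s => s - ε * g ((ε, w), s)) (1 - ε * fderiv ℝ g ((ε, w), s) (0, 1)) s := by
    intro ε hε w hw s hs
    have h1 : HasDerivAt (fun s : ℝ => ((ε, w), s)) ((0 : ℝ × E), (1 : ℝ)) s :=
      (hasDerivAt_const s (ε, w)).prodMk (hasDerivAt_id s)
    have h2 : HasDerivAt (fun s : ℝ => g ((ε, w), s)) (fderiv ℝ g ((ε, w), s) (0, 1)) s :=
      HasFDerivAt.comp_hasDerivAt (l := g) s
        ((hgat ε hε w hw s hs).differentiableAt (by simp)).hasFDerivAt h1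
    exact (hasDerivAt_id s).sub (h2.const_mul ε)
  have hmono : ∀ ε ∈ Ioo (-δ) δ, ∀ w ∈ W,
      StrictMonoOn (fun s => s - ε * g ((ε, w), s)) (Icc (-r) r) := by
    intro ε hε w hw
    refine strictMonoOn_of_deriv_pos (convex_Icc _ _) (fun s hs =>
      (hder ε (hsub ε hε) w hw s hs).continuousAt.continuousWithinAt) fun s hs => ?_
    have hs' : s ∈ Icc (-r) r := interior_subset hs
    rw [(hder ε (hsub ε hε) w hw s hs').deriv]
    have := (abs_le.1 (hsmall ε hε _ (hB' ε (hsub ε hε) w hw s hs')).1).2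
    linarith
  have hex : ∀ ε ∈ Ioo (-δ) δ, ∀ w ∈ W, ∃ s ∈ Ioo (-r) r, s = ε * g ((ε, w), s) := by
    intro ε hε w hw
    have hc : ContinuousOn (fun s => s - ε * g ((ε, w), s)) (Icc (-r) r) := fun s hs =>
      (hder ε (hsub ε hε) w hw s hs).continuousAt.continuousWithinAt
    have h1 := (abs_le.1 (hsmall ε hε _ (hB ε (hsub ε hε) w hw r ⟨by linarith, le_rfl⟩)).2).2
    have h2 := (abs_le.1 (hsmall ε hε _ (hB ε (hsub ε hε) w hw (-r) ⟨le_rfl, by linarith⟩)).2).1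
    obtain ⟨s, hs, hs0⟩ := intermediate_value_Ioo (by linarith) hc
      (show (0 : ℝ) ∈ Ioo _ _ from ⟨by linarith, by linarith⟩)
    exact ⟨s, hs, by simp only at hs0; linarith⟩
  choose! σ' hσ' using hex
  refine ⟨δ, hδ0, hδε, fun q => σ' q.1 q.2, ?_, fun ε hε w hw =>
    ⟨(hσ' ε hε w hw).1, (hσ' ε hε w hw).2, fun s hs hs' => ?_⟩⟩
  · rintro ⟨ε, w⟩ ⟨hε, hw⟩
    obtain ⟨hs, hseq⟩ := hσ' ε hε w hw
    set s := σ' ε w with hsdef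
    have hs' := Ioo_subset_Icc_self hs
    let F : (ℝ × E) × ℝ → ℝ := fun a => a.2 - a.1.1 * g a
    have hF : ContDiffAt ℝ ∞ F ((ε, w), s) :=
      contDiffAt_snd.sub ((contDiffAt_fst.comp _ contDiffAt_fst).mul
        (hgat ε (hsub ε hε) w hw s hs'))
    have hF0 : F ((ε, w), s) = 0 := by simp only [F]; linarith
    have hFd : fderiv ℝ F ((ε, w), s) (0, 1) = 1 - ε * fderiv ℝ g ((ε, w), s) (0, 1) := by
      have h1 : HasDerivAt (fun s : ℝ => ((ε, w), s)) ((0 : ℝ × E), (1 : ℝ)) s :=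
        (hasDerivAt_const s (ε, w)).prodMk (hasDerivAt_id s)
      have h2 : HasDerivAt (fun s : ℝ => F ((ε, w), s)) (fderiv ℝ F ((ε, w), s) (0, 1)) s :=
        HasFDerivAt.comp_hasDerivAt (l := F) s (hF.differentiableAt (by simp)).hasFDerivAt h1
      exact h2.unique (hder ε (hsub ε hε) w hw s hs')
    have hinj : Function.Injective
        (fderiv ℝ F ((ε, w), s) ∘L .inr ℝ (ℝ × E) ℝ).toLinearMap := by
      rw [← LinearMap.ker_eq_bot, LinearMap.ker_eq_bot']
      intro t ht
      have h1 : fderiv ℝ F ((ε, w), s) (0, t) = 0 := ht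
      have h2 : ((0 : ℝ × E), t) = t • ((0 : ℝ × E), (1 : ℝ)) := by simp
      rw [h2, map_smul, hFd, smul_eq_mul] at h1
      have := (abs_le.1 (hsmall ε hε _ (hB' ε (hsub ε hε) w hw s hs')).1).2
      exact (mul_eq_zero.1 h1).resolve_right (by linarith)
    have hinv : (fderiv ℝ F ((ε, w), s) ∘L .inr ℝ (ℝ × E) ℝ).IsInvertible :=
      ⟨(LinearEquiv.ofInjectiveEndo _ hinj).toContinuousLinearEquiv, by ext1; rfl⟩
    have hψ := hF.contDiffAt_implicitFunction (by simp) hinv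
    have hψ0 : hF.implicitFunction (by simp) hinv (ε, w) = s :=
      hF.implicitFunction_apply_self (by simp) hinv
    refine (hψ.congr_of_eventuallyEq ?_).contDiffWithinAt
    have h1 : ∀ᶠ q in 𝓝 (ε, w), hF.implicitFunction (by simp) hinv q ∈ Ioo (-r) r :=
      hψ.continuousAt.eventually (isOpen_Ioo.mem_nhds (by rw [hψ0]; exact hs))
    filter_upwards [h1, hF.eventually_apply_implicitFunction (by simp) hinv,
      (isOpen_Ioo.prod hW).mem_nhds (show (ε, w) ∈ Ioo (-δ) δ ×ˢ W from ⟨hε, hw⟩)] with q hq1 hq2 hq3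
    obtain ⟨hs1, hs2⟩ := hσ' q.1 hq3.1 q.2 hq3.2
    -- The local implicit function and the chosen root are zeros of the same strictly monotone
    -- function, so they agree.
    refine (hmono q.1 hq3.1 q.2 hq3.2).injOn (Ioo_subset_Icc_self hs1)
      (Ioo_subset_Icc_self hq1) ?_
    rw [hF0] at hq2
    simp only [F] at hq2
    linarith
  · obtain ⟨hs1, hs2⟩ := hσ' ε hε w hw
    refine (hmono ε hε w hw).injOn hs (Ioo_subset_Icc_self hs1) ?_
    simp only
    linarith

/-- For functions constant on rays, the required bounds follow from compactness. -/
theorem exists_contDiffOn_fixedPoint_of_smul {d : ℕ} {g : (ℝ × Euc d) × ℝ → ℝ} {ε₀ r r₀ : ℝ}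
    (hε₀ : 0 < ε₀) (hr : 0 < r) (hr₀ : r < r₀)
    (hg : ContDiffOn ℝ ∞ g ((Ioo (-ε₀) ε₀ ×ˢ {0}ᶜ) ×ˢ Ioo (-r₀) r₀))
    (hsmul : ∀ ε ∈ Ioo (-ε₀) ε₀, ∀ w ≠ 0, ∀ s, ∀ t : ℝ, 0 < t →
      g ((ε, t • w), s) = g ((ε, w), s)) :
    ∃ δ, 0 < δ ∧ δ ≤ ε₀ ∧ ∃ σ : ℝ × Euc d → ℝ, ContDiffOn ℝ ∞ σ (Ioo (-δ) δ ×ˢ {0}ᶜ) ∧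
      (∀ ε ∈ Ioo (-δ) δ, ∀ w ≠ 0, ∀ t : ℝ, 0 < t → σ (ε, t • w) = σ (ε, w)) ∧
      ∀ ε ∈ Ioo (-δ) δ, ∀ w ≠ 0, σ (ε, w) ∈ Ioo (-r) r ∧
        σ (ε, w) = ε * g ((ε, w), σ (ε, w)) ∧
        ∀ s ∈ Icc (-r) r, s = ε * g ((ε, w), s) → s = σ (ε, w) := by
  have hopen : IsOpen ((Ioo (-ε₀) ε₀ ×ˢ ({0}ᶜ : Set (Euc d))) ×ˢ Ioo (-r₀) r₀) :=
    (isOpen_Ioo.prod isOpen_compl_singleton).prod isOpen_Ioo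
  have hgat : ∀ ε ∈ Ioo (-ε₀) ε₀, ∀ w : Euc d, w ≠ 0 → ∀ s ∈ Icc (-r) r,
      ContDiffAt ℝ ∞ g ((ε, w), s) := fun ε hε w hw s hs =>
    hg.contDiffAt (hopen.mem_nhds ⟨⟨hε, hw⟩, by linarith [hs.1], by linarith [hs.2]⟩)
  -- Unit vectors represent all rays; halving the range of `ε` makes the parameter set compact.
  set K : Set ((ℝ × Euc d) × ℝ) :=
    (Icc (-(ε₀ / 2)) (ε₀ / 2) ×ˢ Metric.sphere 0 1) ×ˢ Icc (-r) r with hK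
  have hKc : IsCompact K := (isCompact_Icc.prod (isCompact_sphere _ _)).prod isCompact_Icc
  have hKat : ∀ a ∈ K, ContDiffAt ℝ ∞ g a := by
    rintro ⟨⟨ε, w⟩, s⟩ ⟨⟨hε, hw⟩, hs⟩
    exact hgat ε ⟨by linarith [hε.1], by linarith [hε.2]⟩ w
      (ne_zero_of_mem_unit_sphere ⟨w, hw⟩) s hs
  obtain ⟨B₁, hB₁⟩ := hKc.exists_bound_of_continuousOn (f := g)
    fun a ha => (hKat a ha).continuousAt.continuousWithinAt
  obtain ⟨B₂, hB₂⟩ := hKc.exists_bound_of_continuousOn (f := fun a => fderiv ℝ g a (0, 1))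
    fun a ha => ((((hKat a ha).fderiv_right (m := ∞) (by simp)).continuousAt).clm_apply
      continuousAt_const).continuousWithinAt
  have hsub : ∀ ε ∈ Ioo (-(ε₀ / 2)) (ε₀ / 2), ε ∈ Ioo (-ε₀) ε₀ := fun ε hε =>
    ⟨by linarith [hε.1], by linarith [hε.2]⟩
  have hmemK : ∀ ε ∈ Ioo (-(ε₀ / 2)) (ε₀ / 2), ∀ w ∈ ({0}ᶜ : Set (Euc d)), ∀ s ∈ Icc (-r) r,
      ((ε, ‖w‖⁻¹ • w), s) ∈ K := by
    intro ε hε w hw s hs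
    have hw' : w ≠ 0 := hw
    exact ⟨⟨Ioo_subset_Icc_self hε, by simp [norm_smul, hw']⟩, hs⟩
  have hline : ∀ ε ∈ Ioo (-ε₀) ε₀, ∀ w : Euc d, w ≠ 0 → ∀ s ∈ Icc (-r) r,
      HasDerivAt (fun s => g ((ε, w), s)) (fderiv ℝ g ((ε, w), s) (0, 1)) s := by
    intro ε hε w hw s hs
    have h1 : HasDerivAt (fun s : ℝ => ((ε, w), s)) ((0 : ℝ × Euc d), (1 : ℝ)) s :=
      (hasDerivAt_const s (ε, w)).prodMk (hasDerivAt_id s)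
    exact HasFDerivAt.comp_hasDerivAt (l := g) s
      ((hgat ε hε w hw s hs).differentiableAt (by simp)).hasFDerivAt h1
  have hb₁ : ∀ ε ∈ Ioo (-(ε₀ / 2)) (ε₀ / 2), ∀ w ∈ ({0}ᶜ : Set (Euc d)), ∀ s ∈ Icc (-r) r,
      |g ((ε, w), s)| ≤ max B₁ B₂ := by
    intro ε hε w hw s hs
    have hw' : (0 : ℝ) < ‖w‖⁻¹ := inv_pos.2 (norm_pos_iff.2 hw)
    rw [← hsmul ε (hsub ε hε) w hw s _ hw']
    exact (hB₁ _ (hmemK ε hε w hw s hs)).trans (le_max_left _ _)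
  have hb₂ : ∀ ε ∈ Ioo (-(ε₀ / 2)) (ε₀ / 2), ∀ w ∈ ({0}ᶜ : Set (Euc d)), ∀ s ∈ Icc (-r) r,
      |fderiv ℝ g ((ε, w), s) (0, 1)| ≤ max B₁ B₂ := by
    intro ε hε w hw s hs
    have hw' : (0 : ℝ) < ‖w‖⁻¹ := inv_pos.2 (norm_pos_iff.2 hw)
    have h1 := hline ε (hsub ε hε) _ (smul_ne_zero hw'.ne' hw) s hs
    simp only [hsmul ε (hsub ε hε) w hw _ _ hw'] at h1
    rw [(hline ε (hsub ε hε) w hw s hs).unique h1]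
    exact (hB₂ _ (hmemK ε hε w hw s hs)).trans (le_max_right _ _)
  obtain ⟨δ, hδ0, hδ, σ, hσ, h⟩ := exists_contDiffOn_fixedPoint isOpen_compl_singleton
    (half_pos hε₀) hr hr₀ (hg.mono (prod_mono_left (prod_mono_left hsub))) hb₁ hb₂
  refine ⟨δ, hδ0, by linarith, σ, hσ, fun ε hε w hw t ht => ?_, h⟩
  have hε' := hsub ε ⟨by linarith [hε.1], by linarith [hε.2]⟩
  obtain ⟨h1, h2, -⟩ := h ε hε (t • w) (smul_ne_zero ht.ne' hw)
  refine (h ε hε w hw).2.2 _ (Ioo_subset_Icc_self h1) ?_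
  rw [hsmul ε hε' w hw _ t ht] at h2
  exact h2

end ConvexTube

namespace ConvexTube

variable {d : ℕ}

/-! ### Tilted sections -/

/-- A bounded smooth family of support fields. -/
structure IsSupportFamily (Γ : Euc d × ℝ → Euc d) : Prop where
  smooth : ContDiffOn ℝ ∞ Γ ({0}ᶜ ×ˢ I)
  smul : ∀ u z, ∀ t : ℝ, 0 < t → Γ (t • u, z) = Γ (u, z)
  field : ∀ z ∈ I, IsSupportField fun u => Γ (u, z)
  bounded : ∃ R, ∀ u, u ≠ 0 → ∀ z ∈ I, ‖Γ (u, z)‖ ≤ R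

/-- `ζ (ε, u)` is the height at which the section tilted by `ε` has the horizontal normal `u`. -/
structure IsRadialHeight (Γ : Euc d × ℝ → Euc d) (τ : Euc d) (z₀ δ : ℝ) (ζ : ℝ × Euc d → ℝ) :
    Prop where
  smooth : ContDiffOn ℝ ∞ ζ (Ioo (-δ) δ ×ˢ {0}ᶜ)
  smul : ∀ ε ∈ Ioo (-δ) δ, ∀ u ≠ 0, ∀ t : ℝ, 0 < t → ζ (ε, t • u) = ζ (ε, u)
  mem : ∀ ε ∈ Ioo (-δ) δ, ∀ u ≠ 0, ζ (ε, u) ∈ I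
  solves_iff : ∀ ε ∈ Ioo (-δ) δ, ∀ u ≠ 0, ∀ z ∈ I,
    z = z₀ + ε * inner ℝ τ (Γ (u, z)) ↔ z = ζ (ε, u)

/-- The normal velocity of the family at the height `ζ`. -/
noncomputable def normalVelocity (Γ : Euc d × ℝ → Euc d) (ζ : ℝ × Euc d → ℝ) (q : ℝ × Euc d) : ℝ :=
  inner ℝ q.2 (fderiv ℝ Γ (q.2, ζ q) (0, 1))

/-- A normal vector of the tilted section at the point with horizontal normal `q.2`. -/
noncomputable def tiltedNormal (Γ : Euc d × ℝ → Euc d) (τ : Euc d) (ζ : ℝ × Euc d → ℝ)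
    (q : ℝ × Euc d) : Euc d :=
  q.2 - (q.1 * normalVelocity Γ ζ q) • τ

/-- The unit vector in the direction `q.2`, displaced by `σ q` in the direction `τ`. -/
noncomputable def displaced (τ : Euc d) (σ : ℝ × Euc d → ℝ) (q : ℝ × Euc d) : Euc d :=
  ‖q.2‖⁻¹ • q.2 + σ q • τ

/-- The displacement `σ` inverts the map to the tilted normals. -/
structure IsTilt (Γ : Euc d × ℝ → Euc d) (τ : Euc d) (ζ : ℝ × Euc d → ℝ) (δ : ℝ)
    (σ : ℝ × Euc d → ℝ) : Prop where
  smooth : ContDiffOn ℝ ∞ σ (Ioo (-δ) δ ×ˢ {0}ᶜ)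
  smul : ∀ ε ∈ Ioo (-δ) δ, ∀ u ≠ 0, ∀ t : ℝ, 0 < t → σ (ε, t • u) = σ (ε, u)
  displaced_ne : ∀ ε ∈ Ioo (-δ) δ, ∀ u ≠ 0, displaced τ σ (ε, u) ≠ 0
  eq : ∀ ε ∈ Ioo (-δ) δ, ∀ u ≠ 0,
    σ (ε, u) = ε * normalVelocity Γ ζ (ε, displaced τ σ (ε, u))
  tiltedNormal_ne : ∀ ε ∈ Ioo (-δ) δ, ∀ u ≠ 0, tiltedNormal Γ τ ζ (ε, u) ≠ 0
  displaced_tiltedNormal : ∀ ε ∈ Ioo (-δ) δ, ∀ u ≠ 0,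
    displaced τ σ (ε, tiltedNormal Γ τ ζ (ε, u)) = ‖tiltedNormal Γ τ ζ (ε, u)‖⁻¹ • u

theorem Ioo_neg_subset {a b : ℝ} (h : a ≤ b) : Ioo (-a) a ⊆ Ioo (-b) b :=
  Ioo_subset_Ioo (neg_le_neg h) h

variable {Γ : Euc d × ℝ → Euc d} {τ : Euc d} {z₀ δ : ℝ} {ζ σ : ℝ × Euc d → ℝ}

theorem IsRadialHeight.mono (h : IsRadialHeight Γ τ z₀ δ ζ) {δ' : ℝ} (hδ : δ' ≤ δ) :
    IsRadialHeight Γ τ z₀ δ' ζ :=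
  ⟨h.smooth.mono (prod_mono_left (Ioo_neg_subset hδ)), fun ε hε => h.smul ε (Ioo_neg_subset hδ hε),
    fun ε hε => h.mem ε (Ioo_neg_subset hδ hε), fun ε hε => h.solves_iff ε (Ioo_neg_subset hδ hε)⟩

theorem IsTilt.mono (h : IsTilt Γ τ ζ δ σ) {δ' : ℝ} (hδ : δ' ≤ δ) : IsTilt Γ τ ζ δ' σ :=
  ⟨h.smooth.mono (prod_mono_left (Ioo_neg_subset hδ)), fun ε hε => h.smul ε (Ioo_neg_subset hδ hε),
    fun ε hε => h.displaced_ne ε (Ioo_neg_subset hδ hε),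
    fun ε hε => h.eq ε (Ioo_neg_subset hδ hε),
    fun ε hε => h.tiltedNormal_ne ε (Ioo_neg_subset hδ hε),
    fun ε hε => h.displaced_tiltedNormal ε (Ioo_neg_subset hδ hε)⟩

theorem isOpen_strip (δ : ℝ) : IsOpen (Ioo (-δ) δ ×ˢ ({0}ᶜ : Set (Euc d))) :=
  isOpen_Ioo.prod isOpen_compl_singleton

theorem IsSupportFamily.contDiffAt (hΓ : IsSupportFamily Γ) {u : Euc d} {z : ℝ} (hu : u ≠ 0)
    (hz : z ∈ I) : ContDiffAt ℝ ∞ Γ (u, z) :=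
  hΓ.smooth.contDiffAt (IsOvaloidFamily.isOpen_dom.mem_nhds ⟨hu, hz⟩)

theorem IsSupportFamily.hasDerivAt (hΓ : IsSupportFamily Γ) {u : Euc d} {z : ℝ} (hu : u ≠ 0)
    (hz : z ∈ I) : HasDerivAt (fun z => Γ (u, z)) (fderiv ℝ Γ (u, z) (0, 1)) z :=
  HasFDerivAt.comp_hasDerivAt (l := Γ) z
    ((hΓ.contDiffAt hu hz).differentiableAt (by simp)).hasFDerivAt
    ((hasDerivAt_const z u).prodMk (hasDerivAt_id z))

/-- The fixed point lemma gives uniqueness only near `z₀`. The bound `R` on `Γ` extends it to all of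
`I`: any solution satisfies `|z - z₀| ≤ |ε| R`, hence is within `r₀ / 2` of `z₀` for the chosen
range of `ε`. -/
theorem IsSupportFamily.exists_isRadialHeight (hΓ : IsSupportFamily Γ) (hz₀ : z₀ ∈ I)
    (hτ : ‖τ‖ = 1) : ∃ δ, 0 < δ ∧ ∃ ζ, IsRadialHeight Γ τ z₀ δ ζ := by
  obtain ⟨R, hR⟩ := hΓ.bounded
  obtain ⟨r₀, hr₀, hball⟩ := Metric.isOpen_iff.1 (isOpen_Ioo (a := (-1 : ℝ)) (b := 1)) z₀ hz₀
  have hI : ∀ s ∈ Ioo (-r₀) r₀, z₀ + s ∈ I := fun s hs =>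
    hball (by rw [mem_ball_iff_norm, add_sub_cancel_left]; exact abs_lt.2 hs)
  obtain ⟨δ, hδ0, -, σ, hσ, hsm, h⟩ := exists_contDiffOn_fixedPoint_of_smul
    (g := fun a : (ℝ × Euc d) × ℝ => inner ℝ τ (Γ (a.1.2, z₀ + a.2))) (ε₀ := 1) (r := r₀ / 2)
    (r₀ := r₀) one_pos (half_pos hr₀) (half_lt_self hr₀) (by
      rintro ⟨⟨ε, u⟩, s⟩ ⟨⟨-, hu⟩, hs⟩
      refine (contDiffAt_const.inner ℝ ?_).contDiffWithinAt
      exact ContDiffAt.comp (g := Γ) (f := fun a : (ℝ × Euc d) × ℝ => (a.1.2, z₀ + a.2))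
        ((ε, u), s) (hΓ.contDiffAt hu (hI s hs)) (by fun_prop))
    (fun ε _ w _ s t ht => by simp only [hΓ.smul w _ t ht])
  refine ⟨min δ (r₀ / 2 / (|R| + 1)), by positivity, fun q => z₀ + σ q, ?_⟩
  have hsub := Ioo_neg_subset (min_le_left δ (r₀ / 2 / (|R| + 1)))
  have hmem : ∀ ε ∈ Ioo (-δ) δ, ∀ u ≠ 0, z₀ + σ (ε, u) ∈ I := fun ε hε u hu => by
    have := (h ε hε u hu).1
    exact hI _ ⟨by linarith [this.1], by linarith [this.2]⟩
  refine ⟨contDiffOn_const.add (hσ.mono (prod_mono_left hsub)), fun ε hε u hu t ht => ?_,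
    fun ε hε => hmem ε (hsub hε), fun ε hε u hu z hz => ⟨fun heq => ?_, ?_⟩⟩
  · simp only [hsm ε (hsub hε) u hu t ht]
  · have h1 : |z - z₀| ≤ r₀ / 2 := by
      have h2 : |ε| ≤ r₀ / 2 / (|R| + 1) := (abs_lt.2 hε).le.trans (min_le_right _ _)
      have h3 : |inner ℝ τ (Γ (u, z))| ≤ |R| + 1 := by
        have h4 := abs_real_inner_le_norm τ (Γ (u, z))
        rw [hτ, one_mul] at h4
        linarith [hR u hu z hz, le_abs_self R]
      have h5 : z - z₀ = ε * inner ℝ τ (Γ (u, z)) := by linarith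
      rw [h5, abs_mul]
      calc _ ≤ r₀ / 2 / (|R| + 1) * (|R| + 1) := by gcongr
        _ = r₀ / 2 := div_mul_cancel₀ _ (by positivity)
    have h6 := (h ε (hsub hε) u hu).2.2 (z - z₀) (abs_le.1 h1)
      (by simp only [add_sub_cancel]; linarith)
    simp only [← h6, add_sub_cancel]
  · rintro rfl
    linarith [(h ε (hsub hε) u hu).2.1]

namespace IsRadialHeight

theorem contDiffAt (hζ : IsRadialHeight Γ τ z₀ δ ζ) {ε : ℝ} {u : Euc d}
    (hε : ε ∈ Ioo (-δ) δ) (hu : u ≠ 0) : ContDiffAt ℝ ∞ ζ (ε, u) :=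
  hζ.smooth.contDiffAt ((isOpen_strip δ).mem_nhds ⟨hε, hu⟩)

theorem eq_of_zero (hζ : IsRadialHeight Γ τ z₀ δ ζ) (hδ : 0 < δ) (hz₀ : z₀ ∈ I) {u : Euc d}
    (hu : u ≠ 0) : ζ (0, u) = z₀ :=
  ((hζ.solves_iff 0 ⟨by linarith, hδ⟩ u hu z₀ hz₀).1 (by simp)).symm

theorem eq (hζ : IsRadialHeight Γ τ z₀ δ ζ) {ε : ℝ} {u : Euc d}
    (hε : ε ∈ Ioo (-δ) δ) (hu : u ≠ 0) : ζ (ε, u) = z₀ + ε * inner ℝ τ (Γ (u, ζ (ε, u))) :=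
  (hζ.solves_iff ε hε u hu _ (hζ.mem ε hε u hu)).2 rfl

theorem contDiffAt_normalVelocity (hζ : IsRadialHeight Γ τ z₀ δ ζ) (hΓ : IsSupportFamily Γ)
    {ε : ℝ} {u : Euc d} (hε : ε ∈ Ioo (-δ) δ) (hu : u ≠ 0) :
    ContDiffAt ℝ ∞ (normalVelocity Γ ζ) (ε, u) := by
  have h1 : ContDiffAt ℝ ∞ (fun q : ℝ × Euc d => fderiv ℝ Γ (q.2, ζ q)) (ε, u) :=
    ContDiffAt.comp (g := fderiv ℝ Γ) (f := fun q : ℝ × Euc d => (q.2, ζ q)) (ε, u)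
      ((hΓ.contDiffAt hu (hζ.mem ε hε u hu)).fderiv_right (m := ∞) (by simp))
      (contDiffAt_snd.prodMk (hζ.contDiffAt hε hu))
  exact contDiffAt_snd.inner ℝ (h1.clm_apply contDiffAt_const)

theorem normalVelocity_smul (hζ : IsRadialHeight Γ τ z₀ δ ζ) (hΓ : IsSupportFamily Γ)
    {ε : ℝ} {u : Euc d} (hε : ε ∈ Ioo (-δ) δ) (hu : u ≠ 0) {t : ℝ} (ht : 0 < t) :
    normalVelocity Γ ζ (ε, t • u) = t * normalVelocity Γ ζ (ε, u) := by
  have hz := hζ.mem ε hε u hu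
  have h1 := hΓ.hasDerivAt (smul_ne_zero ht.ne' hu) hz
  simp only [hΓ.smul u _ t ht] at h1
  have h3 := h1.unique (hΓ.hasDerivAt hu hz)
  simp only [normalVelocity, hζ.smul ε hε u hu t ht, h3, inner_smul_left, conj_trivial]

theorem tiltedNormal_smul (hζ : IsRadialHeight Γ τ z₀ δ ζ) (hΓ : IsSupportFamily Γ)
    {ε : ℝ} {u : Euc d} (hε : ε ∈ Ioo (-δ) δ) (hu : u ≠ 0) {t : ℝ} (ht : 0 < t) :
    tiltedNormal Γ τ ζ (ε, t • u) = t • tiltedNormal Γ τ ζ (ε, u) := by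
  simp only [tiltedNormal, hζ.normalVelocity_smul hΓ hε hu ht]
  module

theorem contDiffAt_tiltedNormal (hζ : IsRadialHeight Γ τ z₀ δ ζ) (hΓ : IsSupportFamily Γ)
    {ε : ℝ} {u : Euc d} (hε : ε ∈ Ioo (-δ) δ) (hu : u ≠ 0) :
    ContDiffAt ℝ ∞ (tiltedNormal Γ τ ζ) (ε, u) :=
  contDiffAt_snd.sub ((contDiffAt_fst.mul (hζ.contDiffAt_normalVelocity hΓ hε hu)).smul
    contDiffAt_const)

/-- Passing from a direction to its tilted normal only subtracts a multiple of `τ`, so the inverse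
solves a scalar fixed point equation for `σ`. Existence of the fixed point gives one composition and
its uniqueness gives the other. -/
theorem exists_isTilt (hζ : IsRadialHeight Γ τ z₀ δ ζ) (hΓ : IsSupportFamily Γ) (hδ : 0 < δ)
    (hτ : ‖τ‖ = 1) : ∃ δ', 0 < δ' ∧ δ' ≤ δ ∧ ∃ σ, IsTilt Γ τ ζ δ' σ := by
  have hunit : ∀ u : Euc d, u ≠ 0 → ‖‖u‖⁻¹ • u‖ = 1 := fun u hu => by
    rw [norm_smul, norm_inv, norm_norm, inv_mul_cancel₀ (norm_ne_zero_iff.2 hu)]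
  have hne : ∀ u : Euc d, u ≠ 0 → ∀ s ∈ Ioo (-1 : ℝ) 1, ‖u‖⁻¹ • u + s • τ ≠ 0 := by
    intro u hu s hs h0
    have h1 := congrArg norm (eq_neg_of_add_eq_zero_left h0)
    rw [hunit u hu, norm_neg, norm_smul, hτ, mul_one, Real.norm_eq_abs] at h1
    exact (abs_lt.2 hs).ne h1.symm
  obtain ⟨C, hC⟩ := ((isCompact_Icc (a := -(δ / 2)) (b := δ / 2)).prod
    (isCompact_sphere (0 : Euc d) 1)).exists_bound_of_continuousOn (f := normalVelocity Γ ζ) (by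
      rintro ⟨ε, u⟩ ⟨hε, hu⟩
      exact (hζ.contDiffAt_normalVelocity hΓ ⟨by linarith [hε.1], by linarith [hε.2]⟩
        (ne_zero_of_mem_unit_sphere ⟨u, hu⟩)).continuousAt.continuousWithinAt)
  have hC' : ∀ ε ∈ Ioo (-(δ / 2)) (δ / 2), ∀ u : Euc d, u ≠ 0 →
      |normalVelocity Γ ζ (ε, u)| ≤ (|C| + 1) * ‖u‖ := by
    intro ε hε u hu
    have hpos := norm_pos_iff.2 hu
    have h1 := hC (ε, ‖u‖⁻¹ • u) ⟨Ioo_subset_Icc_self hε, by simpa using hunit u hu⟩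
    have h2 := hζ.normalVelocity_smul hΓ (Ioo_neg_subset (half_le_self hδ.le) hε) hu
      (inv_pos.2 hpos)
    rw [h2, norm_mul, norm_inv, norm_norm, Real.norm_eq_abs, inv_mul_le_iff₀ hpos] at h1
    nlinarith [le_abs_self C]
  obtain ⟨δ₁, hδ₁0, hδ₁, σ, hσ, hsm, h⟩ := exists_contDiffOn_fixedPoint_of_smul
    (g := fun a : (ℝ × Euc d) × ℝ => normalVelocity Γ ζ (a.1.1, ‖a.1.2‖⁻¹ • a.1.2 + a.2 • τ))
    (ε₀ := δ) (r := 1 / 2) (r₀ := 1) hδ (by norm_num) (by norm_num) (by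
      rintro ⟨⟨ε, u⟩, s⟩ ⟨⟨hε, hu⟩, hs⟩
      have h1 : ContDiffAt ℝ ∞ (fun a : (ℝ × Euc d) × ℝ => ‖a.1.2‖⁻¹) ((ε, u), s) :=
        (ContDiffAt.norm ℝ (f := fun a : (ℝ × Euc d) × ℝ => a.1.2) (by fun_prop) hu).inv
          (norm_ne_zero_iff.2 hu)
      have h2 : ContDiffAt ℝ ∞ (fun a : (ℝ × Euc d) × ℝ => ‖a.1.2‖⁻¹ • a.1.2 + a.2 • τ)
          ((ε, u), s) :=
        (h1.smul (contDiffAt_snd.comp _ contDiffAt_fst)).add (contDiffAt_snd.smul contDiffAt_const)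
      exact (ContDiffAt.comp (g := normalVelocity Γ ζ)
        (f := fun a : (ℝ × Euc d) × ℝ => (a.1.1, ‖a.1.2‖⁻¹ • a.1.2 + a.2 • τ)) ((ε, u), s)
        (hζ.contDiffAt_normalVelocity hΓ hε (hne u hu s hs))
        ((contDiffAt_fst.comp _ contDiffAt_fst).prodMk h2)).contDiffWithinAt)
    (fun ε _ u hu s t ht => by
      have h1 : ‖t • u‖⁻¹ • t • u = ‖u‖⁻¹ • u := by
        rw [norm_smul, Real.norm_of_nonneg ht.le, smul_smul]
        congr 1
        field_simp
      simp only [h1])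
  have hC1 : 0 < |C| + 1 := by positivity
  -- With this choice `|ε k(u)| ≤ ‖u‖ / 3`, where `k` is the normal velocity. So tilted normals do
  -- not vanish, and the displacement `s` below obeys `|s| ≤ (1 + |s|) / 3`, hence `|s| ≤ 1 / 2`,
  -- the range in which the fixed point is unique.
  refine ⟨min δ₁ (min (δ / 2) (1 / 3 / (|C| + 1))), by positivity,
    (min_le_right _ _).trans ((min_le_left _ _).trans (half_le_self hδ.le)), σ, ?_⟩
  set δ' := min δ₁ (min (δ / 2) (1 / 3 / (|C| + 1))) with hδ'
  have hs1 : Ioo (-δ') δ' ⊆ Ioo (-δ₁) δ₁ := Ioo_neg_subset (min_le_left _ _)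
  have hs2 : Ioo (-δ') δ' ⊆ Ioo (-(δ / 2)) (δ / 2) :=
    Ioo_neg_subset ((min_le_right _ _).trans (min_le_left _ _))
  have hs3 : ∀ ε ∈ Ioo (-δ') δ', |ε| * (|C| + 1) ≤ 1 / 3 := by
    intro ε hε
    rw [← le_div_iff₀ hC1]
    exact (abs_lt.2 hε).le.trans ((min_le_right _ _).trans (min_le_right _ _))
  have hkb : ∀ ε ∈ Ioo (-δ') δ', ∀ u : Euc d, u ≠ 0 →
      |ε * normalVelocity Γ ζ (ε, u)| ≤ 1 / 3 * ‖u‖ := by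
    intro ε hε u hu
    rw [abs_mul]
    calc _ ≤ |ε| * ((|C| + 1) * ‖u‖) := by gcongr; exact hC' ε (hs2 hε) u hu
      _ = (|ε| * (|C| + 1)) * ‖u‖ := by ring
      _ ≤ _ := by gcongr; exact hs3 ε hε
  have hMne : ∀ ε ∈ Ioo (-δ') δ', ∀ u : Euc d, u ≠ 0 → tiltedNormal Γ τ ζ (ε, u) ≠ 0 := by
    intro ε hε u hu h0
    have h1 := congrArg norm (sub_eq_zero.1 h0)
    simp only [norm_smul, hτ, mul_one, Real.norm_eq_abs] at h1
    have h2 := hkb ε hε u hu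
    linarith [norm_pos_iff.2 hu]
  refine ⟨hσ.mono (prod_mono_left hs1), fun ε hε => hsm ε (hs1 hε), fun ε hε u hu => ?_,
    fun ε hε u hu => (h ε (hs1 hε) u hu).2.1, hMne, fun ε hε u hu => ?_⟩
  · have h1 := (h ε (hs1 hε) u hu).1
    exact hne u hu _ ⟨by linarith [h1.1], by linarith [h1.2]⟩
  · set μ := tiltedNormal Γ τ ζ (ε, u) with hμ
    have hμ0 : μ ≠ 0 := hMne ε hε u hu
    have hμpos : 0 < ‖μ‖⁻¹ := inv_pos.2 (norm_pos_iff.2 hμ0)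
    have hεδ : ε ∈ Ioo (-δ) δ := Ioo_neg_subset (half_le_self hδ.le) (hs2 hε)
    -- Dividing `u = μ + ε k(u) τ` by `‖μ‖` exhibits `‖μ‖⁻¹ • u` as the unit vector of `μ` displaced
    -- by `s`; homogeneity of `k` shows that `s` solves the fixed point equation.
    set s := ‖μ‖⁻¹ * (ε * normalVelocity Γ ζ (ε, u)) with hs
    have hy : ‖μ‖⁻¹ • u = ‖μ‖⁻¹ • μ + s • τ := by
      have hu' : u = μ + (ε * normalVelocity Γ ζ (ε, u)) • τ := by simp [hμ, tiltedNormal]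
      conv_lhs => rw [hu']
      rw [smul_add, smul_smul, hs]
    have hsk : s = ε * normalVelocity Γ ζ (ε, ‖μ‖⁻¹ • u) := by
      rw [hζ.normalVelocity_smul hΓ hεδ hu hμpos, hs]; ring
    have hsb : |s| ≤ 1 / 2 := by
      have h1 := hkb ε hε _ (smul_ne_zero hμpos.ne' hu)
      rw [← hsk] at h1
      have h2 : ‖‖μ‖⁻¹ • u‖ ≤ 1 + |s| := by
        rw [hy]
        refine (norm_add_le _ _).trans ?_
        rw [hunit μ hμ0, norm_smul, hτ, mul_one, Real.norm_eq_abs]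
      linarith
    have h1 := (h ε (hs1 hε) μ hμ0).2.2 s (abs_le.1 hsb) (by
      simp only
      rw [← hy]; exact hsk)
    rw [hy, displaced, ← h1]

end IsRadialHeight

end ConvexTube

/-! ### Support fields of the tilted sections and the initial velocity -/

namespace ConvexTube

variable {d : ℕ} {Γ : Euc d × ℝ → Euc d} {τ : Euc d} {z₀ δ : ℝ} {ζ σ : ℝ × Euc d → ℝ}

/-- The point of the tilted section with normal `q.2`. -/
noncomputable def tiltedSupport (Γ : Euc d × ℝ → Euc d) (τ : Euc d) (ζ σ : ℝ × Euc d → ℝ)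
    (q : ℝ × Euc d) : Euc d :=
  Γ (displaced τ σ q, ζ (q.1, displaced τ σ q))

namespace IsTilt

theorem contDiffAt (hσ : IsTilt Γ τ ζ δ σ) {ε : ℝ} {u : Euc d}
    (hε : ε ∈ Ioo (-δ) δ) (hu : u ≠ 0) : ContDiffAt ℝ ∞ σ (ε, u) :=
  hσ.smooth.contDiffAt ((isOpen_strip δ).mem_nhds ⟨hε, hu⟩)

theorem contDiffAt_displaced (hσ : IsTilt Γ τ ζ δ σ) {ε : ℝ} {u : Euc d}
    (hε : ε ∈ Ioo (-δ) δ) (hu : u ≠ 0) : ContDiffAt ℝ ∞ (displaced τ σ) (ε, u) := by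
  have h1 : ContDiffAt ℝ ∞ (fun q : ℝ × Euc d => ‖q.2‖⁻¹) (ε, u) :=
    (contDiffAt_snd.norm ℝ hu).inv (norm_ne_zero_iff.2 hu)
  exact (h1.smul contDiffAt_snd).add ((hσ.contDiffAt hε hu).smul contDiffAt_const)

theorem contDiffAt_tiltedSupport (hσ : IsTilt Γ τ ζ δ σ) (hζ : IsRadialHeight Γ τ z₀ δ ζ)
    (hΓ : IsSupportFamily Γ) {ε : ℝ} {u : Euc d} (hε : ε ∈ Ioo (-δ) δ) (hu : u ≠ 0) :
    ContDiffAt ℝ ∞ (tiltedSupport Γ τ ζ σ) (ε, u) := by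
  have hne := hσ.displaced_ne ε hε u hu
  have hD := hσ.contDiffAt_displaced hε hu
  have h1 : ContDiffAt ℝ ∞ (fun q : ℝ × Euc d => ζ (q.1, displaced τ σ q)) (ε, u) :=
    ContDiffAt.comp (g := ζ) (f := fun q : ℝ × Euc d => (q.1, displaced τ σ q)) (ε, u)
      (hζ.contDiffAt hε hne) (contDiffAt_fst.prodMk hD)
  exact ContDiffAt.comp (g := Γ)
    (f := fun q : ℝ × Euc d => (displaced τ σ q, ζ (q.1, displaced τ σ q))) (ε, u)
    (hΓ.contDiffAt hne (hζ.mem ε hε _ hne)) (hD.prodMk h1)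

theorem displaced_smul (hσ : IsTilt Γ τ ζ δ σ) {ε : ℝ} {u : Euc d}
    (hε : ε ∈ Ioo (-δ) δ) (hu : u ≠ 0) {t : ℝ} (ht : 0 < t) :
    displaced τ σ (ε, t • u) = displaced τ σ (ε, u) := by
  have h1 : ‖t • u‖⁻¹ • t • u = ‖u‖⁻¹ • u := by
    rw [norm_smul, Real.norm_of_nonneg ht.le, smul_smul]
    congr 1
    field_simp
  simp only [displaced, hσ.smul ε hε u hu t ht, h1]

theorem tiltedNormal_displaced (hσ : IsTilt Γ τ ζ δ σ) {ε : ℝ} {u : Euc d}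
    (hε : ε ∈ Ioo (-δ) δ) (hu : u ≠ 0) :
    tiltedNormal Γ τ ζ (ε, displaced τ σ (ε, u)) = ‖u‖⁻¹ • u := by
  rw [tiltedNormal, ← hσ.eq ε hε u hu]
  simp [displaced]

theorem eq_zero (hσ : IsTilt Γ τ ζ δ σ) (hδ : 0 < δ) {u : Euc d} (hu : u ≠ 0) :
    σ (0, u) = 0 := by
  have := hσ.eq 0 ⟨by linarith, hδ⟩ u hu
  rwa [zero_mul] at this

theorem displaced_zero (hσ : IsTilt Γ τ ζ δ σ) (hδ : 0 < δ) {u : Euc d} (hu : u ≠ 0) :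
    displaced τ σ (0, u) = ‖u‖⁻¹ • u := by
  simp [displaced, hσ.eq_zero hδ hu]

theorem tiltedSupport_zero (hσ : IsTilt Γ τ ζ δ σ) (hζ : IsRadialHeight Γ τ z₀ δ ζ)
    (hΓ : IsSupportFamily Γ) (hδ : 0 < δ) (hz₀ : z₀ ∈ I) {u : Euc d} (hu : u ≠ 0) :
    tiltedSupport Γ τ ζ σ (0, u) = Γ (u, z₀) := by
  have ht : 0 < ‖u‖⁻¹ := inv_pos.2 (norm_pos_iff.2 hu)
  simp only [tiltedSupport, hσ.displaced_zero hδ hu]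
  rw [hζ.eq_of_zero hδ hz₀ (smul_ne_zero ht.ne' hu), hΓ.smul u _ _ ht]

theorem hasFDerivAt_tiltedSupport (hσ : IsTilt Γ τ ζ δ σ) (hζ : IsRadialHeight Γ τ z₀ δ ζ)
    (hΓ : IsSupportFamily Γ) {ε : ℝ} {u : Euc d} (hε : ε ∈ Ioo (-δ) δ) (hu : u ≠ 0) :
    HasFDerivAt (fun u => tiltedSupport Γ τ ζ σ (ε, u))
      ((fderiv ℝ (tiltedSupport Γ τ ζ σ) (ε, u)).comp (.inr ℝ ℝ (Euc d))) u :=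
  HasFDerivAt.comp (g := tiltedSupport Γ τ ζ σ) u
    ((hσ.contDiffAt_tiltedSupport hζ hΓ hε hu).differentiableAt (by simp)).hasFDerivAt
    (hasFDerivAt_prodMk_right ε u)

/-- The differential `D` of the section is the horizontal differential of `Γ`, orthogonal to `y`,
plus `ε ⟨τ, D w⟩` times `∂Γ/∂z`. Hence `⟨y, D w⟩ = ε k ⟨τ, D w⟩`, and `m = y - ε k τ`. -/
theorem inner_fderiv_tiltedSupport (hσ : IsTilt Γ τ ζ δ σ) (hζ : IsRadialHeight Γ τ z₀ δ ζ)
    (hΓ : IsSupportFamily Γ) {ε : ℝ} {m : Euc d} (hε : ε ∈ Ioo (-δ) δ) (hm : ‖m‖ = 1)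
    (w : Euc d) :
    inner ℝ m (fderiv ℝ (fun u => tiltedSupport Γ τ ζ σ (ε, u)) m w) = 0 := by
  have hm0 : m ≠ 0 := IsOvaloidFamily.ne_zero_of_norm hm
  set y := displaced τ σ (ε, m) with hy
  have hy0 : y ≠ 0 := hσ.displaced_ne ε hε m hm0
  set z := ζ (ε, y) with hz
  have hzI : z ∈ I := hζ.mem ε hε y hy0
  have hmy : m = y - (ε * normalVelocity Γ ζ (ε, y)) • τ := by
    have h1 := hσ.tiltedNormal_displaced hε hm0
    rw [hm, inv_one, one_smul] at h1
    exact h1.symm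
  have hγ := hσ.hasFDerivAt_tiltedSupport hζ hΓ hε hm0
  rw [← hγ.fderiv] at hγ
  set D := fderiv ℝ (fun u => tiltedSupport Γ τ ζ σ (ε, u)) m with hD
  obtain ⟨Y, hY⟩ : ∃ Y, HasFDerivAt (fun u => displaced τ σ (ε, u)) Y m :=
    ⟨_, HasFDerivAt.comp (g := displaced τ σ) m
      ((hσ.contDiffAt_displaced hε hm0).differentiableAt (by simp)).hasFDerivAt
      (hasFDerivAt_prodMk_right ε m)⟩
  -- The height of a point of the section is `z₀ + ε τ·p`, so its differential is expressed through
  -- `D` itself.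
  have hζd : HasFDerivAt (fun u => ζ (ε, displaced τ σ (ε, u)))
      (ε • ((innerSL ℝ τ).comp D)) m := by
    have h1 : HasFDerivAt (fun u => z₀ + ε * (innerSL ℝ τ) (tiltedSupport Γ τ ζ σ (ε, u)))
        (ε • ((innerSL ℝ τ).comp D)) m :=
      (((innerSL ℝ τ).hasFDerivAt.comp m hγ).const_mul ε).const_add z₀
    refine h1.congr_of_eventuallyEq ?_
    filter_upwards [isOpen_compl_singleton.mem_nhds hm0] with u hu
    exact hζ.eq hε (hσ.displaced_ne ε hε u hu)
  have hΓd := ((hΓ.contDiffAt hy0 hzI).differentiableAt (by simp)).hasFDerivAt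
  have h2 : HasFDerivAt (fun u => tiltedSupport Γ τ ζ σ (ε, u))
      ((fderiv ℝ Γ (y, z)).comp (Y.prod (ε • ((innerSL ℝ τ).comp D)))) m :=
    HasFDerivAt.comp (g := Γ) (f := fun u => (displaced τ σ (ε, u), ζ (ε, displaced τ σ (ε, u))))
      m hΓd (hY.prodMk hζd)
  have h3 : D w = fderiv ℝ Γ (y, z) (Y w, 0) + (ε * inner ℝ τ (D w)) • fderiv ℝ Γ (y, z) (0, 1) := by
    have h4 := congrArg (fun L => L w) (hγ.unique h2)
    have h5 : ((Y w, ε * inner ℝ τ (D w)) : Euc d × ℝ) =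
        (Y w, 0) + (ε * inner ℝ τ (D w)) • ((0 : Euc d), (1 : ℝ)) := by simp
    refine h4.trans ?_
    rw [← map_smul, ← map_add, ← h5]
    simp
  have h4 : inner ℝ y (fderiv ℝ Γ (y, z) (Y w, 0)) = 0 := by
    have h5 : HasFDerivAt (fun u => Γ (u, z)) ((fderiv ℝ Γ (y, z)).comp (.inl ℝ (Euc d) ℝ)) y :=
      HasFDerivAt.comp (g := Γ) y hΓd (hasFDerivAt_prodMk_left y z)
    have h6 := (hΓ.field z hzI).perp y hy0 (Y w)
    rw [h5.fderiv] at h6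
    simpa using h6
  have h5 : inner ℝ y (D w) = (ε * inner ℝ τ (D w)) * normalVelocity Γ ζ (ε, y) := by
    conv_lhs => rw [h3]
    rw [inner_add_right, h4, inner_smul_right, zero_add]
    rfl
  nth_rewrite 1 [hmy]
  rw [inner_sub_left, inner_smul_left, h5]
  simp only [conj_trivial]
  ring

/-- For small tilts the tilted sections are again given by support fields. -/
theorem exists_isSupportField (hσ : IsTilt Γ τ ζ δ σ) (hζ : IsRadialHeight Γ τ z₀ δ ζ)
    (hΓ : IsSupportFamily Γ) (hδ : 0 < δ) (hz₀ : z₀ ∈ I) :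
    ∃ δ', 0 < δ' ∧ δ' ≤ δ ∧ ∀ ε ∈ Ioo (-δ') δ',
      IsSupportField fun u => tiltedSupport Γ τ ζ σ (ε, u) := by
  have h0 : (0 : ℝ) ∈ Ioo (-δ) δ := ⟨by linarith, hδ⟩
  set K : Set (Euc d × Euc d) := {a | ‖a.1‖ = 1 ∧ ‖a.2‖ = 1 ∧ inner ℝ a.1 a.2 = 0} with hK
  have hKc : IsCompact K := by
    refine ((isCompact_sphere (0 : Euc d) 1).prod (isCompact_sphere (0 : Euc d) 1)).of_isClosed_subset
      ?_ fun a ha => ⟨by simpa using ha.1, by simpa using ha.2.1⟩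
    exact ((isClosed_eq (by fun_prop) continuous_const).inter
      ((isClosed_eq (by fun_prop) continuous_const).inter
        (isClosed_eq (by fun_prop) continuous_const)))
  -- At `ε = 0` the section is the slice at `z₀`, whose support field is positive; compactness of
  -- the set of orthonormal pairs makes this stable for small `ε`.
  have key := hKc.eventually_forall_of_forall_eventually (x₀ := (0 : ℝ))
    (P := fun ε a => 0 < inner ℝ (fderiv ℝ (tiltedSupport Γ τ ζ σ) (ε, a.1) (0, a.2)) a.2) (by
      rintro ⟨m, w⟩ ⟨hm, hw, hmw⟩
      have hm0 : m ≠ 0 := IsOvaloidFamily.ne_zero_of_norm hm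
      have hw0 : w ≠ 0 := IsOvaloidFamily.ne_zero_of_norm hw
      have h1 : ContinuousAt (fun b : ℝ × (Euc d × Euc d) =>
          fderiv ℝ (tiltedSupport Γ τ ζ σ) (b.1, b.2.1)) (0, (m, w)) :=
        ContinuousAt.comp (g := fderiv ℝ (tiltedSupport Γ τ ζ σ))
          (f := fun b : ℝ × (Euc d × Euc d) => (b.1, b.2.1))
          (((hσ.contDiffAt_tiltedSupport hζ hΓ h0 hm0).fderiv_right (m := ∞)
            (by simp)).continuousAt) (by fun_prop)
      have h2 : ContinuousAt (fun b : ℝ × (Euc d × Euc d) =>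
          (inner ℝ (fderiv ℝ (tiltedSupport Γ τ ζ σ) (b.1, b.2.1) (0, b.2.2)) b.2.2 : ℝ))
          (0, (m, w)) :=
        (h1.clm_apply (by fun_prop)).inner (by fun_prop)
      refine h2.eventually (lt_mem_nhds ?_)
      have h3 := (hσ.hasFDerivAt_tiltedSupport hζ hΓ h0 hm0).fderiv
      have h4 : (fun u => tiltedSupport Γ τ ζ σ (0, u)) =ᶠ[𝓝 m] fun u => Γ (u, z₀) := by
        filter_upwards [isOpen_compl_singleton.mem_nhds hm0] with u hu
        exact hσ.tiltedSupport_zero hζ hΓ hδ hz₀ hu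
      rw [h4.fderiv_eq] at h3
      have h5 := (hΓ.field z₀ hz₀).pos m w hm0 hmw hw0
      rw [h3] at h5
      simpa using h5)
  obtain ⟨δ', hδ'0, hδ'⟩ := Metric.eventually_nhds_iff_ball.1 key
  refine ⟨min δ δ', by positivity, min_le_left _ _, fun ε hε => ?_⟩
  have hεδ : ε ∈ Ioo (-δ) δ := Ioo_neg_subset (min_le_left _ _) hε
  have hεδ' : ε ∈ Metric.ball (0 : ℝ) δ' := by
    rw [mem_ball_zero_iff]
    exact abs_lt.2 (Ioo_neg_subset (min_le_right _ _) hε)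
  refine .of_unit (fun u hu => ?_) (fun u t ht => ?_)
    (fun m hm w => hσ.inner_fderiv_tiltedSupport hζ hΓ hεδ hm w) fun m w hm hmw hw => ?_
  · exact (ContDiffAt.comp (g := tiltedSupport Γ τ ζ σ) (f := fun u => (ε, u)) u
      (hσ.contDiffAt_tiltedSupport hζ hΓ hεδ hu)
      (contDiffAt_const.prodMk contDiffAt_id)).contDiffWithinAt
  · by_cases hu : u = 0
    · simp [hu]
    · simp only [tiltedSupport, hσ.displaced_smul hεδ hu ht]
  · rw [(hσ.hasFDerivAt_tiltedSupport hζ hΓ hεδ (IsOvaloidFamily.ne_zero_of_norm hm)).fderiv]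
    have hwpos : 0 < ‖w‖⁻¹ := inv_pos.2 (norm_pos_iff.2 hw)
    have h1 := hδ' ε hεδ' (m, ‖w‖⁻¹ • w) ⟨hm, by simp [norm_smul, hw], by
      simp only [inner_smul_right, hmw, mul_zero]⟩
    have h2 : ((0 : ℝ), ‖w‖⁻¹ • w) = ‖w‖⁻¹ • ((0 : ℝ), w) := by simp
    simp only [h2, map_smul, inner_smul_left, inner_smul_right, conj_trivial] at h1
    simpa using pos_of_mul_pos_right (pos_of_mul_pos_right h1 hwpos.le) hwpos.le

/-- The initial velocity of the displaced directions. -/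
theorem hasDerivAt_displaced (hσ : IsTilt Γ τ ζ δ σ) (hζ : IsRadialHeight Γ τ z₀ δ ζ)
    (hΓ : IsSupportFamily Γ) (hδ : 0 < δ) (hz₀ : z₀ ∈ I) {u : Euc d} (hu : ‖u‖ = 1) :
    HasDerivAt (fun ε => displaced τ σ (ε, u))
      ((inner ℝ u (fderiv ℝ Γ (u, z₀) (0, 1)) : ℝ) • τ) 0 := by
  have hu0 : u ≠ 0 := IsOvaloidFamily.ne_zero_of_norm hu
  have h0 : (0 : ℝ) ∈ Ioo (-δ) δ := ⟨by linarith, hδ⟩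
  have hd0 : displaced τ σ (0, u) = u := by rw [hσ.displaced_zero hδ hu0, hu]; simp
  have h1 : ContDiffAt ℝ ∞ (fun ε => normalVelocity Γ ζ (ε, displaced τ σ (ε, u))) 0 := by
    have h2 : ContDiffAt ℝ ∞ (fun ε : ℝ => displaced τ σ (ε, u)) 0 :=
      ContDiffAt.comp (g := displaced τ σ) (f := fun ε : ℝ => (ε, u)) 0
        (hσ.contDiffAt_displaced h0 hu0) (contDiffAt_id.prodMk contDiffAt_const)
    exact ContDiffAt.comp (g := normalVelocity Γ ζ)
      (f := fun ε : ℝ => (ε, displaced τ σ (ε, u))) 0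
      (hζ.contDiffAt_normalVelocity hΓ h0 (hσ.displaced_ne 0 h0 u hu0))
      (contDiffAt_id.prodMk h2)
  -- In `σ = ε k` the derivative of `k` is multiplied by `ε = 0`, so only the value of `k` at `ε =
  -- 0` survives.
  have h2 := (hasDerivAt_id (0 : ℝ)).mul (h1.differentiableAt (by simp)).hasDerivAt
  have h3 : HasDerivAt (fun ε => σ (ε, u)) (inner ℝ u (fderiv ℝ Γ (u, z₀) (0, 1))) 0 := by
    refine (h2.congr_of_eventuallyEq ?_).congr_deriv ?_
    · filter_upwards [isOpen_Ioo.mem_nhds h0] with ε hε using hσ.eq ε hε u hu0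
    · simp [hd0, normalVelocity, hζ.eq_of_zero hδ hz₀ hu0]
  exact (h3.smul_const τ).const_add (‖u‖⁻¹ • u)

end IsTilt

/-! ### From maps constant on rays back to the sphere -/

/-- The differential of the radial projection at a unit vector. -/
theorem hasDerivAt_coe_sphereProj_comp {v : ℝ → Euc d} {v' : Euc d} (u : Sph d) {t : ℝ}
    (hv : HasDerivAt v v' t) (hvt : v t = u) :
    HasDerivAt (fun t => (sphereProj (v t) : Euc d))
      (v' - inner ℝ v' (u : Euc d) • (u : Euc d)) t := by
  have hu : (u : Euc d) ≠ 0 := ne_zero_of_mem_unit_sphere u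
  have hd : HasFDerivAt (fun y : Euc d => (sphereProj y : Euc d))
      (fderiv ℝ (fun y : Euc d => (sphereProj y : Euc d)) u) (u : Euc d) :=
    ((contDiffOn_coe_sphereProj.contDiffAt
      (isOpen_compl_singleton.mem_nhds hu)).differentiableAt (by simp)).hasFDerivAt
  set L := fderiv ℝ (fun y : Euc d => (sphereProj y : Euc d)) u with hL
  have hLu : L u = 0 := by
    have h1 : HasDerivAt (fun t : ℝ => t • (u : Euc d)) u 1 := by
      simpa using (hasDerivAt_id (1 : ℝ)).smul_const (u : Euc d)
    have hd' : HasFDerivAt (fun y : Euc d => (sphereProj y : Euc d)) L ((1 : ℝ) • (u : Euc d)) := by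
      rw [one_smul]; exact hd
    have h2 := hd'.comp_hasDerivAt 1 h1
    refine h2.unique ((hasDerivAt_const (1 : ℝ) (u : Euc d)).congr_of_eventuallyEq ?_)
    filter_upwards [lt_mem_nhds (zero_lt_one' ℝ)] with t ht
    simp [sphereProj_smul _ ht]
  have hLw : ∀ w, inner ℝ (u : Euc d) w = 0 → L w = w := by
    intro w hw
    have h1 : HasDerivAt (fun t : ℝ => (u : Euc d) + t • w) w 0 := by
      simpa using ((hasDerivAt_id (0 : ℝ)).smul_const w).const_add (u : Euc d)
    have hd' : HasFDerivAt (fun y : Euc d => (sphereProj y : Euc d)) L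
        ((u : Euc d) + (0 : ℝ) • w) := by
      rw [zero_smul, add_zero]; exact hd
    have h2 := hd'.comp_hasDerivAt 0 h1
    exact h2.unique (hasDerivAt_coe_sphereProj u hw)
  have h3 : L v' = v' - inner ℝ v' (u : Euc d) • (u : Euc d) := by
    have h4 : L (v' - inner ℝ v' (u : Euc d) • (u : Euc d)) =
        v' - inner ℝ v' (u : Euc d) • (u : Euc d) := by
      apply hLw
      rw [inner_sub_right, inner_smul_right, real_inner_self_eq_norm_sq, norm_eq_of_mem_sphere,
        real_inner_comm]
      ring
    rw [map_sub, map_smul, hLu, smul_zero, sub_zero] at h4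
    exact h4
  rw [← h3]
  exact HasFDerivAt.comp_hasDerivAt (l := fun y : Euc d => (sphereProj y : Euc d)) t
    (hvt ▸ hd) hv

/-- Restriction to `(-δ, δ) × 𝕊^d` of maps smooth on `(-δ, δ) × (ℝ^(d+1) ∖ {0})`. -/
theorem contMDiffOn_strip {F : Type*} [NormedAddCommGroup F] [NormedSpace ℝ F]
    {Φ : ℝ × Euc d → F} (hΦ : ∀ ε ∈ Ioo (-δ) δ, ∀ u ≠ 0, ContDiffAt ℝ ∞ Φ (ε, u)) :
    ContMDiffOn (𝓘(ℝ, ℝ).prod (𝓡 d)) 𝓘(ℝ, F) ∞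
      (fun q : ℝ × Sph d => Φ (q.1, (q.2 : Euc d))) (Ioo (-δ) δ ×ˢ univ) := by
  have h1 : ContMDiff (𝓘(ℝ, ℝ).prod (𝓡 d)) 𝓘(ℝ, ℝ × Euc d) ∞
      (fun q : ℝ × Sph d => (q.1, (q.2 : Euc d))) :=
    contMDiff_fst.prodMk_space (contMDiff_coe_sph.comp contMDiff_snd)
  have h2 : ContDiffOn ℝ ∞ Φ (Ioo (-δ) δ ×ˢ {0}ᶜ) := fun q hq =>
    (hΦ q.1 hq.1 q.2 hq.2).contDiffWithinAt
  exact h2.contMDiffOn.comp h1.contMDiffOn fun q hq => ⟨hq.1, ne_zero_of_mem_unit_sphere q.2⟩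

theorem contMDiffOn_sphereProj_strip {Φ : ℝ × Euc d → Euc d}
    (hΦ : ∀ ε ∈ Ioo (-δ) δ, ∀ u ≠ 0, ContDiffAt ℝ ∞ Φ (ε, u))
    (hne : ∀ ε ∈ Ioo (-δ) δ, ∀ u ≠ 0, Φ (ε, u) ≠ 0) :
    ContMDiffOn (𝓘(ℝ, ℝ).prod (𝓡 d)) (𝓡 d) ∞
      (fun q : ℝ × Sph d => sphereProj (Φ (q.1, (q.2 : Euc d)))) (Ioo (-δ) δ ×ˢ univ) :=
  contMDiffOn_sphereProj.comp (contMDiffOn_strip hΦ) fun q hq =>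
    hne q.1 hq.1 q.2 (ne_zero_of_mem_unit_sphere q.2)

theorem contMDiff_slice {f : ℝ × Sph d → Sph d} {ε : ℝ} (hε : ε ∈ Ioo (-δ) δ)
    (hf : ContMDiffOn (𝓘(ℝ, ℝ).prod (𝓡 d)) (𝓡 d) ∞ f (Ioo (-δ) δ ×ˢ univ)) :
    ContMDiff (𝓡 d) (𝓡 d) ∞ fun u => f (ε, u) := by
  rw [← contMDiffOn_univ]
  exact hf.comp (contMDiff_const.prodMk contMDiff_id).contMDiffOn fun u _ => ⟨hε, trivial⟩

/-- The reparametrization of the sphere by the normals of the tilted section. -/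
noncomputable def tiltDiffeomorph (hσ : IsTilt Γ τ ζ δ σ) (hζ : IsRadialHeight Γ τ z₀ δ ζ)
    (hΓ : IsSupportFamily Γ) {ε : ℝ} (hε : ε ∈ Ioo (-δ) δ) :
    Diffeomorph (𝓡 d) (𝓡 d) (Sph d) (Sph d) ∞ where
  toFun u := sphereProj (displaced τ σ (ε, (u : Euc d)))
  invFun u := sphereProj (tiltedNormal Γ τ ζ (ε, (u : Euc d)))
  left_inv u := by
    have hu : (u : Euc d) ≠ 0 := ne_zero_of_mem_unit_sphere u
    have hy := hσ.displaced_ne ε hε u hu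
    simp only
    rw [coe_sphereProj hy, hζ.tiltedNormal_smul hΓ hε hy (inv_pos.2 (norm_pos_iff.2 hy)),
      hσ.tiltedNormal_displaced hε hu, sphereProj_smul _ (inv_pos.2 (norm_pos_iff.2 hy)),
      sphereProj_smul _ (inv_pos.2 (norm_pos_iff.2 hu)), sphereProj_coe]
  right_inv u := by
    have hu : (u : Euc d) ≠ 0 := ne_zero_of_mem_unit_sphere u
    have hy := hσ.tiltedNormal_ne ε hε u hu
    simp only
    rw [coe_sphereProj hy, hσ.displaced_smul hε hy (inv_pos.2 (norm_pos_iff.2 hy)),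
      hσ.displaced_tiltedNormal ε hε u hu, sphereProj_smul _ (inv_pos.2 (norm_pos_iff.2 hy)),
      sphereProj_coe]
  contMDiff_toFun := contMDiff_slice hε (contMDiffOn_sphereProj_strip
    (fun _ hε _ hu => hσ.contDiffAt_displaced hε hu) hσ.displaced_ne)
  contMDiff_invFun := contMDiff_slice hε (contMDiffOn_sphereProj_strip
    (fun _ hε _ hu => hζ.contDiffAt_tiltedNormal hΓ hε hu) hσ.tiltedNormal_ne)

end ConvexTube

namespace ConvexTube

variable {d : ℕ} {T : Set (Euc d × ℝ)}

/-! ### Transversely convex tubes -/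

theorem image_sphereProj_sphere (f : Sph d → Euc d) :
    (fun y => f (sphereProj y)) '' Metric.sphere 0 1 = range f := by
  ext p
  constructor
  · rintro ⟨y, -, rfl⟩
    exact ⟨_, rfl⟩
  · rintro ⟨u, rfl⟩
    exact ⟨u, u.2, by simp⟩

/-- At fixed height the last coordinate of `X` is constant and `c` only translates, so injectivity
and immersivity of `X` pass to `α (·, z)`. -/
theorem isOvaloidFamily_of_tube {c : ℝ → Euc d} {α : Sph d × ℝ → Euc d}
    (hα : ContMDiffOn ((𝓡 d).prod 𝓘(ℝ, ℝ)) 𝓘(ℝ, Euc d) ∞ α (univ ×ˢ I))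
    (hX : IsEmbeddingOnTube (tubeMap c α))
    (hov : ∀ z ∈ I, IsOvaloid (range fun u => α (u, z))) :
    IsOvaloidFamily fun q : Euc d × ℝ => α (sphereProj q.1, q.2) where
  smooth := contDiffOn_comp_sphereProj hα
  inj := by
    intro z hz x hx y hy hxy
    have h1 : ∀ u v : Sph d, α (u, z) = α (v, z) → u = v := by
      intro u v huv
      have h2 := hX.embedding.injective
        (a₁ := ⟨(u, z), trivial, hz⟩) (a₂ := ⟨(v, z), trivial, hz⟩)
        (by simp [Set.domRestrict, tubeMap, huv])
      exact congrArg (fun q => q.1.1) h2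
    have h3 := h1 _ _ hxy
    have h4 := congrArg (Subtype.val) h3
    have h5 : (sphereProj x : Euc d) = x := congrArg Subtype.val (sphereProj_coe ⟨x, hx⟩)
    have h6 : (sphereProj y : Euc d) = y := congrArg Subtype.val (sphereProj_coe ⟨y, hy⟩)
    rw [← h5, ← h6, h4]
  smul y z r hr := by simp only [sphereProj_smul y hr]
  imm := by
    intro z hz y w hy hyw hw h0
    have hy0 : y ≠ 0 := IsOvaloidFamily.ne_zero_of_norm hy
    let u : Sph d := ⟨y, mem_sphere_zero_iff_norm.2 hy⟩
    have hmem : ((univ : Set (Sph d)) ×ˢ I) ∈ 𝓝 (u, z) :=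
      (isOpen_univ.prod isOpen_Ioo).mem_nhds ⟨trivial, hz⟩
    have hXd : MDifferentiableAt ((𝓡 d).prod 𝓘(ℝ, ℝ)) 𝓘(ℝ, Euc d × ℝ) (tubeMap c α) (u, z) :=
      (hX.smooth.contMDiffAt hmem).mdifferentiableAt (by simp)
    have hl : HasDerivAt (fun t : ℝ => y + t • w) w 0 := by
      simpa using ((hasDerivAt_id (0 : ℝ)).smul_const w).const_add y
    have hA₂ : ContDiffAt ℝ ∞ (fun q : Euc d × ℝ => α (sphereProj q.1, q.2)) (y, z) :=
      (contDiffOn_comp_sphereProj hα).contDiffAt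
        (IsOvaloidFamily.isOpen_dom.mem_nhds ⟨hy0, hz⟩)
    have hA : ContDiffAt ℝ ∞ (fun y => α (sphereProj y, z)) y :=
      ContDiffAt.comp (g := fun q : Euc d × ℝ => α (sphereProj q.1, q.2))
        (f := fun y => (y, z)) y hA₂ (contDiffAt_id.prodMk contDiffAt_const)
    have hA' : HasFDerivAt (fun y => α (sphereProj y, z))
        (fderiv ℝ (fun y => α (sphereProj y, z)) y) (y + (0 : ℝ) • w) := by
      rw [zero_smul, add_zero]
      exact (hA.differentiableAt (by simp)).hasFDerivAt
    have h1 : HasDerivAt (fun t : ℝ => α (sphereProj (y + t • w), z)) 0 0 :=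
      (HasFDerivAt.comp_hasDerivAt (l := fun y => α (sphereProj y, z)) 0 hA' hl).congr_deriv h0
    have h2 : HasDerivAt (fun t : ℝ => tubeMap c α (sphereProj ((u : Euc d) + t • w), z))
        (0, 0) 0 := (h1.const_add (c z)).prodMk (hasDerivAt_const (0 : ℝ) z)
    exact ne_zero_of_hasDerivAt_comp_sphereProj hXd (hX.immersion (u, z) ⟨trivial, hz⟩) hyw hw h2
      rfl
  ovaloid z hz := by
    rw [image_sphereProj_sphere fun u => α (u, z)]
    exact hov z hz

/-- A bounded transversely convex tube is swept out by a smooth family of support fields. -/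
theorem IsTransverselyConvexTube.exists_isSupportFamily (hT : IsTransverselyConvexTube T)
    (hbdd : Bornology.IsBounded T) :
    ∃ Γ : Euc d × ℝ → Euc d, IsSupportFamily Γ ∧
      (∀ z ∈ I, horizontalSlice T z = range fun u : Sph d => Γ (u, z)) ∧
      ∀ q ∈ T, q.2 ∈ I := by
  obtain ⟨c, α, hc, hα, hX, hov, rfl⟩ := hT
  have hA := isOvaloidFamily_of_tube hα hX fun z hz => (hov z hz).1
  set A : Euc d × ℝ → Euc d := fun q => α (sphereProj q.1, q.2) with hAdef
  have hslice : ∀ z ∈ I, horizontalSlice (tubeMap c α '' (univ ×ˢ I)) z =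
      range fun u : Sph d => c z + IsOvaloidFamily.support A (u, z) := by
    intro z hz
    have h1 := hA.range_support hz
    rw [image_sphereProj_sphere fun u => α (u, z)] at h1
    ext p
    constructor
    · rintro ⟨⟨v, z'⟩, -, hv⟩
      simp only [tubeMap, Prod.mk.injEq] at hv
      obtain ⟨rfl, rfl⟩ := hv
      obtain ⟨u, hu⟩ := h1.ge (mem_range_self v)
      exact ⟨u, congrArg (fun x => c z' + x) hu⟩
    · rintro ⟨u, rfl⟩
      obtain ⟨v, hv⟩ := h1.le (mem_range_self u)
      exact ⟨(v, z), ⟨trivial, hz⟩, Prod.ext (congrArg (fun x => c z + x) hv) rfl⟩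
  refine ⟨fun q => c q.2 + IsOvaloidFamily.support A q, ⟨?_, ?_, ?_, ?_⟩, hslice, ?_⟩
  · rintro ⟨u, z⟩ ⟨hu, hz⟩
    have h1 : ContDiffAt ℝ ∞ (fun q : Euc d × ℝ => c q.2) (u, z) :=
      ContDiffAt.comp (g := c) (f := fun q : Euc d × ℝ => q.2) (u, z)
        (hc.contDiffAt (isOpen_Ioo.mem_nhds hz)) contDiffAt_snd
    exact (h1.add (hA.contDiffAt_support hu hz)).contDiffWithinAt
  · intro u z t ht
    simp only [IsOvaloidFamily.support, IsOvaloidFamily.top_smul u z t ht]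
  · exact fun z hz => hA.isSupportField hz (c z)
  · obtain ⟨R, hR⟩ := hbdd.exists_norm_le
    refine ⟨R, fun u hu z hz => ?_⟩
    have ht : 0 < ‖u‖⁻¹ := inv_pos.2 (norm_pos_iff.2 hu)
    have h1 : c z + IsOvaloidFamily.support A (u, z) ∈
        horizontalSlice (tubeMap c α '' (univ ×ˢ I)) z := by
      rw [hslice z hz]
      refine ⟨sphereProj u, ?_⟩
      simp only [coe_sphereProj hu, IsOvaloidFamily.support, IsOvaloidFamily.top_smul u z _ ht]
    have h2 : ‖((c z + IsOvaloidFamily.support A (u, z), z) : Euc d × ℝ)‖ ≤ R := hR _ h1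
    exact (norm_fst_le ((c z + IsOvaloidFamily.support A (u, z), z) : Euc d × ℝ)).trans h2
  · rintro _ ⟨⟨v, z⟩, ⟨-, hz⟩, rfl⟩
    exact hz

/-- A point of the tilted section with horizontal normal `u` must lie at height `ζ (ε, u)`. It is
the value of `tiltedSupport` at the tilted normal of `u`, because displacing that normal returns the
ray of `u`. -/
theorem projectedSlice_eq_range {Γ : Euc d × ℝ → Euc d} {τ : Sph d} {z₀ δ ε : ℝ}
    {ζ σ : ℝ × Euc d → ℝ} (hΓ : IsSupportFamily Γ)
    (hslice : ∀ z ∈ I, horizontalSlice T z = range fun u : Sph d => Γ (u, z))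
    (hTI : ∀ q ∈ T, q.2 ∈ I) (hζ : IsRadialHeight Γ τ z₀ δ ζ) (hσ : IsTilt Γ τ ζ δ σ)
    (hε : ε ∈ Ioo (-δ) δ) :
    projectedSlice T τ z₀ ε = range fun u : Sph d => tiltedSupport Γ τ ζ σ (ε, u) := by
  ext p
  constructor
  · rintro ⟨⟨p, z⟩, ⟨hpT, hpz⟩, rfl⟩
    have hz : z ∈ I := hTI _ hpT
    obtain ⟨u, hu⟩ : p ∈ range fun u : Sph d => Γ (u, z) := hslice z hz ▸ hpT
    have hu0 : (u : Euc d) ≠ 0 := ne_zero_of_mem_unit_sphere u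
    have hpz' : z = ε * inner ℝ p (τ : Euc d) + z₀ := hpz
    simp only at hu
    have hzζ : z = ζ (ε, u) := (hζ.solves_iff ε hε u hu0 z hz).1 (by
      rw [hu, real_inner_comm]; linarith)
    have hμ := hσ.tiltedNormal_ne ε hε u hu0
    have hμ' := inv_pos.2 (norm_pos_iff.2 hμ)
    refine ⟨sphereProj (tiltedNormal Γ τ ζ (ε, u)), ?_⟩
    simp only [tiltedSupport]
    rw [coe_sphereProj hμ, hσ.displaced_smul hε hμ hμ', hσ.displaced_tiltedNormal ε hε u hu0,
      hζ.smul ε hε u hu0 _ hμ', hΓ.smul _ _ _ hμ', ← hzζ, hu]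
  · rintro ⟨u, rfl⟩
    have hu0 : (u : Euc d) ≠ 0 := ne_zero_of_mem_unit_sphere u
    have hy := hσ.displaced_ne ε hε u hu0
    have hz := hζ.mem ε hε _ hy
    have h1 : tiltedSupport Γ τ ζ σ (ε, u) ∈
        horizontalSlice T (ζ (ε, displaced τ σ (ε, u))) := by
      rw [hslice _ hz]
      refine ⟨sphereProj (displaced τ σ (ε, u)), ?_⟩
      simp only [coe_sphereProj hy]
      exact hΓ.smul _ _ _ (inv_pos.2 (norm_pos_iff.2 hy))
    refine ⟨(_, ζ (ε, displaced τ σ (ε, u))), ⟨h1, ?_⟩, rfl⟩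
    have h2 := hζ.eq hε hy
    change ζ (ε, displaced τ σ (ε, u)) =
      ε * inner ℝ (tiltedSupport Γ τ ζ σ (ε, u)) (τ : Euc d) + z₀
    rw [real_inner_comm]
    exact h2.trans (add_comm _ _)

end ConvexTube

/-! ### The theorem on tilted sections -/

theorem mainTheorem8 (d : ℕ) (hd : 1 ≤ d) (T : Set (Euc d × ℝ))
    (hT : IsTransverselyConvexTube T) (hbdd : Bornology.IsBounded T) :
    -- the support map is well defined and smooth
    ContMDiffOn ((𝓡 d).prod 𝓘(ℝ, ℝ)) 𝓘(ℝ, Euc d) ∞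
      (fun q : Sph d × ℝ => supportMap T q.1 q.2) (Set.univ ×ˢ I) ∧
    (∀ z ∈ I, IsSupportParametrization (fun u => supportMap T u z) (horizontalSlice T z)) ∧
    ∀ z₀ ∈ I, ∀ τ : Sph d,
      ∃ δ : ℝ, 0 < δ ∧
      ∃ ζ : ℝ → Sph d → ℝ, IsHeightFunction T τ z₀ δ ζ ∧
      ∃ θ : ℝ → Diffeomorph (𝓡 d) (𝓡 d) (Sph d) (Sph d) ∞,
        ContMDiffOn (𝓘(ℝ, ℝ).prod (𝓡 d)) (𝓡 d) ∞
          (fun q : ℝ × Sph d => θ q.1 q.2) (Set.Ioo (-δ) δ ×ˢ Set.univ) ∧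
        (∀ ε ∈ Set.Ioo (-δ) δ, IsSupportParametrization
          (fun u => supportMap T (θ ε u) (ζ ε (θ ε u))) (projectedSlice T τ z₀ ε)) ∧
        (∀ u, θ 0 u = u) ∧
        ∀ u : Sph d, HasDerivAt (fun ε => (θ ε u : Euc d))
          (inner ℝ (u : Euc d) (deriv (fun z => supportMap T u z) z₀) • tangentialPart τ u) 0 := by
  obtain ⟨Γ, hΓ, hslice, hTI⟩ := hT.exists_isSupportFamily hbdd
  have hsupp : ∀ z ∈ I, ∀ u : Sph d, supportMap T u z = Γ (u, z) := by
    intro z hz u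
    rw [supportMap, hslice z hz]
    exact (hΓ.field z hz).gaussInverse_eq hd u
  have hne : ∀ u : Sph d, (u : Euc d) ≠ 0 := fun u => ne_zero_of_mem_unit_sphere u
  refine ⟨?_, fun z hz => ?_, fun z₀ hz₀ τ => ?_⟩
  · have h1 : ContMDiff ((𝓡 d).prod 𝓘(ℝ, ℝ)) 𝓘(ℝ, Euc d × ℝ) ∞
        (fun q : Sph d × ℝ => ((q.1 : Euc d), q.2)) :=
      (contMDiff_coe_sph.comp contMDiff_fst).prodMk_space contMDiff_snd
    refine (hΓ.smooth.contMDiffOn.comp h1.contMDiffOn fun q hq => ⟨hne q.1, hq.2⟩).congr ?_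
    exact fun q hq => hsupp q.2 hq.2 q.1
  · rw [hslice z hz, funext (hsupp z hz)]
    exact (hΓ.field z hz).isSupportParametrization hd
  have hτ : ‖(τ : Euc d)‖ = 1 := norm_eq_of_mem_sphere τ
  -- The range of `ε` shrinks three times: for the height function, for the inversion of the tilted
  -- normals and for positive curvature of the sections.
  obtain ⟨δ₁, hδ₁, ζ, hζ₁⟩ := hΓ.exists_isRadialHeight hz₀ hτ
  obtain ⟨δ₂, hδ₂, hδ₂₁, σ, hσ₂⟩ := hζ₁.exists_isTilt hΓ hδ₁ hτ
  obtain ⟨δ, hδ, hδδ₂, hfield⟩ := hσ₂.exists_isSupportField (hζ₁.mono hδ₂₁) hΓ hδ₂ hz₀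
  have hσ := hσ₂.mono hδδ₂
  have hζ := hζ₁.mono (hδδ₂.trans hδ₂₁)
  have h0 : (0 : ℝ) ∈ Ioo (-δ) δ := ⟨by linarith, hδ⟩
  classical
  -- The identity outside `(-δ, δ)` is only a default value.
  let θ : ℝ → Diffeomorph (𝓡 d) (𝓡 d) (Sph d) (Sph d) ∞ := fun ε =>
    if hε : ε ∈ Ioo (-δ) δ then tiltDiffeomorph hσ hζ hΓ hε else Diffeomorph.refl _ _ _
  have hθ : ∀ ε ∈ Ioo (-δ) δ, ∀ u : Sph d,
      θ ε u = sphereProj (displaced τ σ (ε, (u : Euc d))) := by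
    intro ε hε u
    simp only [θ, dif_pos hε]
    rfl
  refine ⟨δ, hδ, fun ε u => ζ (ε, u), ?_, θ, ?_, fun ε hε => ?_, fun u => ?_, fun u => ?_⟩
  · refine ⟨contMDiffOn_strip fun ε hε u hu => hζ.contDiffAt hε hu,
      fun u => hζ.eq_of_zero hδ hz₀ (hne u), fun ε hε u => hζ.mem ε hε u (hne u),
      fun ε hε u z hz => ?_⟩
    rw [← hζ.solves_iff ε hε u (hne u) z hz, hsupp z hz]
    constructor <;> intro h <;> linarith
  · exact (contMDiffOn_sphereProj_strip (fun ε hε u hu => hσ.contDiffAt_displaced hε hu)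
      hσ.displaced_ne).congr fun q hq => hθ q.1 hq.1 q.2
  · have h1 : (fun u => supportMap T (θ ε u) (ζ (ε, (θ ε u : Euc d)))) =
        fun u : Sph d => tiltedSupport Γ τ ζ σ (ε, u) := by
      funext u
      have hy := hσ.displaced_ne ε hε u (hne u)
      have hy' := inv_pos.2 (norm_pos_iff.2 hy)
      rw [hsupp _ (hζ.mem ε hε _ (hne _)), hθ ε hε u, coe_sphereProj hy,
        hζ.smul ε hε _ hy _ hy', hΓ.smul _ _ _ hy']
      rfl
    rw [h1, projectedSlice_eq_range hΓ hslice hTI hζ hσ hε]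
    exact (hfield ε hε).isSupportParametrization hd
  · rw [hθ 0 h0 u, hσ.displaced_zero hδ (hne u), norm_eq_of_mem_sphere, inv_one, one_smul,
      sphereProj_coe]
  · have hnu : ‖(u : Euc d)‖ = 1 := norm_eq_of_mem_sphere u
    have h1 : deriv (fun z => supportMap T u z) z₀ = fderiv ℝ Γ ((u : Euc d), z₀) (0, 1) := by
      rw [← (hΓ.hasDerivAt (hne u) hz₀).deriv]
      refine Filter.EventuallyEq.deriv_eq ?_
      filter_upwards [isOpen_Ioo.mem_nhds hz₀] with z hz using hsupp z hz u
    have h2 := hasDerivAt_coe_sphereProj_comp u (hσ.hasDerivAt_displaced hζ hΓ hδ hz₀ hnu)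
      (by rw [hσ.displaced_zero hδ (hne u), hnu, inv_one, one_smul])
    rw [h1]
    refine (h2.congr_of_eventuallyEq ?_).congr_deriv ?_
    · filter_upwards [isOpen_Ioo.mem_nhds h0] with ε hε
      rw [hθ ε hε u]
    · rw [tangentialPart, inner_smul_left, conj_trivial, smul_sub, smul_smul]
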